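/- Let $d\ge 2$ and let $F$ be a probability distribution on $\mathrm{Sym}(d)$. Label the nodes $s$ of the infinite rooted $d$-ary tree (finite words over $\{0,\dots,d-1\}$, the root being the empty word) by independent random permutations $\alpha_s$ of $\{0,\dots,d-1\}$ with common law $F$. Let $f:[0,1]\to[0,1]$ be the (almost everywhere defined) measure-preserving bijection that sends the point with base-$d$ digits $x_1x_2x_3\dots$ to the point with digits $y_k=\alpha_{x_1\dots x_{k-1}}(x_k)$, $k\ge 1$, and let $\mu=\mu_F$ be the random permuton induced by $f$, i.e. $\mu(B\times C)=\lambda(B\cap f^{-1}(C))$ with $\lambda$ the Lebesgue measure on $[0,1]$. For a planar probability measure $\mu$ let $H_n(\mu)$ be the Shannon entropy of the random permutation in $\mathrm{Sym}(n)$ obtained by drawing $n$ independent points with law $\mu$ and reading their height ordering from left to right. Then there are a deterministic nonnegative sequence $(\rho_l)$ with $\rho_l=O(\log l)$ and a deterministic function $A:\mathbb R\to\mathbb R$, both depending only on $F$, such that almost surely the sequence $a(n)=H_n(\mu)/n$ is asymptotically log-periodic in base $d$ with limit $A$, meaning that the functions $x\mapsto a(\lfloor d^{x+m}\rfloor)$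 converge to $A$ locally uniformly on $\mathbb R$ as $m\to\infty$, and $$A(x)=\sum_{r=-\infty}^{\infty}\left(\sum_{l=1}^{\infty}\rho_{l+1}\frac{1-d^{-l}}{(l+1)!\,\log d}\,\Gamma\!\left(l-\frac{2\pi i r}{\log d}\right)\right)\exp(2\pi i r x)\qquad(x\in\mathbb R),$$ with all the series absolutely convergent. Moreover, $A$ is integrable on $[0,1]$ and $\int_0^1A(x)\,dx=0$ if and only if $F$ is a Dirac measure on the identity $(1,2,\dots,d)$ or on the reversal $(d,d-1,\dots,1)$. -/

import Mathlib

open MeasureTheory Filter Topology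

noncomputable section

/-! ### Sampling entropy of planar measures -/

/-- The configurations of `n` planar points that determine the pattern `σ`: some enumeration `τ`
lists the points from left to right, and the heights read in this order are in the same relative
order as `σ 0, σ 1, …` (in particular no two abscissas and no two heights coincide). -/
def patternSet {n : ℕ} (σ : Equiv.Perm (Fin n)) : Set (Fin n → ℝ × ℝ) :=
  {p | ∃ τ : Equiv.Perm (Fin n), StrictMono (fun i => (p (τ i)).1) ∧
    (∀ i j, (p (τ i)).2 < (p (τ j)).2 ↔ σ i < σ j)}

/-- The density `t(σ, μ)`: the probability that `n` independent points with law `μ` determine the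
pattern `σ`. -/
def patternDensity (μ : Measure (ℝ × ℝ)) {n : ℕ} (σ : Equiv.Perm (Fin n)) : ℝ :=
  (Measure.pi fun _ : Fin n => μ).real (patternSet σ)

/-- The sampling entropy `H_n(μ)`: the Shannon entropy (natural logarithm) of the random pattern
of `n` independent points with law `μ`. -/
def samplingEntropy (μ : Measure (ℝ × ℝ)) (n : ℕ) : ℝ :=
  ∑ σ : Equiv.Perm (Fin n), Real.negMulLog (patternDensity μ σ)

/-! ### Permutons from labellings of the `d`-ary tree -/

/-- A `Sym(d)`-labelling of the nodes of the infinite rooted `d`-ary tree; the nodes are the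
finite `d`-ary words, the root being the empty word. -/
abbrev TreeLabelling (d : ℕ) : Type := List (Fin d) → Equiv.Perm (Fin d)

/-- The action on infinite `d`-ary words of the tree automorphism encoded by a labelling: the
`k`-th letter is moved by the label of the node formed by the letters before it. -/
def treeAction {d : ℕ} (S : TreeLabelling d) (u : ℕ → Fin d) : ℕ → Fin d :=
  fun k => S (List.ofFn fun j : Fin k => u j) (u k)

/-- The (almost everywhere defined) measure-preserving bijection `f` of `[0, 1]` induced by a
labelling: it acts on the base `d` digits by the tree automorphism. For each `n`, it sends the
`d`-adic interval of level `n` with address `s` to the one whose address is the image of `s`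
under the automorphism, so that its graph lies in the base squares of every finite approximation
of the permuton. -/
def treeMap {d : ℕ} [NeZero d] (S : TreeLabelling d) (x : ℝ) : ℝ :=
  Real.ofDigits (treeAction S (Real.digits x d))

/-- The permuton `μ_S` induced by `f`, i.e. `μ_S (A ×ˢ B) = λ (A ∩ f ⁻¹' B)` with `λ` the Lebesgue
measure on `[0, 1]`. -/
def treePermuton {d : ℕ} [NeZero d] (S : TreeLabelling d) : Measure (ℝ × ℝ) :=
  (volume.restrict (Set.Icc (0 : ℝ) 1)).map fun x => (x, treeMap S x)

theorem measurable_treeMap {d : ℕ} [NeZero d] (S : TreeLabelling d) :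
    Measurable (treeMap S) := by
  have hdig : ∀ k, Measurable fun x : ℝ => Real.digits x d k := fun k =>
    (measurable_of_countable (Fin.ofNat d)).comp
      (Nat.measurable_floor.comp (measurable_id.mul_const _))
  have hterm : ∀ k, Measurable fun x : ℝ => treeAction S (Real.digits x d) k := by
    intro k
    have h : Measurable fun x : ℝ => fun j : Fin (k + 1) => Real.digits x d j :=
      measurable_pi_lambda _ fun j => hdig j
    exact (measurable_of_countable (fun v : Fin (k + 1) → Fin d =>
      S (List.ofFn fun j : Fin k => v j.castSucc) (v (Fin.last k)))).comp h
  exact Real.continuous_ofDigits.measurable.comp (measurable_pi_lambda _ hterm)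

instance isProbabilityMeasure_treePermuton {d : ℕ} [NeZero d] (S : TreeLabelling d) :
    IsProbabilityMeasure (treePermuton S) := by
  have : IsProbabilityMeasure (volume.restrict (Set.Icc (0 : ℝ) 1)) := ⟨by simp⟩
  exact Measure.isProbabilityMeasure_map
    (measurable_id.prodMk (measurable_treeMap S)).aemeasurable

instance permFinMeasurableSpace (d : ℕ) : MeasurableSpace (Equiv.Perm (Fin d)) := ⊤

/-- The law of the random labelling whose labels are independent with common law `F`. The random
permuton `μ_F` is `treePermuton S` for `S` drawn according to this law. -/
def labellingLaw {d : ℕ} (F : PMF (Equiv.Perm (Fin d))) : Measure (TreeLabelling d) :=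
  Measure.infinitePi fun _ : List (Fin d) => F.toMeasure

/-! ### Asymptotic log-periodicity -/

/-- The sequence `a` is asymptotically log-periodic in base `η` with log-periodic limit `A`: the
functions `x ↦ a [η ^ (x + m)]` converge to `A` locally uniformly on the real line as `m → ∞`. -/
def IsLogPeriodicLimit (η : ℝ) (a : ℕ → ℝ) (A : ℝ → ℝ) : Prop :=
  TendstoLocallyUniformly (fun (m : ℕ) (x : ℝ) => a ⌊η ^ (x + (m : ℝ))⌋₊) A atTop

/-- The `l`-th term, `ρ_{l+1} (1 - d^{-l}) / ((l+1)! log d) · Γ(l - 2πir / log d)`, of the series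
for the `r`-th Fourier coefficient (used for `l ≥ 1`). -/
def fourierTerm (d : ℕ) (ρ : ℕ → ℝ) (r : ℤ) (l : ℕ) : ℂ :=
  ((ρ (l + 1) * ((1 - ((d : ℝ) ^ l)⁻¹) / ((l + 1).factorial * Real.log d)) : ℝ) : ℂ) *
    Complex.Gamma ((l : ℂ) - 2 * (Real.pi : ℂ) * Complex.I * (r : ℂ) / ((Real.log d : ℝ) : ℂ))

end

/-!
Split the unit interval into the `d` cells of the first level. Given how many of the `n` points fall
into each cell, the pattern of the points determines, and is determined by, the patterns inside the
cells (`samePattern_sigma_iff`), and these are independent samples from the permutons of the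
subtrees. Hence `H_n(S)` is the mean of the sum of the entropies of the subtrees at the binomial cell
counts, plus a remainder `entropyGain n S`, the mutual information between the pattern and the cell
counts. It is nonnegative and at most the entropy of the counts, so it is `O(log n)`. Iterating over
all levels (`hasSum_treeEntropy`), `H_n(S)` becomes the sum over `k` of the binomial means, with
parameters `n` and `d ^ (-k)`, of the sums of the gains over the `d ^ k` nodes of level `k`.

The subtrees hanging from the nodes of a level are independent copies of the whole tree, so by a
variance estimate the level averages of the gains tend almost surely to the mean gains `meanGain F`
(`ae_tendsto_meanGain`). Along `n = ⌊d ^ (x + m)⌋`, level `m + j` has about `d ^ (x - j)` points per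
node, and the Poisson limit theorem with dominated convergence (`tendsto_tsum_levels`) gives the limit
`limitProfile F x`, the sum over `j : ℤ` of the Poisson means of the mean gains at `d ^ (x - j)`
divided by `d ^ (x - j)`.

This is a sum over integer translates of a function of the logarithmic scale, and Poisson summation
turns it into a Fourier series (`hasSum_gammaTerm_exp`). The coefficients are Mellin transforms of
Poisson means, that is, series of values of the Gamma function (`fourier_logProfile`); their absolute
summability follows from a bound on `|Γ(l + 1 + i s)|` obtained by comparing the values at `l` and at
about `2 l` through the functional equation (`gammaRatio_mul_le`).

The mean of the limit is the zeroth coefficient, a combination of the mean gains with positive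
weights, so it vanishes exactly if all mean gains do. Already the gain for two points then forces the
pattern of two points to be deterministic, which holds only if the labels are almost surely all the
identity or all the reversal (`forall_meanGain_eq_zero_iff`).
-/

/-! ### Patterns of finite planar configurations -/

/-- The planar configuration with abscissas `x` and heights `y`, indexed by an arbitrary type `ι`,
determines the pattern `σ`. For `ι = Fin n` this is membership in `patternSet σ`. -/
def HasPattern {ι : Type*} {n : ℕ} (x y : ι → ℝ) (σ : Equiv.Perm (Fin n)) : Prop :=
  ∃ τ : Fin n ≃ ι, StrictMono (fun i => x (τ i)) ∧ ∀ i j, y (τ i) < y (τ j) ↔ σ i < σ j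

/-- Two planar configurations are order-isomorphic: some bijection between the points preserves
both the order of the abscissas and the order of the heights. -/
def SamePattern {ι κ : Type*} (x y : ι → ℝ) (x' y' : κ → ℝ) : Prop :=
  ∃ e : ι ≃ κ, ∀ i j, (x i < x j ↔ x' (e i) < x' (e j)) ∧ (y i < y j ↔ y' (e i) < y' (e j))

theorem SamePattern.symm {ι κ : Type*} {x y : ι → ℝ} {x' y' : κ → ℝ}
    (h : SamePattern x y x' y') : SamePattern x' y' x y := by
  obtain ⟨e, he⟩ := h
  exact ⟨e.symm, fun i j => by
    have h := he (e.symm i) (e.symm j)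
    simp only [Equiv.apply_symm_apply] at h
    exact ⟨h.1.symm, h.2.symm⟩⟩

theorem HasPattern.congr {ι κ : Type*} {n : ℕ} {x y : ι → ℝ} {x' y' : κ → ℝ}
    (h : SamePattern x y x' y') {σ : Equiv.Perm (Fin n)} (hσ : HasPattern x y σ) :
    HasPattern x' y' σ := by
  obtain ⟨e, he⟩ := h
  obtain ⟨τ, h1, h2⟩ := hσ
  exact ⟨τ.trans e, fun i j hij => (he _ _).1.1 (h1 hij), fun i j =>
    (he _ _).2.symm.trans (h2 i j)⟩

theorem HasPattern.samePattern {ι κ : Type*} {n : ℕ} {x y : ι → ℝ} {x' y' : κ → ℝ}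
    {σ : Equiv.Perm (Fin n)} (h : HasPattern x y σ) (h' : HasPattern x' y' σ) :
    SamePattern x y x' y' := by
  obtain ⟨τ, h1, h2⟩ := h
  obtain ⟨τ', h1', h2'⟩ := h'
  refine ⟨τ.symm.trans τ', fun i j => ?_⟩
  obtain ⟨i, rfl⟩ := τ.surjective i
  obtain ⟨j, rfl⟩ := τ.surjective j
  simp only [Equiv.trans_apply, Equiv.symm_apply_apply]
  exact ⟨(StrictMono.lt_iff_lt h1 (a := i) (b := j)).trans (StrictMono.lt_iff_lt h1').symm,
    (h2 i j).trans (h2' i j).symm⟩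

theorem HasPattern.comp_equiv {ι κ : Type*} {n : ℕ} {x y : ι → ℝ} {σ : Equiv.Perm (Fin n)}
    (e : κ ≃ ι) : HasPattern (x ∘ e) (y ∘ e) σ ↔ HasPattern x y σ :=
  ⟨HasPattern.congr ⟨e, fun _ _ => by simp⟩,
    HasPattern.congr (SamePattern.symm ⟨e, fun _ _ => by simp⟩)⟩

theorem Fin.equiv_eq_of_strictMono {n : ℕ} {ι : Type*} {x : ι → ℝ} {τ τ' : Fin n ≃ ι}
    (h : StrictMono fun i => x (τ i)) (h' : StrictMono fun i => x (τ' i)) : τ = τ' := by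
  have hr : Set.range (fun i => x (τ i)) = Set.range (fun i => x (τ' i)) := by
    rw [← Function.comp_def x τ, ← Function.comp_def x τ', Set.range_comp, Set.range_comp]
    simp
  have hf := (StrictMono.range_inj h h').1 hr
  ext i
  have hx : x (τ i) = x (τ' i) := congrFun hf i
  obtain ⟨j, hj⟩ := τ'.surjective (τ i)
  rw [← hj] at hx ⊢
  rw [h'.injective hx]

theorem HasPattern.unique {ι : Type*} {n : ℕ} {x y : ι → ℝ} {σ σ' : Equiv.Perm (Fin n)}
    (h : HasPattern x y σ) (h' : HasPattern x y σ') : σ = σ' := by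
  obtain ⟨τ, h1, h2⟩ := h
  obtain ⟨τ', h1', h2'⟩ := h'
  obtain rfl := Fin.equiv_eq_of_strictMono h1 h1'
  have h3 : StrictMono fun i => σ' (σ.symm i) := fun i j hij => by
    rw [← h2', h2]; simpa using hij
  have h4 := (StrictMono.range_inj h3 (strictMono_id (α := Fin n))).1 (by
    rw [← Function.comp_def σ' σ.symm, Set.range_comp]; simp)
  ext i
  have := congrFun h4 (σ i)
  simp only [Equiv.symm_apply_apply, id] at this
  rw [this]

/-- The enumeration of finitely many points by increasing value of an injective function. -/
theorem exists_equiv_strictMono {ι : Type*} [Fintype ι] {n : ℕ} (hn : Fintype.card ι = n)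
    {x : ι → ℝ} (hx : Function.Injective x) : ∃ τ : Fin n ≃ ι, StrictMono fun i => x (τ i) := by
  let _ : LinearOrder ι := LinearOrder.lift' x hx
  refine ⟨(Fintype.orderIsoFinOfCardEq ι hn).toEquiv, fun i j hij => ?_⟩
  exact (Fintype.orderIsoFinOfCardEq ι hn).strictMono hij

theorem exists_hasPattern {ι : Type*} [Fintype ι] {n : ℕ} (hn : Fintype.card ι = n)
    {x y : ι → ℝ} (hx : Function.Injective x) (hy : Function.Injective y) :
    ∃ σ : Equiv.Perm (Fin n), HasPattern x y σ := by
  obtain ⟨τ, hτ⟩ := exists_equiv_strictMono hn hx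
  obtain ⟨τ', hτ'⟩ := exists_equiv_strictMono hn hy
  refine ⟨τ.trans τ'.symm, τ, hτ, fun i j => ?_⟩
  have := StrictMono.lt_iff_lt hτ' (a := τ'.symm (τ i)) (b := τ'.symm (τ j))
  simpa using this

/-- If two weakly monotone cell functions on a finite set ordered by `x` are exchanged by an order
isomorphism, they have equally large initial segments, so the second is at least the first. -/
theorem cell_le_of_orderIso {ι : Type*} [Fintype ι] {d : ℕ} {x x' : ι → ℝ} {cell : ι → Fin d}
    (hx : ∀ p q, cell p < cell q → x p < x q) (hx' : ∀ p q, cell p < cell q → x' p < x' q)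
    (e : ι ≃ ι) (he : ∀ p q, x p < x q ↔ x' (e p) < x' (e q)) (p : ι) :
    cell p ≤ cell (e p) := by
  classical
  -- if the cell dropped at `p`, then `e` would map the points whose image lies in a cell before
  -- that of `p` onto the points in these cells, but the former are strictly more numerous
  by_contra! hlt
  have hcard : (Finset.univ.filter fun q => cell q < cell p).card =
      (Finset.univ.filter fun q => cell (e q) < cell p).card := by
    refine (Finset.card_bij (fun q _ => e q) ?_ ?_ ?_).symm
    · intro q hq; simpa using hq
    · intro a _ b _ h; exact e.injective h
    · intro b hb; exact ⟨e.symm b, by simpa using hb, by simp⟩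
  refine absurd hcard (ne_of_lt (Finset.card_lt_card ?_))
  refine (Finset.ssubset_iff_of_subset ?_).2 ⟨p, by simpa using hlt, by simp⟩
  intro q hq
  simp only [Finset.mem_filter, Finset.mem_univ, true_and] at hq ⊢
  by_contra! hge
  exact lt_asymm ((he q p).1 (hx q p hq)) (hx' (e p) (e q) (hlt.trans_le hge))

theorem cell_eq_of_orderIso {ι : Type*} [Fintype ι] {d : ℕ} {x x' : ι → ℝ} {cell : ι → Fin d}
    (hx : ∀ p q, cell p < cell q → x p < x q) (hx' : ∀ p q, cell p < cell q → x' p < x' q)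
    (e : ι ≃ ι) (he : ∀ p q, x p < x q ↔ x' (e p) < x' (e q)) (p : ι) :
    cell (e p) = cell p := by
  refine le_antisymm ?_ (cell_le_of_orderIso hx hx' e he p)
  have := cell_le_of_orderIso hx' hx e.symm (fun p q => by
    simpa using (he (e.symm p) (e.symm q)).symm) (e p)
  simpa using this

/-- A configuration whose points lie in `d` vertical strips, and at the same time in `d` horizontal
strips permuted by `α`, is determined up to order isomorphism by its restrictions to the strips,
and conversely determines them (given the numbers of points in the strips). -/
theorem samePattern_sigma_iff {d : ℕ} {c : Fin d → ℕ} (α : Equiv.Perm (Fin d))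
    {x y x' y' : (Σ i, Fin (c i)) → ℝ}
    (hx : ∀ p q, p.1 < q.1 → x p < x q) (hx' : ∀ p q, p.1 < q.1 → x' p < x' q)
    (hy : ∀ p q, α p.1 < α q.1 → y p < y q) (hy' : ∀ p q, α p.1 < α q.1 → y' p < y' q) :
    SamePattern x y x' y' ↔ ∀ i, SamePattern (fun j => x ⟨i, j⟩) (fun j => y ⟨i, j⟩)
      (fun j => x' ⟨i, j⟩) (fun j => y' ⟨i, j⟩) := by
  constructor
  · rintro ⟨e, he⟩ i
    have hcell : ∀ p, (e p).1 = p.1 :=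
      cell_eq_of_orderIso (cell := Sigma.fst) hx hx' e fun p q => (he p q).1
    have hf : ∀ j, ∃ k, e ⟨i, j⟩ = ⟨i, k⟩ := fun j => by
      have h := hcell ⟨i, j⟩
      rcases hp : e ⟨i, j⟩ with ⟨i', k⟩
      rw [hp] at h
      obtain rfl : i' = i := h
      exact ⟨k, rfl⟩
    choose f hf using hf
    have hinj : Function.Injective f := fun a b hab => by
      have : e ⟨i, a⟩ = e ⟨i, b⟩ := by rw [hf, hf, hab]
      simpa using this
    refine ⟨Equiv.ofBijective f (Finite.injective_iff_bijective.1 hinj), fun a b => ?_⟩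
    have := he ⟨i, a⟩ ⟨i, b⟩
    simpa [hf] using this
  · intro h
    choose e he using h
    refine ⟨Equiv.sigmaCongrRight e, ?_⟩
    rintro ⟨i, a⟩ ⟨j, b⟩
    simp only [Equiv.sigmaCongrRight_apply]
    rcases lt_trichotomy i j with hij | rfl | hij
    · refine ⟨iff_of_true (hx _ _ hij) (hx' _ _ hij), ?_⟩
      rcases lt_or_gt_of_ne (α.injective.ne hij.ne) with hα | hα
      · exact iff_of_true (hy _ _ hα) (hy' _ _ hα)
      · exact iff_of_false (hy ⟨j, b⟩ ⟨i, a⟩ hα).not_gt (hy' ⟨j, _⟩ ⟨i, _⟩ hα).not_gt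
    · exact he i a b
    · refine ⟨iff_of_false (hx ⟨j, b⟩ ⟨i, a⟩ hij).not_gt (hx' ⟨j, _⟩ ⟨i, _⟩ hij).not_gt, ?_⟩
      rcases lt_or_gt_of_ne (α.injective.ne hij.ne) with hα | hα
      · exact iff_of_false (hy ⟨j, b⟩ ⟨i, a⟩ hα).not_gt (hy' ⟨j, _⟩ ⟨i, _⟩ hα).not_gt
      · exact iff_of_true (hy _ _ hα) (hy' _ _ hα)

/-! ### Shannon entropy of finite laws -/

/-- The Shannon entropy of a finite family of weights. -/
noncomputable def shannon {A : Type*} [Fintype A] (p : A → ℝ) : ℝ := ∑ a, Real.negMulLog (p a)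

theorem Real.negMulLog_add_le {x y : ℝ} (hx : 0 ≤ x) (hy : 0 ≤ y) :
    Real.negMulLog (x + y) ≤ Real.negMulLog x + Real.negMulLog y := by
  rcases hx.eq_or_lt with rfl | hx
  · simp
  rcases hy.eq_or_lt with rfl | hy
  · simp
  simp only [Real.negMulLog]
  have h1 : Real.log x ≤ Real.log (x + y) := Real.log_le_log hx (by linarith)
  have h2 : Real.log y ≤ Real.log (x + y) := Real.log_le_log hy (by linarith)
  nlinarith

theorem Real.negMulLog_sum_le {A : Type*} (s : Finset A) {f : A → ℝ} (hf : ∀ a, 0 ≤ f a) :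
    Real.negMulLog (∑ a ∈ s, f a) ≤ ∑ a ∈ s, Real.negMulLog (f a) := by
  classical
  induction s using Finset.induction_on with
  | empty => simp
  | insert a s ha ih =>
    rw [Finset.sum_insert ha, Finset.sum_insert ha]
    exact (Real.negMulLog_add_le (hf a) (Finset.sum_nonneg fun b _ => hf b)).trans
      (add_le_add_right ih _)

theorem shannon_nonneg {A : Type*} [Fintype A] {p : A → ℝ} (h0 : ∀ a, 0 ≤ p a)
    (h1 : ∀ a, p a ≤ 1) : 0 ≤ shannon p :=
  Finset.sum_nonneg fun a _ => Real.negMulLog_nonneg (h0 a) (h1 a)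

theorem shannon_le_log_card {A : Type*} [Fintype A] {p : A → ℝ} (h0 : ∀ a, 0 ≤ p a)
    (h1 : ∑ a, p a = 1) : shannon p ≤ Real.log (Fintype.card A) := by
  have hne : Nonempty A := by
    by_contra h
    rw [not_nonempty_iff] at h
    simp at h1
  have hN : (0 : ℝ) < Fintype.card A := by exact_mod_cast Fintype.card_pos
  have := Real.concaveOn_negMulLog.le_map_sum (t := Finset.univ) (w := fun _ : A =>
    (Fintype.card A : ℝ)⁻¹) (p := p) (fun _ _ => by positivity) (by simp [hN.ne'])
    (fun a _ => h0 a)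
  simp only [smul_eq_mul, ← Finset.mul_sum, h1, mul_one] at this
  rw [Real.negMulLog, Real.log_inv, neg_mul_neg] at this
  exact le_of_mul_le_mul_left this (by positivity)

/-- The mutual information between a finite mixture and its mixing variable is nonnegative. -/
theorem shannon_mixture_ge {A B : Type*} [Fintype A] [Fintype B] {p : A → ℝ} {q : A → B → ℝ}
    (hp : ∀ a, 0 ≤ p a) (hp1 : ∑ a, p a = 1) (hq : ∀ a b, 0 ≤ q a b) :
    ∑ a, p a * shannon (q a) ≤ shannon fun b => ∑ a, p a * q a b := by
  simp only [shannon, Finset.mul_sum]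
  rw [Finset.sum_comm]
  refine Finset.sum_le_sum fun b _ => ?_
  simpa using Real.concaveOn_negMulLog.le_map_sum (t := Finset.univ) (w := p)
    (p := fun a => q a b) (fun a _ => hp a) hp1 (fun a _ => hq a b)

/-- The mutual information between a finite mixture and its mixing variable is at most the entropy
of the mixing variable. -/
theorem shannon_mixture_le {A B : Type*} [Fintype A] [Fintype B] {p : A → ℝ} {q : A → B → ℝ}
    (hp : ∀ a, 0 ≤ p a) (hq : ∀ a b, 0 ≤ q a b) (hq1 : ∀ a, p a ≠ 0 → ∑ b, q a b = 1) :
    shannon (fun b => ∑ a, p a * q a b) ≤ shannon p + ∑ a, p a * shannon (q a) := by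
  have h1 : shannon (fun b => ∑ a, p a * q a b) ≤ ∑ b, ∑ a, Real.negMulLog (p a * q a b) :=
    Finset.sum_le_sum fun b _ => Real.negMulLog_sum_le _ fun a => mul_nonneg (hp a) (hq a b)
  refine h1.trans (le_of_eq ?_)
  rw [Finset.sum_comm, shannon, ← Finset.sum_add_distrib]
  refine Finset.sum_congr rfl fun a _ => ?_
  simp only [Real.negMulLog_mul, Finset.sum_add_distrib, ← Finset.sum_mul, ← Finset.mul_sum,
    shannon]
  by_cases h : p a = 0
  · simp [h]
  · rw [hq1 a h, one_mul]

theorem Real.negMulLog_prod {ι : Type*} [DecidableEq ι] (s : Finset ι) (f : ι → ℝ) :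
    Real.negMulLog (∏ i ∈ s, f i) =
      ∑ i ∈ s, ∏ j ∈ s, if j = i then Real.negMulLog (f j) else f j := by
  induction s using Finset.induction_on with
  | empty => simp
  | insert a s ha ih =>
    rw [Finset.prod_insert ha, Real.negMulLog_mul, Finset.sum_insert ha, Finset.prod_insert ha, ih,
      Finset.mul_sum, if_pos rfl, mul_comm]
    congr 1
    · congr 1
      exact Finset.prod_congr rfl fun j hj => by rw [if_neg (by rintro rfl; exact ha hj)]
    · refine Finset.sum_congr rfl fun i hi => ?_
      rw [Finset.prod_insert ha, if_neg (by rintro rfl; exact ha hi)]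

/-- Entropy is additive over independent families. -/
theorem shannon_pi {ι : Type*} [Fintype ι] [DecidableEq ι] {A : ι → Type*} [∀ i, Fintype (A i)]
    {p : ∀ i, A i → ℝ} (hp : ∀ i, ∑ a, p i a = 1) :
    shannon (fun a : ∀ i, A i => ∏ i, p i (a i)) = ∑ i, shannon (p i) := by
  simp only [shannon, Real.negMulLog_prod]
  rw [Finset.sum_comm]
  refine Finset.sum_congr rfl fun i _ => ?_
  have h := Finset.prod_univ_sum (fun i => (Finset.univ : Finset (A i)))
    (fun j a => if j = i then Real.negMulLog (p j a) else p j a)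
  rw [Fintype.piFinset_univ] at h
  rw [← h, Finset.prod_eq_single i]
  · simp
  · intro j _ hj
    simp [hj, hp]
  · simp

/-- Two finite families of events which, on an almost sure event, partition the probability space
into the same classes have the same entropy. -/
theorem shannon_eq_of_same_classes {Ω A B : Type*} [Fintype A] [Fintype B] [MeasurableSpace Ω]
    {P : Measure Ω} {E : A → Set Ω} {E' : B → Set Ω} {G : Set Ω} (hG : ∀ᵐ ω ∂P, ω ∈ G)
    (hE : ∀ ω ∈ G, ∃ a, ω ∈ E a) (hE' : ∀ ω ∈ G, ∃ b, ω ∈ E' b)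
    (huE : ∀ ω ∈ G, ∀ a a', ω ∈ E a → ω ∈ E a' → a = a')
    (huE' : ∀ ω ∈ G, ∀ b b', ω ∈ E' b → ω ∈ E' b' → b = b')
    (hEE' : ∀ ω ∈ G, ∀ ω' ∈ G, ∀ a b, ω ∈ E a → ω ∈ E' b → (ω' ∈ E a ↔ ω' ∈ E' b)) :
    shannon (fun a => P.real (E a)) = shannon fun b => P.real (E' b) := by
  have hne : ∀ {S : Set Ω}, Real.negMulLog (P.real S) ≠ 0 → ∃ ω ∈ G, ω ∈ S := by
    intro S hS
    by_contra! h
    apply hS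
    have : P S = 0 := measure_mono_null (fun ω hω hG' => h ω hG' hω) (ae_iff.1 hG)
    simp [Measure.real, this]
  have heq : ∀ ω ∈ G, ∀ a b, ω ∈ E a → ω ∈ E' b → P.real (E a) = P.real (E' b) := by
    intro ω hω a b ha hb
    refine measureReal_congr ?_
    filter_upwards [hG] with ω' hω'
    exact propext (hEE' ω hω ω' hω' a b ha hb)
  rcases isEmpty_or_nonempty B with hB | hB
  · have hA : ∀ a, Real.negMulLog (P.real (E a)) = 0 := fun a => by
      by_contra h
      obtain ⟨ω, h1, _⟩ := hne h
      exact hB.elim (hE' ω h1).choose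
    simp [shannon, hA]
  choose! f hf using hE'
  refine Finset.sum_bij_ne_zero (fun a _ ha => f (hne ha).choose) ?_ ?_ ?_ ?_
  · intros; simp
  · intro a _ ha a' _ ha' h
    obtain ⟨h1, h2⟩ := (hne ha).choose_spec
    obtain ⟨h1', h2'⟩ := (hne ha').choose_spec
    set ω := (hne ha).choose
    set ω' := (hne ha').choose
    have : ω' ∈ E a := (hEE' ω h1 ω' h1' a (f ω) h2 (hf ω h1)).2 (h ▸ hf ω' h1')
    exact huE ω' h1' _ _ this h2'
  · intro b _ hb
    obtain ⟨ω, h1, h2⟩ := hne hb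
    obtain ⟨a, ha⟩ := hE ω h1
    have hval := heq ω h1 a b ha h2
    have ha0 : Real.negMulLog (P.real (E a)) ≠ 0 := by rwa [hval]
    refine ⟨a, by simp, ha0, ?_⟩
    obtain ⟨h1', h2'⟩ := (hne ha0).choose_spec
    set ω' := (hne ha0).choose
    exact huE' ω' h1' _ _ (hf ω' h1') ((hEE' ω h1 ω' h1' a b ha h2).1 h2')
  · intro a _ ha
    obtain ⟨h1, h2⟩ := (hne ha).choose_spec
    exact congrArg Real.negMulLog (heq _ h1 a _ h2 (hf _ h1))

/-! ### Self-similarity of the tree map -/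

/-- The law of a uniform point of the unit interval. -/
noncomputable def unitLebesgue : Measure ℝ := volume.restrict (Set.Icc (0 : ℝ) 1)

instance : IsProbabilityMeasure unitLebesgue := ⟨by simp [unitLebesgue]⟩

/-- The labelling of the subtree hanging from the `i`-th child of the root. -/
def subtree {d : ℕ} (S : TreeLabelling d) (i : Fin d) : TreeLabelling d := fun w => S (i :: w)

/-- The affine map of the unit interval onto the `i`-th interval of the first `d`-adic level. -/
noncomputable def cellMap {d : ℕ} (i : Fin d) (x : ℝ) : ℝ := (x + i) / d

theorem measurable_cellMap {d : ℕ} (i : Fin d) : Measurable (cellMap i) :=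
  (measurable_id.add_const _).div_const _

theorem cellMap_injective {d : ℕ} (hd : 0 < d) (i : Fin d) : Function.Injective (cellMap i) := by
  intro x y h
  have : (d : ℝ) ≠ 0 := by positivity
  simp only [cellMap] at h
  field_simp at h
  linarith

theorem cellMap_lt_cellMap {d : ℕ} (hd : 0 < d) (i : Fin d) {x y : ℝ} :
    cellMap i x < cellMap i y ↔ x < y := by
  have : (0 : ℝ) < d := by positivity
  simp only [cellMap, div_lt_div_iff_of_pos_right this, add_lt_add_iff_right]

theorem cellMap_lt_of_lt {d : ℕ} {i j : Fin d} (hij : i < j) {x y : ℝ}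
    (hx : x < 1) (hy : 0 ≤ y) : cellMap i x < cellMap j y := by
  have hd : (0 : ℝ) < d := by exact_mod_cast i.pos
  have : (i : ℝ) + 1 ≤ j := by exact_mod_cast hij
  rw [cellMap, cellMap, div_lt_div_iff_of_pos_right hd]
  linarith

theorem digits_cellMap_zero {d : ℕ} [NeZero d] (i : Fin d) {x : ℝ} (hx : x ∈ Set.Ico (0 : ℝ) 1) :
    Real.digits (cellMap i x) d 0 = i := by
  have hd : (d : ℝ) ≠ 0 := by simpa using NeZero.ne d
  have h : ⌊x + (i : ℝ)⌋₊ = i := by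
    rw [Nat.floor_add_natCast hx.1, Nat.floor_eq_zero.2 hx.2, zero_add]
  simp only [Real.digits, cellMap, zero_add, pow_one, div_mul_cancel₀ _ hd, h]
  simp

theorem digits_cellMap_succ {d : ℕ} [NeZero d] (i : Fin d) {x : ℝ} (hx : x ∈ Set.Ico (0 : ℝ) 1)
    (k : ℕ) : Real.digits (cellMap i x) d (k + 1) = Real.digits x d k := by
  have hd : (d : ℝ) ≠ 0 := by simpa using NeZero.ne d
  have h : cellMap i x * (d : ℝ) ^ (k + 1 + 1) =
      x * (d : ℝ) ^ (k + 1) + ((i * d ^ (k + 1) : ℕ) : ℝ) := by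
    push_cast
    rw [cellMap]
    field_simp
    ring
  have hx0 : 0 ≤ x * (d : ℝ) ^ (k + 1) := mul_nonneg hx.1 (by positivity)
  simp only [Real.digits]
  rw [h, Nat.floor_add_natCast hx0]
  ext
  simp only [Fin.val_ofNat]
  generalize ⌊x * (d : ℝ) ^ (k + 1)⌋₊ = a
  rw [pow_succ d, ← mul_assoc, Nat.add_mul_mod_self_right]

theorem treeMap_cellMap {d : ℕ} [NeZero d] (S : TreeLabelling d) (i : Fin d) {x : ℝ}
    (hx : x ∈ Set.Ico (0 : ℝ) 1) :
    treeMap S (cellMap i x) = cellMap (S [] i) (treeMap (subtree S i) x) := by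
  have hd : (d : ℝ) ≠ 0 := by simpa using NeZero.ne d
  have h0 : treeAction S (Real.digits (cellMap i x) d) 0 = S [] i := by
    simp [treeAction, digits_cellMap_zero i hx]
  have h1 : (fun k => treeAction S (Real.digits (cellMap i x) d) (k + 1)) =
      treeAction (subtree S i) (Real.digits x d) := by
    funext k
    simp only [treeAction, subtree, List.ofFn_succ, Fin.val_zero, digits_cellMap_zero i hx,
      Fin.val_succ, digits_cellMap_succ i hx]
  rw [treeMap, Real.ofDigits_eq_sum_add_ofDigits _ 1, h1, Finset.sum_range_one, Real.ofDigitsTerm,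
    h0, cellMap, treeMap]
  field_simp
  ring

theorem treeMap_mem_Icc {d : ℕ} [NeZero d] (S : TreeLabelling d) (x : ℝ) :
    treeMap S x ∈ Set.Icc (0 : ℝ) 1 :=
  ⟨Real.ofDigits_nonneg _, Real.ofDigits_le_one _⟩

theorem ae_unitLebesgue_mem_Ico : ∀ᵐ x ∂unitLebesgue, x ∈ Set.Ico (0 : ℝ) 1 := by
  have h1 : ∀ᵐ x ∂unitLebesgue, x ∈ Set.Icc (0 : ℝ) 1 := ae_restrict_mem measurableSet_Icc
  have h2 : ∀ᵐ x ∂unitLebesgue, x ≠ 1 := by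
    refine ae_restrict_of_ae ?_
    simp [ae_iff]
  filter_upwards [h1, h2] with x hx hx1
  exact ⟨hx.1, lt_of_le_of_ne hx.2 hx1⟩

/-- The uniform law on the unit interval is the average of its images in the `d` cells. -/
theorem unitLebesgue_apply {d : ℕ} (hd : 0 < d) {s : Set ℝ} (hs : MeasurableSet s) :
    unitLebesgue s = ∑ i : Fin d, (d : ENNReal)⁻¹ * unitLebesgue (cellMap i ⁻¹' s) := by
  have hd0 : (d : ℝ) ≠ 0 := by positivity
  have key : ∀ i : Fin d, (d : ENNReal)⁻¹ * unitLebesgue (cellMap i ⁻¹' s) =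
      volume (s ∩ Set.Ico ((i : ℝ) / d) ((i + 1) / d)) := by
    intro i
    have h1 : unitLebesgue (cellMap i ⁻¹' s) =
        volume (cellMap i ⁻¹' (s ∩ Set.Ico ((i : ℝ) / d) ((i + 1) / d))) := by
      rw [unitLebesgue, ← restrict_Ico_eq_restrict_Icc,
        Measure.restrict_apply (measurable_cellMap i hs), Set.preimage_inter]
      congr 2
      ext x
      have : (0 : ℝ) < d := by positivity
      simp only [Set.mem_preimage, Set.mem_Ico, cellMap, div_le_div_iff_of_pos_right this,
        div_lt_div_iff_of_pos_right this]
      constructor <;> rintro ⟨_, _⟩ <;> constructor <;> linarith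
    have h2 : ∀ t : Set ℝ, volume (cellMap i ⁻¹' t) = (d : ENNReal) * volume t := by
      intro t
      have : cellMap i ⁻¹' t = (fun x => x + (i : ℝ)) ⁻¹' ((fun x => x * (d : ℝ)⁻¹) ⁻¹' t) := by
        ext x; simp [cellMap, div_eq_mul_inv]
      rw [this, measure_preimage_add_right, Real.volume_preimage_mul_right (inv_ne_zero hd0)]
      simp
    rw [h1, h2, ← mul_assoc, ENNReal.inv_mul_cancel (by simpa using hd.ne') (by simp), one_mul]
  have hdisj : Pairwise (Function.onFun Disjoint fun i : Fin d =>
      s ∩ Set.Ico ((i : ℝ) / d) ((i + 1) / d)) := by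
    have hlt : ∀ i j : Fin d, i < j → Disjoint (s ∩ Set.Ico ((i : ℝ) / d) ((i + 1) / d))
        (s ∩ Set.Ico ((j : ℝ) / d) ((j + 1) / d)) := by
      intro i j hij
      rw [Set.disjoint_left]
      rintro x ⟨_, hx⟩ ⟨_, hx'⟩
      have h1 : ((i : ℝ) + 1) / d ≤ j / d := by
        have : (i : ℝ) + 1 ≤ j := by exact_mod_cast hij
        gcongr
      exact absurd (hx.2.trans_le h1) hx'.1.not_gt
    intro i j hij
    rcases lt_or_gt_of_ne hij with h | h
    · exact hlt i j h
    · exact (hlt j i h).symm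
  have hunion : s ∩ Set.Ico (0 : ℝ) 1 = ⋃ i : Fin d, s ∩ Set.Ico ((i : ℝ) / d) ((i + 1) / d) := by
    rw [← Set.inter_iUnion]
    congr 1
    have hdpos : (0 : ℝ) < d := by positivity
    ext x
    simp only [Set.mem_iUnion, Set.mem_Ico, div_le_iff₀ hdpos, lt_div_iff₀ hdpos]
    constructor
    · rintro ⟨h0, h1⟩
      have hx0 : 0 ≤ x * d := by positivity
      refine ⟨⟨⌊x * d⌋₊, (Nat.floor_lt hx0).2 ?_⟩, Nat.floor_le hx0, Nat.lt_floor_add_one _⟩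
      nlinarith
    · rintro ⟨i, h0, h1⟩
      have h2 : (i : ℝ) + 1 ≤ d := by exact_mod_cast i.2
      have h3 : (0 : ℝ) ≤ i := by positivity
      constructor <;> nlinarith
  simp only [key]
  rw [unitLebesgue, ← restrict_Ico_eq_restrict_Icc, Measure.restrict_apply hs, hunion,
    measure_iUnion hdisj fun i => hs.inter measurableSet_Ico, tsum_fintype]

/-- The self-similarity of the uniform law for `n` independent points: their cells are independent
and uniform, and the points are independent and uniform in their cells. -/
theorem pi_unitLebesgue_apply {d : ℕ} (hd : 0 < d) {ι : Type*} [Fintype ι] [DecidableEq ι]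
    {E : Set (ι → ℝ)} (hE : MeasurableSet E) :
    (Measure.pi fun _ : ι => unitLebesgue) E = ∑ κ : ι → Fin d, ((d : ENNReal)⁻¹ ^ Fintype.card ι) *
      (Measure.pi fun _ : ι => unitLebesgue) {x | (fun j => cellMap (κ j) (x j)) ∈ E} := by
  have hmeas : ∀ κ : ι → Fin d, Measurable fun (x : ι → ℝ) j => cellMap (κ j) (x j) := fun κ =>
    measurable_pi_lambda _ fun j => (measurable_cellMap _).comp (measurable_pi_apply j)
  have h : (Measure.pi fun _ : ι => unitLebesgue) = ∑ κ : ι → Fin d,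
      ((d : ENNReal)⁻¹ ^ Fintype.card ι) •
        (Measure.pi fun _ : ι => unitLebesgue).map fun x j => cellMap (κ j) (x j) := by
    refine Measure.pi_eq fun s hs => ?_
    rw [Measure.finsetSum_apply]
    simp only [Measure.smul_apply, smul_eq_mul]
    simp only [unitLebesgue_apply hd (hs _)]
    rw [Finset.prod_univ_sum, Fintype.piFinset_univ]
    refine Finset.sum_congr rfl fun κ _ => ?_
    rw [Measure.map_apply (hmeas κ) (MeasurableSet.univ_pi hs), Finset.prod_mul_distrib,
      Finset.prod_const, Finset.card_univ]
    congr 1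
    rw [← Measure.pi_pi]
    congr 1
  conv_lhs => rw [h]
  rw [Measure.finsetSum_apply]
  refine Finset.sum_congr rfl fun κ _ => ?_
  rw [Measure.smul_apply, smul_eq_mul, Measure.map_apply (hmeas κ) hE]
  rfl

/-- One step of the tree bounds the mass of an atom of the image law by the masses of the atoms of
the image laws of the subtrees. -/
theorem unitLebesgue_treeMap_eq_le {d : ℕ} [NeZero d] (S : TreeLabelling d) (y : ℝ) :
    unitLebesgue {x | treeMap S x = y} ≤ ∑ i : Fin d, (d : ENNReal)⁻¹ *
      unitLebesgue {x | treeMap (subtree S i) x = d * y - S [] i} := by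
  have hd : (d : ℝ) ≠ 0 := by simpa using NeZero.ne d
  have hms : MeasurableSet {x | treeMap S x = y} :=
    measurable_treeMap S (measurableSet_singleton y)
  rw [unitLebesgue_apply (NeZero.pos d) hms]
  refine Finset.sum_le_sum fun i _ => ?_
  refine mul_le_mul_right (measure_mono_ae (μ := unitLebesgue) ?_) _
  filter_upwards [ae_unitLebesgue_mem_Ico] with x hx h
  have h' : treeMap S (cellMap i x) = y := h
  rw [treeMap_cellMap S i hx, cellMap, div_eq_iff hd] at h'
  change treeMap (subtree S i) x = _
  linarith

theorem ENNReal.eq_zero_of_forall_le_inv_pow {d : ℕ} (hd : 2 ≤ d) {a : ENNReal}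
    (h : ∀ k : ℕ, a ≤ (d : ENNReal)⁻¹ ^ k) : a = 0 := by
  refine le_antisymm (ge_of_tendsto' (ENNReal.tendsto_pow_atTop_nhds_zero_of_lt_one ?_) h) bot_le
  rw [ENNReal.inv_lt_one]
  exact_mod_cast hd

/-- If at most one child of each node can contribute to an atom, then there is no atom. -/
theorem unitLebesgue_treeMap_eq_zero_of_single {d : ℕ} [NeZero d] (hd : 2 ≤ d) (Y : Set ℝ)
    (hY : ∀ y ∈ Y, ∀ (S : TreeLabelling d), ∃ i₀ : Fin d, (d * y - S [] i₀) ∈ Y ∧ ∀ i ≠ i₀,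
      unitLebesgue {x | treeMap (subtree S i) x = d * y - S [] i} = 0)
    (S : TreeLabelling d) {y : ℝ} (hy : y ∈ Y) : unitLebesgue {x | treeMap S x = y} = 0 := by
  refine ENNReal.eq_zero_of_forall_le_inv_pow hd fun k => ?_
  induction k generalizing S y with
  | zero => simpa using prob_le_one
  | succ k ih =>
    obtain ⟨i₀, h1, h2⟩ := hY y hy S
    refine (unitLebesgue_treeMap_eq_le S y).trans ?_
    rw [Finset.sum_eq_single i₀ (fun i _ hi => by rw [h2 i hi, mul_zero]) (by simp), pow_succ']
    gcongr
    exact ih _ h1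

theorem unitLebesgue_treeMap_eq_zero_of_notMem {d : ℕ} [NeZero d] (S : TreeLabelling d) {y : ℝ}
    (hy : y ∉ Set.Icc (0 : ℝ) 1) : unitLebesgue {x | treeMap S x = y} = 0 := by
  have : {x | treeMap S x = y} = ∅ := by
    ext x
    simp only [Set.mem_ofPred_eq, Set.mem_empty_iff_false, iff_false]
    rintro rfl
    exact hy (treeMap_mem_Icc S x)
  simp [this]

/-- The image law of the tree map has no atoms. -/
theorem unitLebesgue_treeMap_eq {d : ℕ} [NeZero d] (hd : 2 ≤ d) (S : TreeLabelling d) (y : ℝ) :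
    unitLebesgue {x | treeMap S x = y} = 0 := by
  have hdR : (2 : ℝ) ≤ d := by exact_mod_cast hd
  -- the endpoints `0` and `1` are each attained through a single child of every node
  have h0 : ∀ S : TreeLabelling d, unitLebesgue {x | treeMap S x = 0} = 0 := fun S => by
    refine unitLebesgue_treeMap_eq_zero_of_single hd {0} ?_ S rfl
    rintro _ rfl S
    refine ⟨(S []).symm 0, by simp, fun i hi => unitLebesgue_treeMap_eq_zero_of_notMem _ ?_⟩
    have : 0 < (S [] i : ℕ) := Nat.pos_of_ne_zero fun h => hi (by
      rw [Equiv.eq_symm_apply]; ext; simpa using h)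
    have : (0 : ℝ) < (S [] i : ℕ) := by exact_mod_cast this
    rintro ⟨h, _⟩
    linarith
  have h1 : ∀ S : TreeLabelling d, unitLebesgue {x | treeMap S x = 1} = 0 := fun S => by
    refine unitLebesgue_treeMap_eq_zero_of_single hd {1} ?_ S rfl
    rintro _ rfl S
    have hlast : d - 1 < d := by omega
    refine ⟨(S []).symm ⟨d - 1, hlast⟩, ?_, fun i hi =>
      unitLebesgue_treeMap_eq_zero_of_notMem _ ?_⟩
    · simp [Nat.cast_sub (show 1 ≤ d by omega)]
    · have h2 : (S [] i : ℕ) ≠ d - 1 := fun h => hi (by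
        rw [Equiv.eq_symm_apply]; ext; simpa using h)
      have h3 : (S [] i : ℕ) + 2 ≤ d := by have := (S [] i).2; omega
      have : ((S [] i : ℕ) : ℝ) + 2 ≤ d := by exact_mod_cast h3
      rintro ⟨_, h⟩
      linarith
  rcases em (y ∈ Set.Icc (0 : ℝ) 1) with hy | hy
  swap
  · exact unitLebesgue_treeMap_eq_zero_of_notMem S hy
  refine unitLebesgue_treeMap_eq_zero_of_single hd Set.univ ?_ S (Set.mem_univ y)
  intro y _ S
  -- the values `d * y - a` are at mutual distance at least one, so besides the one in `[0, 1)`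
  -- only the endpoint `1` can be attained
  by_cases hex : ∃ i, d * y - S [] i ∈ Set.Ico (0 : ℝ) 1
  · obtain ⟨i₀, hi₀⟩ := hex
    refine ⟨i₀, Set.mem_univ _, fun i hi => ?_⟩
    have hne : (S [] i : ℕ) ≠ S [] i₀ := fun h => hi ((S []).injective (Fin.ext h))
    rcases lt_or_gt_of_ne hne with h | h
    · have h' : ((S [] i : ℕ) : ℝ) + 1 ≤ (S [] i₀ : ℕ) := by exact_mod_cast h
      by_cases hone : d * y - S [] i = 1
      · rw [hone]; exact h1 _
      · refine unitLebesgue_treeMap_eq_zero_of_notMem _ fun hmem => hone ?_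
        exact le_antisymm hmem.2 (by linarith [hi₀.1])
    · have h' : ((S [] i₀ : ℕ) : ℝ) + 1 ≤ (S [] i : ℕ) := by exact_mod_cast h
      refine unitLebesgue_treeMap_eq_zero_of_notMem _ fun hmem => ?_
      linarith [hmem.1, hi₀.2]
  · refine ⟨0, Set.mem_univ _, fun i _ => ?_⟩
    by_cases hone : d * y - S [] i = 1
    · rw [hone]; exact h1 _
    · refine unitLebesgue_treeMap_eq_zero_of_notMem _ fun hmem => hex ⟨i, hmem.1, ?_⟩
      exact lt_of_le_of_ne hmem.2 hone

theorem ae_treeMap_mem_Ico {d : ℕ} [NeZero d] (hd : 2 ≤ d) (S : TreeLabelling d) :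
    ∀ᵐ x ∂unitLebesgue, treeMap S x ∈ Set.Ico (0 : ℝ) 1 := by
  have h : ∀ᵐ x ∂unitLebesgue, treeMap S x ≠ 1 := by
    simpa [ae_iff] using unitLebesgue_treeMap_eq hd S 1
  filter_upwards [h] with x hx
  exact ⟨(treeMap_mem_Icc S x).1, lt_of_le_of_ne (treeMap_mem_Icc S x).2 hx⟩

/-- Independent variables with atomless laws are almost surely distinct. -/
theorem ae_pi_pairwise_ne {ι : Type*} [Fintype ι] {f : ι → ℝ → ℝ} (hf : ∀ i, Measurable (f i))
    (h0 : ∀ i y, unitLebesgue {x | f i x = y} = 0) :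
    ∀ᵐ x ∂(Measure.pi fun _ : ι => unitLebesgue), ∀ p q, p ≠ q → f p (x p) ≠ f q (x q) := by
  rw [ae_all_iff]; intro p
  rw [ae_all_iff]; intro q
  by_cases hpq : p = q
  · simp [hpq]
  have hind : ProbabilityTheory.IndepFun (fun x : ι → ℝ => x p) (fun x => x q)
      (Measure.pi fun _ : ι => unitLebesgue) :=
    (ProbabilityTheory.iIndepFun_pi (μ := fun _ : ι => unitLebesgue) (X := fun _ => id)
      (fun _ => aemeasurable_id)).indepFun hpq
  rw [ProbabilityTheory.indepFun_iff_map_prod_eq_prod_map_map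
    (measurable_pi_apply p).aemeasurable (measurable_pi_apply q).aemeasurable] at hind
  have hm : ∀ r : ι, (Measure.pi fun _ : ι => unitLebesgue).map (fun x => x r) = unitLebesgue :=
    fun r => (measurePreserving_eval (fun _ : ι => unitLebesgue) r).map_eq
  rw [hm, hm] at hind
  have hms : MeasurableSet {z : ℝ × ℝ | f p z.1 = f q z.2} :=
    measurableSet_eq_fun ((hf p).comp measurable_fst) ((hf q).comp measurable_snd)
  have hnull : (unitLebesgue.prod unitLebesgue) {z : ℝ × ℝ | f p z.1 = f q z.2} = 0 := by
    rw [Measure.measure_prod_null hms]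
    refine Filter.Eventually.of_forall fun a => ?_
    have := h0 q (f p a)
    simpa [Set.preimage, eq_comm] using this
  rw [← hind, Measure.map_apply (by fun_prop) hms] at hnull
  rw [ae_iff]
  simpa [hpq] using hnull

/-! ### The law of the pattern and its decomposition over the cells -/

theorem measurableSet_hasPattern {Ω ι : Type*} [MeasurableSpace Ω] [Finite ι] {n : ℕ}
    {X Y : Ω → ι → ℝ} (hX : ∀ i, Measurable fun ω => X ω i) (hY : ∀ i, Measurable fun ω => Y ω i)
    (σ : Equiv.Perm (Fin n)) : MeasurableSet {ω | HasPattern (X ω) (Y ω) σ} := by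
  have : {ω | HasPattern (X ω) (Y ω) σ} = ⋃ τ : Fin n ≃ ι,
      (⋂ i : Fin n, ⋂ j : Fin n, ⋂ _ : i < j, {ω | X ω (τ i) < X ω (τ j)}) ∩
      ⋂ i : Fin n, ⋂ j : Fin n, {ω | Y ω (τ i) < Y ω (τ j) ↔ σ i < σ j} := by
    ext ω
    simp only [HasPattern, StrictMono, Set.mem_ofPred_eq, Set.mem_iUnion, Set.mem_inter_iff,
      Set.mem_iInter]
  rw [this]
  have : Countable (Fin n ≃ ι) := inferInstance
  refine MeasurableSet.iUnion fun τ => MeasurableSet.inter ?_ ?_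
  · exact MeasurableSet.iInter fun i => MeasurableSet.iInter fun j => MeasurableSet.iInter fun _ =>
      measurableSet_lt (hX _) (hX _)
  · refine MeasurableSet.iInter fun i => MeasurableSet.iInter fun j => ?_
    by_cases h : σ i < σ j
    · simpa [h] using measurableSet_lt (hY (τ i)) (hY (τ j))
    · simpa [h] using measurableSet_le (hY (τ j)) (hY (τ i))

/-- The law of `n` independent uniform points of the unit interval. -/
noncomputable abbrev uniformPoints (ι : Type*) [Fintype ι] : Measure (ι → ℝ) :=
  Measure.pi fun _ : ι => unitLebesgue

theorem patternDensity_treePermuton {d : ℕ} [NeZero d] (S : TreeLabelling d) {n : ℕ}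
    (σ : Equiv.Perm (Fin n)) : patternDensity (treePermuton S) σ =
      (uniformPoints (Fin n)).real {x | HasPattern x (fun j => treeMap S (x j)) σ} := by
  have hm : Measurable fun x : ℝ => (x, treeMap S x) := measurable_id.prodMk (measurable_treeMap S)
  have hpi : (Measure.pi fun _ : Fin n => treePermuton S) =
      (uniformPoints (Fin n)).map fun x j => (x j, treeMap S (x j)) := by
    have : ∀ i : Fin n, SigmaFinite (unitLebesgue.map fun x : ℝ => (x, treeMap S x)) := fun _ =>
      inferInstanceAs (SigmaFinite (treePermuton S))
    exact (Measure.pi_map_pi (μ := fun _ : Fin n => unitLebesgue)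
      (f := fun _ x => (x, treeMap S x)) fun _ => hm.aemeasurable).symm
  have hset : MeasurableSet (patternSet σ) :=
    measurableSet_hasPattern (X := fun (p : Fin n → ℝ × ℝ) j => (p j).1) (Y := fun p j => (p j).2)
      (fun i => (measurable_pi_apply i).fst) (fun i => (measurable_pi_apply i).snd) σ
  have hm' : Measurable fun (x : Fin n → ℝ) j => (x j, treeMap S (x j)) :=
    measurable_pi_lambda _ fun j => hm.comp (measurable_pi_apply j)
  rw [patternDensity, hpi, map_measureReal_apply hm' hset]
  rfl

/-- Events that almost surely partition the space have total probability one. -/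
theorem sum_measureReal_eq_one {Ω A : Type*} [Fintype A] [MeasurableSpace Ω] {P : Measure Ω}
    [IsProbabilityMeasure P] {E : A → Set Ω} (hm : ∀ a, MeasurableSet (E a))
    (hex : ∀ᵐ ω ∂P, ∃ a, ω ∈ E a) (hu : ∀ ω a a', ω ∈ E a → ω ∈ E a' → a = a') :
    ∑ a, P.real (E a) = 1 := by
  rw [← measureReal_biUnion_finset (s := Finset.univ) ?_ fun a _ => hm a]
  · rw [measureReal_congr (t := Set.univ)]
    · simp
    · filter_upwards [hex] with ω hω
      exact propext ⟨fun _ => trivial, fun _ => by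
        obtain ⟨a, ha⟩ := hω
        exact Set.mem_biUnion (Finset.mem_coe.2 (Finset.mem_univ a)) ha⟩
  · intro a _ b _ hab
    exact Set.disjoint_left.2 fun ω h h' => hab (hu ω a b h h')

theorem unitLebesgue_eq_zero (y : ℝ) : unitLebesgue {x | x = y} = 0 := by
  have : unitLebesgue {x | x = y} ≤ volume {y} := Measure.restrict_apply_le _ _
  simpa using this

theorem ae_exists_hasPattern {d : ℕ} [NeZero d] (hd : 2 ≤ d) (S : TreeLabelling d) (n : ℕ) :
    ∀ᵐ x ∂uniformPoints (Fin n), ∃ σ : Equiv.Perm (Fin n),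
      HasPattern x (fun j => treeMap S (x j)) σ := by
  filter_upwards [ae_pi_pairwise_ne (ι := Fin n) (f := fun _ x => x) (fun _ => measurable_id)
    (fun _ => unitLebesgue_eq_zero), ae_pi_pairwise_ne (ι := Fin n) (f := fun _ => treeMap S)
    (fun _ => measurable_treeMap S) (fun _ => unitLebesgue_treeMap_eq hd S)] with x h1 h2
  exact exists_hasPattern (by simp) (fun i j h => by_contra fun hne => h1 i j hne h)
    (fun i j h => by_contra fun hne => h2 i j hne h)

theorem measurableSet_treePattern {d : ℕ} [NeZero d] (S : TreeLabelling d) {n : ℕ}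
    (σ : Equiv.Perm (Fin n)) :
    MeasurableSet {x : Fin n → ℝ | HasPattern x (fun j => treeMap S (x j)) σ} :=
  measurableSet_hasPattern (X := fun x => x) (Y := fun x j => treeMap S (x j))
    (fun i => measurable_pi_apply i)
    (fun i => (measurable_treeMap S).comp (measurable_pi_apply i)) σ

theorem sum_patternDensity {d : ℕ} [NeZero d] (hd : 2 ≤ d) (S : TreeLabelling d) (n : ℕ) :
    ∑ σ : Equiv.Perm (Fin n), patternDensity (treePermuton S) σ = 1 := by
  simp only [patternDensity_treePermuton]
  exact sum_measureReal_eq_one (fun σ => measurableSet_treePattern S σ)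
    (ae_exists_hasPattern hd S n) fun ω a a' h h' => by
      simp only [Set.mem_ofPred_eq] at h h'
      exact h.unique h'

/-- The probability of the pattern `σ` given the numbers `c i` of points in the cells of the first
level. -/
noncomputable def cellDensity {d : ℕ} [NeZero d] (S : TreeLabelling d) (c : Fin d → ℕ) {n : ℕ}
    (σ : Equiv.Perm (Fin n)) : ℝ :=
  (uniformPoints (Σ i, Fin (c i))).real {x | HasPattern (fun p => cellMap p.1 (x p))
    (fun p => treeMap S (cellMap p.1 (x p))) σ}

theorem measurableSet_cellPattern {d : ℕ} [NeZero d] (S : TreeLabelling d) {ι : Type*} [Finite ι]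
    (κ : ι → Fin d) {n : ℕ} (σ : Equiv.Perm (Fin n)) :
    MeasurableSet {x : ι → ℝ | HasPattern (fun j => cellMap (κ j) (x j))
      (fun j => treeMap S (cellMap (κ j) (x j))) σ} :=
  measurableSet_hasPattern (X := fun (x : ι → ℝ) j => cellMap (κ j) (x j))
    (Y := fun x j => treeMap S (cellMap (κ j) (x j)))
    (fun i => (measurable_cellMap _).comp (measurable_pi_apply i))
    (fun i => (measurable_treeMap S).comp ((measurable_cellMap _).comp (measurable_pi_apply i))) σ

/-- The number of points in each cell, for an assignment of the points to the cells. -/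
def cellCount {d n : ℕ} (κ : Fin n → Fin d) (i : Fin d) : ℕ :=
  Fintype.card {j // κ j = i}

theorem sum_cellCount {d n : ℕ} (κ : Fin n → Fin d) : ∑ i, cellCount κ i = n := by
  have := Fintype.card_congr (Equiv.sigmaFiberEquiv κ)
  rw [Fintype.card_sigma, Fintype.card_fin] at this
  exact this

/-- Given the cells of the points, the law of the pattern depends only on the numbers of points in
the cells. -/
theorem measureReal_cellPattern {d : ℕ} [NeZero d] (S : TreeLabelling d) {n : ℕ}
    (κ : Fin n → Fin d) (σ : Equiv.Perm (Fin n)) :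
    (uniformPoints (Fin n)).real {x | HasPattern (fun j => cellMap (κ j) (x j))
      (fun j => treeMap S (cellMap (κ j) (x j))) σ} = cellDensity S (cellCount κ) σ := by
  let e : (Σ i, Fin (cellCount κ i)) ≃ Fin n :=
    (Equiv.sigmaCongrRight fun i => (Fintype.equivFin {j // κ j = i}).symm).trans
      (Equiv.sigmaFiberEquiv κ)
  have he : ∀ p, κ (e p) = p.1 := fun p => ((Fintype.equivFin {j // κ j = p.1}).symm p.2).2
  have hmp := measurePreserving_piCongrLeft (fun _ : Fin n => unitLebesgue) e
  rw [cellDensity, measureReal_def, measureReal_def,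
    ← hmp.measure_preimage (measurableSet_cellPattern S κ σ).nullMeasurableSet]
  congr 2
  ext x
  have hx : ∀ p, MeasurableEquiv.piCongrLeft (fun _ : Fin n => ℝ) e x (e p) = x p := fun p =>
    Equiv.piCongrLeft_apply_apply (fun _ : Fin n => ℝ) e x p
  simp only [Set.mem_preimage, Set.mem_ofPred_eq]
  rw [← HasPattern.comp_equiv e]
  simp only [Function.comp_def, hx, he]

/-- The law of the pattern is a mixture over the cell assignments. -/
theorem patternDensity_eq_sum {d : ℕ} [NeZero d] (S : TreeLabelling d) {n : ℕ}
    (σ : Equiv.Perm (Fin n)) : patternDensity (treePermuton S) σ =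
      ∑ κ : Fin n → Fin d, ((d : ℝ) ^ n)⁻¹ * cellDensity S (cellCount κ) σ := by
  rw [patternDensity_treePermuton, measureReal_def,
    pi_unitLebesgue_apply (NeZero.pos d) (measurableSet_treePattern S σ), ENNReal.toReal_sum]
  · refine Finset.sum_congr rfl fun κ _ => ?_
    rw [ENNReal.toReal_mul, ← measureReal_def, ← measureReal_cellPattern]
    congr 1
    simp
  · intro κ _
    refine ENNReal.mul_ne_top (ENNReal.pow_ne_top ?_) (measure_ne_top _ _)
    simpa using NeZero.ne d

/-- Independence of the patterns in different cells. -/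
theorem measureReal_forall_hasPattern {d : ℕ} [NeZero d] (S : Fin d → TreeLabelling d)
    (c : Fin d → ℕ) (π : ∀ i, Equiv.Perm (Fin (c i))) :
    (uniformPoints (Σ i, Fin (c i))).real {x | ∀ i, HasPattern (fun j => x ⟨i, j⟩)
      (fun j => treeMap (S i) (x ⟨i, j⟩)) (π i)} =
    ∏ i, patternDensity (treePermuton (S i)) (π i) := by
  have hmap : (uniformPoints (Σ i, Fin (c i))).map (MeasurableEquiv.piCurry fun _ _ => ℝ) =
      Measure.pi fun i => uniformPoints (Fin (c i)) := by
    have := Measure.infinitePi_map_piCurry (X := fun (i : Fin d) (_ : Fin (c i)) => ℝ)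
      (μ := fun _ _ => unitLebesgue)
    simpa only [Measure.infinitePi_eq_pi] using this
  have hms : MeasurableSet (Set.univ.pi fun i => {x : Fin (c i) → ℝ |
      HasPattern x (fun j => treeMap (S i) (x j)) (π i)}) :=
    MeasurableSet.univ_pi fun i => measurableSet_treePattern (S i) (π i)
  have h2 : (Measure.pi fun i => uniformPoints (Fin (c i))).real
      (Set.univ.pi fun i => {x : Fin (c i) → ℝ |
        HasPattern x (fun j => treeMap (S i) (x j)) (π i)}) =
      ∏ i, patternDensity (treePermuton (S i)) (π i) := by
    rw [measureReal_def, Measure.pi_pi, ENNReal.toReal_prod]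
    simp only [patternDensity_treePermuton, measureReal_def]
  rw [← h2, ← hmap, map_measureReal_apply (MeasurableEquiv.measurable _) hms]
  congr 1
  ext x
  simp only [Set.mem_ofPred_eq, Set.mem_preimage, Set.mem_univ_pi]
  rfl

theorem unitLebesgue_treeMap_cellMap_eq {d : ℕ} [NeZero d] (hd : 2 ≤ d) (S : TreeLabelling d)
    (i : Fin d) (y : ℝ) : unitLebesgue {x | treeMap S (cellMap i x) = y} = 0 := by
  have hms : MeasurableSet {x | treeMap S x = y} :=
    measurable_treeMap S (measurableSet_singleton y)
  have h := unitLebesgue_apply (NeZero.pos d) hms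
  rw [unitLebesgue_treeMap_eq hd S y, eq_comm, Finset.sum_eq_zero_iff] at h
  rcases mul_eq_zero.1 (h i (Finset.mem_univ _)) with h' | h'
  · simp at h'
  · exact h'

/-- Given the cell counts, the pattern carries as much information as the independent patterns in
the cells. -/
theorem shannon_cellDensity {d : ℕ} [NeZero d] (hd : 2 ≤ d) (S : TreeLabelling d)
    (c : Fin d → ℕ) {n : ℕ} (hn : ∑ i, c i = n) :
    shannon (fun σ : Equiv.Perm (Fin n) => cellDensity S c σ) =
      ∑ i, samplingEntropy (treePermuton (subtree S i)) (c i) := by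
  have hd0 : 0 < d := NeZero.pos d
  have hcard : Fintype.card (Σ i, Fin (c i)) = n := by simp [hn]
  set P := uniformPoints (Σ i, Fin (c i))
  -- the generic configurations, on which all patterns are defined
  let G : Set ((Σ i, Fin (c i)) → ℝ) := {x | (∀ p q, p ≠ q → x p ≠ x q) ∧
    (∀ p q, p ≠ q → treeMap S (cellMap p.1 (x p)) ≠ treeMap S (cellMap q.1 (x q))) ∧
    (∀ p, x p ∈ Set.Ico (0 : ℝ) 1 ∧ treeMap (subtree S p.1) (x p) ∈ Set.Ico (0 : ℝ) 1)}
  have hG : ∀ᵐ x ∂P, x ∈ G := by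
    have h3 : ∀ᵐ x ∂P, ∀ p, x p ∈ Set.Ico (0 : ℝ) 1 ∧
        treeMap (subtree S p.1) (x p) ∈ Set.Ico (0 : ℝ) 1 := by
      rw [ae_all_iff]
      intro p
      exact (Measure.tendsto_eval_ae_ae (μ := fun _ : (Σ i, Fin (c i)) => unitLebesgue)
        (i := p)).eventually (ae_unitLebesgue_mem_Ico.and (ae_treeMap_mem_Ico hd (subtree S p.1)))
    filter_upwards [ae_pi_pairwise_ne (ι := Σ i, Fin (c i)) (f := fun _ x => x)
      (fun _ => measurable_id) (fun _ => unitLebesgue_eq_zero),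
      ae_pi_pairwise_ne (ι := Σ i, Fin (c i)) (f := fun p x => treeMap S (cellMap p.1 x))
      (fun p => (measurable_treeMap S).comp (measurable_cellMap p.1))
      (fun p y => unitLebesgue_treeMap_cellMap_eq hd S p.1 y), h3] with x h1 h2 h3
    exact ⟨h1, h2, h3⟩
  have hheight : ∀ x ∈ G, ∀ p, treeMap S (cellMap p.1 (x p)) =
      cellMap (S [] p.1) (treeMap (subtree S p.1) (x p)) := fun x hx p =>
    treeMap_cellMap S p.1 (hx.2.2 p).1
  have hiff : ∀ x ∈ G, ∀ x' ∈ G, SamePattern (fun p => cellMap p.1 (x p))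
      (fun p => treeMap S (cellMap p.1 (x p))) (fun p => cellMap p.1 (x' p))
      (fun p => treeMap S (cellMap p.1 (x' p))) ↔
      ∀ i, SamePattern (fun j => x ⟨i, j⟩) (fun j => treeMap (subtree S i) (x ⟨i, j⟩))
        (fun j => x' ⟨i, j⟩) (fun j => treeMap (subtree S i) (x' ⟨i, j⟩)) := by
    intro x hx x' hx'
    rw [samePattern_sigma_iff (S [])]
    · have hlt : ∀ z ∈ G, ∀ i j k, treeMap S (cellMap i (z ⟨i, j⟩)) <
          treeMap S (cellMap i (z ⟨i, k⟩)) ↔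
          treeMap (subtree S i) (z ⟨i, j⟩) < treeMap (subtree S i) (z ⟨i, k⟩) := by
        intro z hz i j k
        have hj := hheight z hz ⟨i, j⟩
        have hk := hheight z hz ⟨i, k⟩
        simp only at hj hk
        rw [hj, hk, cellMap_lt_cellMap hd0]
      simp only [hlt x hx, hlt x' hx', SamePattern, cellMap_lt_cellMap hd0]
    · exact fun p q h => cellMap_lt_of_lt h (hx.2.2 p).1.2 (hx.2.2 q).1.1
    · exact fun p q h => cellMap_lt_of_lt h (hx'.2.2 p).1.2 (hx'.2.2 q).1.1
    · intro p q h
      rw [hheight x hx, hheight x hx]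
      exact cellMap_lt_of_lt h (hx.2.2 p).2.2 (hx.2.2 q).2.1
    · intro p q h
      rw [hheight x' hx', hheight x' hx']
      exact cellMap_lt_of_lt h (hx'.2.2 p).2.2 (hx'.2.2 q).2.1
  have hinj : ∀ x ∈ G, ∀ i, (Function.Injective fun j => x ⟨i, j⟩) ∧
      Function.Injective fun j => treeMap (subtree S i) (x ⟨i, j⟩) := by
    intro x hx i
    refine ⟨fun a b hab => by_contra fun hne => hx.1 ⟨i, a⟩ ⟨i, b⟩ (by simpa using hne) hab,
      fun a b hab => by_contra fun hne => hx.2.1 ⟨i, a⟩ ⟨i, b⟩ (by simpa using hne) ?_⟩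
    rw [hheight x hx, hheight x hx]
    exact congrArg (cellMap (S [] i)) hab
  have hinj' : ∀ x ∈ G, Function.Injective fun p : (Σ i, Fin (c i)) => cellMap p.1 (x p) := by
    rintro x hx ⟨i, a⟩ ⟨j, b⟩ hab
    rcases lt_trichotomy i j with hij | rfl | hij
    · exact absurd hab (cellMap_lt_of_lt hij (hx.2.2 _).1.2 (hx.2.2 _).1.1).ne
    · exact by_contra fun hne => hx.1 _ _ hne (cellMap_injective hd0 i hab)
    · exact absurd hab (cellMap_lt_of_lt hij (hx.2.2 _).1.2 (hx.2.2 _).1.1).ne'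
  have key := shannon_eq_of_same_classes (P := P) (G := G)
    (E := fun σ : Equiv.Perm (Fin n) => {x | HasPattern (fun p => cellMap p.1 (x p))
      (fun p => treeMap S (cellMap p.1 (x p))) σ})
    (E' := fun π : ∀ i, Equiv.Perm (Fin (c i)) => {x | ∀ i, HasPattern (fun j => x ⟨i, j⟩)
      (fun j => treeMap (subtree S i) (x ⟨i, j⟩)) (π i)}) hG ?_ ?_ ?_ ?_ ?_
  · calc shannon (fun σ : Equiv.Perm (Fin n) => cellDensity S c σ) = _ := key
      _ = shannon fun π : ∀ i, Equiv.Perm (Fin (c i)) =>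
          ∏ i, patternDensity (treePermuton (subtree S i)) (π i) := by
        congr 1
        funext π
        exact measureReal_forall_hasPattern (fun i => subtree S i) c π
      _ = _ := shannon_pi fun i => sum_patternDensity hd (subtree S i) (c i)
  · exact fun x hx => exists_hasPattern hcard (hinj' x hx) fun p q h =>
      by_contra fun hne => hx.2.1 p q hne h
  · intro x hx
    choose π hπ using fun i => exists_hasPattern (n := c i) (by simp) (hinj x hx i).1 (hinj x hx i).2
    exact ⟨π, hπ⟩
  · intro x _ σ σ' h h'
    simp only [Set.mem_ofPred_eq] at h h'
    exact h.unique h'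
  · exact fun x _ π π' h h' => funext fun i => HasPattern.unique (h i) (h' i)
  · intro x hx x' hx' σ π hσ hπ
    constructor
    · intro hσ'
      have := (hiff x hx x' hx').1 (HasPattern.samePattern hσ hσ')
      exact fun i => (hπ i).congr (this i)
    · intro hπ'
      exact HasPattern.congr ((hiff x hx x' hx').2 fun i => (hπ i).samePattern (hπ' i)) hσ

theorem sum_cellDensity {d : ℕ} [NeZero d] (hd : 2 ≤ d) (S : TreeLabelling d)
    (c : Fin d → ℕ) {n : ℕ} (hn : ∑ i, c i = n) :
    ∑ σ : Equiv.Perm (Fin n), cellDensity S c σ = 1 := by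
  have hcell : ∀ (i : Fin d) (y : ℝ), unitLebesgue {x | cellMap i x = y} = 0 := fun i y => by
    by_cases h : ∃ x, cellMap i x = y
    · obtain ⟨x₀, rfl⟩ := h
      simpa only [(cellMap_injective (NeZero.pos d) i).eq_iff] using unitLebesgue_eq_zero x₀
    · push Not at h
      simp [h]
  refine sum_measureReal_eq_one (fun σ => measurableSet_cellPattern S _ σ) ?_
    fun ω a a' h h' => by
      simp only [Set.mem_ofPred_eq] at h h'
      exact h.unique h'
  filter_upwards [ae_pi_pairwise_ne (ι := Σ i, Fin (c i)) (f := fun p x => cellMap p.1 x)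
      (fun p => measurable_cellMap p.1) (fun p y => hcell p.1 y),
    ae_pi_pairwise_ne (ι := Σ i, Fin (c i)) (f := fun p x => treeMap S (cellMap p.1 x))
      (fun p => (measurable_treeMap S).comp (measurable_cellMap p.1))
      (fun p y => unitLebesgue_treeMap_cellMap_eq hd S p.1 y)] with x h1 h2
  exact exists_hasPattern (by simp [hn]) (fun p q h => by_contra fun hne => h1 p q hne h)
    (fun p q h => by_contra fun hne => h2 p q hne h)

/-! ### Binomial means -/

/-- The mean of `h` under the binomial law with parameters `n` and `p`, defined by conditioning on
the first trial. -/
noncomputable def binomialMean (p : ℝ) : (ℕ → ℝ) → ℕ → ℝ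
  | h, 0 => h 0
  | h, n + 1 => (1 - p) * binomialMean p h n + p * binomialMean p (fun l => h (l + 1)) n

theorem binomialMean_sum {p : ℝ} {A : Type*} (s : Finset A) (h : A → ℕ → ℝ) (n : ℕ) :
    binomialMean p (fun l => ∑ a ∈ s, h a l) n = ∑ a ∈ s, binomialMean p (h a) n := by
  induction n generalizing h with
  | zero => simp [binomialMean]
  | succ n ih =>
    simp only [binomialMean, ih, Finset.mul_sum, Finset.sum_add_distrib]

theorem binomialMean_add {p : ℝ} (h g : ℕ → ℝ) (n : ℕ) :
    binomialMean p (fun l => h l + g l) n = binomialMean p h n + binomialMean p g n := by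
  induction n generalizing h g with
  | zero => simp [binomialMean]
  | succ n ih =>
    simp only [binomialMean, ih]
    ring

theorem binomialMean_const_mul {p : ℝ} (c : ℝ) (h : ℕ → ℝ) (n : ℕ) :
    binomialMean p (fun l => c * h l) n = c * binomialMean p h n := by
  induction n generalizing h with
  | zero => simp [binomialMean]
  | succ n ih =>
    simp only [binomialMean, ih]
    ring

theorem binomialMean_const {p : ℝ} (c : ℝ) (n : ℕ) : binomialMean p (fun _ => c) n = c := by
  induction n with
  | zero => simp [binomialMean]
  | succ n ih => simp only [binomialMean, ih]; ring

theorem binomialMean_mono {p : ℝ} (h0 : 0 ≤ p) (h1 : p ≤ 1) {h g : ℕ → ℝ} (hgh : ∀ l, h l ≤ g l)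
    (n : ℕ) : binomialMean p h n ≤ binomialMean p g n := by
  induction n generalizing h g with
  | zero => exact hgh 0
  | succ n ih =>
    simp only [binomialMean]
    have := ih hgh
    have := ih fun l => hgh (l + 1)
    have : 0 ≤ 1 - p := by linarith
    gcongr

theorem binomialMean_nonneg {p : ℝ} (h0 : 0 ≤ p) (h1 : p ≤ 1) {h : ℕ → ℝ} (hh : ∀ l, 0 ≤ h l)
    (n : ℕ) : 0 ≤ binomialMean p h n := by
  simpa only [binomialMean_const] using binomialMean_mono h0 h1 (h := fun _ => 0) hh n

theorem binomialMean_natCast {p : ℝ} (n : ℕ) :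
    binomialMean p (fun l => (l : ℝ)) n = n * p := by
  induction n with
  | zero => simp [binomialMean]
  | succ n ih =>
    have h2 : binomialMean p (fun l : ℕ => ((l + 1 : ℕ) : ℝ)) n = n * p + 1 := by
      simp only [Nat.cast_add, Nat.cast_one, binomialMean_add, ih, binomialMean_const]
    simp only [binomialMean]
    rw [ih, h2]
    push_cast
    ring

theorem binomialMean_mul_pred {p : ℝ} (n : ℕ) :
    binomialMean p (fun l => (l : ℝ) * (l - 1)) n = n * (n - 1) * p ^ 2 := by
  induction n with
  | zero => simp [binomialMean]
  | succ n ih =>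
    have h2 : binomialMean p (fun l : ℕ => ((l + 1 : ℕ) : ℝ) * (((l + 1 : ℕ) : ℝ) - 1)) n =
        n * (n - 1) * p ^ 2 + 2 * (n * p) := by
      have : (fun l : ℕ => ((l + 1 : ℕ) : ℝ) * (((l + 1 : ℕ) : ℝ) - 1)) =
          fun l : ℕ => (l : ℝ) * (l - 1) + 2 * l := by
        funext l; push_cast; ring
      rw [this, binomialMean_add, ih, binomialMean_const_mul, binomialMean_natCast]
    simp only [binomialMean]
    rw [ih, h2]
    push_cast
    ring

/-- A binomial number of trials with a further thinning is again binomial. -/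
theorem binomialMean_binomialMean (p q : ℝ) (h : ℕ → ℝ) (n : ℕ) :
    binomialMean p (binomialMean q h) n = binomialMean (p * q) h n := by
  induction n generalizing h with
  | zero => simp [binomialMean]
  | succ n ih =>
    simp only [binomialMean, ih]
    rw [binomialMean_add, binomialMean_const_mul, binomialMean_const_mul, ih, ih]
    ring

theorem binomialMean_eq_sum (p : ℝ) (h : ℕ → ℝ) (n : ℕ) : binomialMean p h n =
    ∑ l ∈ Finset.range (n + 1), n.choose l * p ^ l * (1 - p) ^ (n - l) * h l := by
  have key : binomialMean p h n = ∑ ij ∈ Finset.HasAntidiagonal.antidiagonal n,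
      (n.choose ij.1 : ℝ) * (p ^ ij.1 * (1 - p) ^ ij.2 * h ij.1) := by
    induction n generalizing h with
    | zero => simp [binomialMean]
    | succ n ih =>
      rw [Finset.sum_antidiagonal_choose_succ_mul fun i j => p ^ i * (1 - p) ^ j * h i]
      simp only [binomialMean]
      rw [ih, ih fun l => h (l + 1), Finset.mul_sum, Finset.mul_sum]
      congr 1
      · exact Finset.sum_congr rfl fun _ _ => by ring
      · refine Finset.sum_congr rfl fun ij hij => ?_
        rw [Nat.choose_symm_of_eq_add (Finset.HasAntidiagonal.mem_antidiagonal.1 hij).symm]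
        ring
  rw [key, Finset.Nat.sum_antidiagonal_eq_sum_range_succ_mk]
  exact Finset.sum_congr rfl fun _ _ => by ring

/-! ### The entropy recursion -/

theorem cellCount_eq_sum {d n : ℕ} (κ : Fin n → Fin d) (i : Fin d) :
    cellCount κ i = ∑ j, if κ j = i then 1 else 0 := by
  rw [cellCount, Fintype.card_subtype, Finset.card_filter]

theorem cellCount_cons {d n : ℕ} (a : Fin d) (κ : Fin n → Fin d) (i : Fin d) :
    cellCount (Fin.cons a κ : Fin (n + 1) → Fin d) i =
      if a = i then cellCount κ i + 1 else cellCount κ i := by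
  simp only [cellCount_eq_sum, Fin.sum_univ_succ, Fin.cons_zero, Fin.cons_succ]
  split_ifs <;> ring

/-- For a uniform random assignment of `n` points to `d` cells, the number of points in a given
cell is binomial. -/
theorem sum_cellCount_eq_binomialMean {d : ℕ} (hd : 0 < d) (i : Fin d) (h : ℕ → ℝ) (n : ℕ) :
    ∑ κ : Fin n → Fin d, ((d : ℝ) ^ n)⁻¹ * h (cellCount κ i) = binomialMean (d : ℝ)⁻¹ h n := by
  have hd0 : (d : ℝ) ≠ 0 := by positivity
  induction n generalizing h with
  | zero => simp [binomialMean, cellCount_eq_sum]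
  | succ n ih =>
    rw [← (Fin.consEquiv fun _ : Fin (n + 1) => Fin d).sum_comp, Fintype.sum_prod_type]
    have hc : ∀ (a : Fin d) (κ : Fin n → Fin d),
        cellCount ((Fin.consEquiv fun _ : Fin (n + 1) => Fin d) (a, κ)) i =
          if a = i then cellCount κ i + 1 else cellCount κ i := fun a κ => cellCount_cons a κ i
    simp only [hc, apply_ite h]
    rw [← Finset.add_sum_erase _ _ (Finset.mem_univ i), Finset.sum_congr (rfl : Finset.univ.erase i = _)
      (g := fun _ => (d : ℝ)⁻¹ * binomialMean (d : ℝ)⁻¹ h n)]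
    · simp only [if_true, Finset.sum_const, Finset.card_erase_of_mem (Finset.mem_univ i),
        Finset.card_univ, Fintype.card_fin, nsmul_eq_mul, binomialMean]
      rw [← ih fun l => h (l + 1), Nat.cast_sub (by omega), pow_succ, Finset.mul_sum, add_comm]
      congr 1
      · push_cast
        field_simp
      · exact Finset.sum_congr rfl fun _ _ => by field_simp
    · intro a ha
      simp only [if_neg (Finset.ne_of_mem_erase ha)]
      rw [← ih h, Finset.mul_sum, pow_succ]
      exact Finset.sum_congr rfl fun _ _ => by field_simp

/-- The sampling entropy of the permuton of a labelling. -/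
noncomputable def treeEntropy {d : ℕ} [NeZero d] (n : ℕ) (S : TreeLabelling d) : ℝ :=
  samplingEntropy (treePermuton S) n

/-- The mutual information between the pattern of `n` points and the numbers of points in the
cells of the first level: the entropy of the pattern minus its conditional entropy. -/
noncomputable def entropyGain {d : ℕ} [NeZero d] (n : ℕ) (S : TreeLabelling d) : ℝ :=
  treeEntropy n S - ∑ i, binomialMean (d : ℝ)⁻¹ (fun l => treeEntropy l (subtree S i)) n

theorem sum_binomialMean_treeEntropy {d : ℕ} [NeZero d] (hd : 2 ≤ d) (n : ℕ)
    (S : TreeLabelling d) :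
    ∑ i, binomialMean (d : ℝ)⁻¹ (fun l => treeEntropy l (subtree S i)) n =
      ∑ κ : Fin n → Fin d, ((d : ℝ) ^ n)⁻¹ *
        shannon (fun σ : Equiv.Perm (Fin n) => cellDensity S (cellCount κ) σ) := by
  have h := fun i => sum_cellCount_eq_binomialMean (NeZero.pos d) i
    (fun l => treeEntropy l (subtree S i)) n
  simp only [← h]
  rw [Finset.sum_comm]
  refine Finset.sum_congr rfl fun κ _ => ?_
  rw [shannon_cellDensity hd S _ (sum_cellCount κ), Finset.mul_sum]
  rfl

theorem cellDensity_nonneg {d : ℕ} [NeZero d] (S : TreeLabelling d) (c : Fin d → ℕ) {n : ℕ}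
    (σ : Equiv.Perm (Fin n)) : 0 ≤ cellDensity S c σ := measureReal_nonneg

theorem sum_cellWeight {d : ℕ} (hd : 0 < d) (n : ℕ) :
    ∑ _κ : Fin n → Fin d, ((d : ℝ) ^ n)⁻¹ = 1 := by
  have hd0 : (d : ℝ) ≠ 0 := by positivity
  simp [hd0]

/-- Conditioning on the cells of the individual points has the same effect as conditioning on their
numbers, so the gain is a mutual information. -/
theorem entropyGain_nonneg {d : ℕ} [NeZero d] (hd : 2 ≤ d) (n : ℕ) (S : TreeLabelling d) :
    0 ≤ entropyGain n S := by
  rw [entropyGain, sum_binomialMean_treeEntropy hd, sub_nonneg]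
  refine (shannon_mixture_ge (fun _ => by positivity) (sum_cellWeight (NeZero.pos d) n)
    fun κ σ => cellDensity_nonneg S (cellCount κ) σ).trans (le_of_eq ?_)
  simp only [← patternDensity_eq_sum]
  rfl

/-- The mutual information is at most the entropy of the cell counts, which take at most
`(n + 1) ^ d` values. -/
theorem entropyGain_le {d : ℕ} [NeZero d] (hd : 2 ≤ d) (n : ℕ) (S : TreeLabelling d) :
    entropyGain n S ≤ d * Real.log (n + 1) := by
  classical
  have hle : ∀ (κ : Fin n → Fin d) i, cellCount κ i < n + 1 := fun κ i => by
    have := Finset.single_le_sum (f := cellCount κ) (fun _ _ => Nat.zero_le _) (Finset.mem_univ i)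
    rw [sum_cellCount] at this
    omega
  let cnt : (Fin n → Fin d) → Fin d → Fin (n + 1) := fun κ i => ⟨cellCount κ i, hle κ i⟩
  -- the law of the cell counts
  let p : (Fin d → Fin (n + 1)) → ℝ := fun c => ∑ κ with cnt κ = c, ((d : ℝ) ^ n)⁻¹
  have hsum : ∀ g : (Fin d → ℕ) → ℝ, ∑ κ : Fin n → Fin d, ((d : ℝ) ^ n)⁻¹ * g (cellCount κ) =
      ∑ c, p c * g fun i => c i := by
    intro g
    rw [← Finset.sum_fiberwise _ cnt]
    refine Finset.sum_congr rfl fun c _ => ?_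
    rw [Finset.sum_mul]
    refine Finset.sum_congr rfl fun κ hκ => ?_
    rw [← (Finset.mem_filter.1 hκ).2]
  have hp0 : ∀ c, 0 ≤ p c := fun c => Finset.sum_nonneg fun _ _ => by positivity
  have hp1 : ∑ c, p c = 1 := by
    have := hsum fun _ => 1
    simp only [mul_one] at this
    rw [← this, sum_cellWeight (NeZero.pos d)]
  rw [entropyGain, sum_binomialMean_treeEntropy hd, sub_le_iff_le_add,
    hsum fun c => shannon (fun σ : Equiv.Perm (Fin n) => cellDensity S c σ)]
  have hmix : treeEntropy n S = shannon fun σ : Equiv.Perm (Fin n) =>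
      ∑ c, p c * cellDensity S (fun i => c i) σ := by
    have : ∀ σ : Equiv.Perm (Fin n), ∑ c, p c * cellDensity S (fun i => c i) σ =
        patternDensity (treePermuton S) σ := fun σ => by
      rw [patternDensity_eq_sum, hsum fun c => cellDensity S c σ]
    simp only [this]
    rfl
  rw [hmix]
  refine (shannon_mixture_le hp0 (fun c σ => cellDensity_nonneg S _ σ) fun c hc => ?_).trans ?_
  · obtain ⟨κ, hκ, _⟩ := Finset.exists_ne_zero_of_sum_ne_zero hc
    refine sum_cellDensity hd S _ ?_
    rw [← (Finset.mem_filter.1 hκ).2]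
    exact sum_cellCount κ
  · gcongr
    refine (shannon_le_log_card hp0 hp1).trans (le_of_eq ?_)
    simp

theorem patternDensity_nonneg (μ : Measure (ℝ × ℝ)) {n : ℕ} (σ : Equiv.Perm (Fin n)) :
    0 ≤ patternDensity μ σ := measureReal_nonneg

theorem treeEntropy_nonneg {d : ℕ} [NeZero d] (n : ℕ) (S : TreeLabelling d) :
    0 ≤ treeEntropy n S :=
  shannon_nonneg (fun σ => patternDensity_nonneg _ σ) fun _ => measureReal_le_one

theorem treeEntropy_of_le_one {d : ℕ} [NeZero d] (hd : 2 ≤ d) {n : ℕ} (hn : n ≤ 1)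
    (S : TreeLabelling d) : treeEntropy n S = 0 := by
  have : Subsingleton (Fin n) := by
    interval_cases n <;> infer_instance
  have h1 := sum_patternDensity hd S n
  rw [Fintype.sum_subsingleton _ 1] at h1
  rw [treeEntropy, samplingEntropy, Fintype.sum_subsingleton _ 1, h1, Real.negMulLog_one]

theorem treeEntropy_le {d : ℕ} [NeZero d] (hd : 2 ≤ d) (n : ℕ) (S : TreeLabelling d) :
    treeEntropy n S ≤ n * (n - 1) := by
  refine (shannon_le_log_card (fun σ => patternDensity_nonneg _ σ)
    (sum_patternDensity hd S n)).trans ?_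
  rw [Fintype.card_perm, Fintype.card_fin]
  induction n with
  | zero => simp
  | succ n ih =>
    rw [Nat.factorial_succ, Nat.cast_mul, Real.log_mul (by positivity) (by positivity)]
    have h1 := Real.log_le_sub_one_of_pos (show (0 : ℝ) < (n + 1 : ℕ) by positivity)
    push_cast at h1 ⊢
    nlinarith

theorem entropyGain_of_le_one {d : ℕ} [NeZero d] (hd : 2 ≤ d) {n : ℕ} (hn : n ≤ 1)
    (S : TreeLabelling d) : entropyGain n S = 0 := by
  have h := fun (l : ℕ) (hl : l ≤ 1) S => treeEntropy_of_le_one (d := d) hd hl S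
  interval_cases n <;> simp [entropyGain, binomialMean, h]

/-- The sum of `g` over the subtrees hanging from the nodes of level `k`. -/
noncomputable def levelSum {d : ℕ} (g : TreeLabelling d → ℝ) : ℕ → TreeLabelling d → ℝ
  | 0, S => g S
  | k + 1, S => ∑ i, levelSum g k (subtree S i)

theorem levelSum_mono {d : ℕ} {g h : TreeLabelling d → ℝ} (hgh : ∀ S, g S ≤ h S) (k : ℕ)
    (S : TreeLabelling d) : levelSum g k S ≤ levelSum h k S := by
  induction k generalizing S with
  | zero => exact hgh S
  | succ k ih => exact Finset.sum_le_sum fun i _ => ih _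

theorem levelSum_const {d : ℕ} (c : ℝ) (k : ℕ) (S : TreeLabelling d) :
    levelSum (fun _ => c) k S = d ^ k * c := by
  induction k generalizing S with
  | zero => simp [levelSum]
  | succ k ih => simp [levelSum, ih, pow_succ]; ring

/-- The entropy recursion, applied at all nodes of level `k`. -/
theorem levelSum_treeEntropy {d : ℕ} [NeZero d] (k n : ℕ) (S : TreeLabelling d) :
    levelSum (treeEntropy n) k S = levelSum (entropyGain n) k S +
      binomialMean (d : ℝ)⁻¹ (fun l => levelSum (treeEntropy l) (k + 1) S) n := by
  induction k generalizing S with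
  | zero => simp only [levelSum, entropyGain, binomialMean_sum]; ring
  | succ k ih =>
    rw [levelSum]
    simp only [ih, Finset.sum_add_distrib]
    rw [← binomialMean_sum]
    rfl

theorem treeEntropy_eq_sum_add {d : ℕ} [NeZero d] (n : ℕ) (S : TreeLabelling d) (K : ℕ) :
    treeEntropy n S =
      ∑ k ∈ Finset.range K, binomialMean ((d : ℝ)⁻¹ ^ k) (fun l => levelSum (entropyGain l) k S) n +
        binomialMean ((d : ℝ)⁻¹ ^ K) (fun l => levelSum (treeEntropy l) K S) n := by
  induction K with
  | zero =>
    have h1 : ∀ (h : ℕ → ℝ) (n : ℕ), binomialMean 1 h n = h n := by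
      intro h n
      induction n generalizing h with
      | zero => rfl
      | succ n ih => simp [binomialMean, ih]
    simp [h1, levelSum]
  | succ K ih =>
    rw [ih, Finset.sum_range_succ, add_assoc]
    congr 1
    simp only [levelSum_treeEntropy K]
    rw [binomialMean_add, binomialMean_binomialMean, pow_succ]

/-- The sampling entropy is the sum over all levels of the information gains. -/
theorem hasSum_treeEntropy {d : ℕ} [NeZero d] (hd : 2 ≤ d) (n : ℕ) (S : TreeLabelling d) :
    HasSum (fun k => binomialMean ((d : ℝ)⁻¹ ^ k) (fun l => levelSum (entropyGain l) k S) n)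
      (treeEntropy n S) := by
  have hd0 : (0 : ℝ) < d := by exact_mod_cast NeZero.pos d
  have hdinv : (d : ℝ)⁻¹ < 1 := inv_lt_one_of_one_lt₀ (by exact_mod_cast hd)
  have hp0 : ∀ k : ℕ, 0 ≤ (d : ℝ)⁻¹ ^ k := fun k => by positivity
  have hp1 : ∀ k : ℕ, (d : ℝ)⁻¹ ^ k ≤ 1 := fun k => pow_le_one₀ (by positivity) hdinv.le
  have hlev0 : ∀ (g : TreeLabelling d → ℝ), (∀ S, 0 ≤ g S) → ∀ k, 0 ≤ levelSum g k S := by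
    intro g hg k
    simpa [levelSum_const] using levelSum_mono (g := fun _ => 0) hg k S
  rw [hasSum_iff_tendsto_nat_of_nonneg]
  · have htail : Tendsto (fun K => binomialMean ((d : ℝ)⁻¹ ^ K)
        (fun l => levelSum (treeEntropy l) K S) n) atTop (𝓝 0) := by
      refine squeeze_zero (g := fun K => (n * (n - 1) : ℝ) * (d : ℝ)⁻¹ ^ K)
        (fun K => binomialMean_nonneg (hp0 K) (hp1 K)
          (fun l => hlev0 _ (treeEntropy_nonneg l) K) n) (fun K => ?_) ?_
      · calc _ ≤ binomialMean ((d : ℝ)⁻¹ ^ K) (fun l : ℕ => (d : ℝ) ^ K * ((l : ℝ) * (l - 1))) n := by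
              refine binomialMean_mono (hp0 K) (hp1 K) (fun l => ?_) n
              rw [← levelSum_const _ K S]
              exact levelSum_mono (fun S => treeEntropy_le hd l S) K S
          _ = _ := by
            rw [binomialMean_const_mul, binomialMean_mul_pred]
            have : (d : ℝ) ^ K * (d : ℝ)⁻¹ ^ K = 1 := by rw [← mul_pow]; simp [hd0.ne']
            linear_combination (n * (n - 1) : ℝ) * (d : ℝ)⁻¹ ^ K * this
      · simpa using (tendsto_pow_atTop_nhds_zero_of_lt_one (by positivity) hdinv).const_mul
          (n * (n - 1) : ℝ)
    have heq : (fun K => ∑ k ∈ Finset.range K, binomialMean ((d : ℝ)⁻¹ ^ k)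
        (fun l => levelSum (entropyGain l) k S) n) = fun K => treeEntropy n S -
        binomialMean ((d : ℝ)⁻¹ ^ K) (fun l => levelSum (treeEntropy l) K S) n := by
      funext K
      rw [treeEntropy_eq_sum_add n S K]
      ring
    rw [heq]
    simpa using htail.const_sub (treeEntropy n S)
  · exact fun k => binomialMean_nonneg (hp0 k) (hp1 k)
      (fun l => hlev0 _ (entropyGain_nonneg hd l) k) n

/-! ### Random labellings and the law of large numbers on the levels of the tree -/

instance {d : ℕ} (F : PMF (Equiv.Perm (Fin d))) : IsProbabilityMeasure (labellingLaw F) :=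
  inferInstanceAs (IsProbabilityMeasure (Measure.infinitePi fun _ : List (Fin d) => F.toMeasure))

theorem measurable_treeMap_uncurry {d : ℕ} [NeZero d] :
    Measurable fun p : TreeLabelling d × ℝ => treeMap p.1 p.2 := by
  refine Real.continuous_ofDigits.measurable.comp (measurable_pi_lambda _ fun k => ?_)
  have hdig : Measurable fun x : ℝ => fun j : Fin (k + 1) => Real.digits x d j :=
    measurable_pi_lambda _ fun j => (measurable_of_countable (Fin.ofNat d)).comp
      (Nat.measurable_floor.comp (measurable_id.mul_const _))
  have hlab : Measurable fun p : TreeLabelling d × (Fin (k + 1) → Fin d) =>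
      p.1 (List.ofFn fun j : Fin k => p.2 j.castSucc) (p.2 (Fin.last k)) := by
    refine measurable_from_prod_countable_left fun v => ?_
    have h : Measurable fun S : TreeLabelling d => S (List.ofFn fun j : Fin k => v j.castSucc) :=
      measurable_pi_apply _
    exact (measurable_from_top (f := fun α : Equiv.Perm (Fin d) => α (v (Fin.last k)))).comp h
  exact hlab.comp (measurable_fst.prodMk (hdig.comp measurable_snd))

theorem measurable_patternDensity_treePermuton {d : ℕ} [NeZero d] {n : ℕ}
    (σ : Equiv.Perm (Fin n)) :
    Measurable fun S : TreeLabelling d => patternDensity (treePermuton S) σ := by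
  simp only [patternDensity_treePermuton]
  have hX : ∀ i, Measurable fun p : TreeLabelling d × (Fin n → ℝ) => p.2 i := fun i =>
    (measurable_pi_apply i).comp measurable_snd
  have hY : ∀ i, Measurable fun p : TreeLabelling d × (Fin n → ℝ) => treeMap p.1 (p.2 i) := by
    intro i
    have h : Measurable fun p : TreeLabelling d × (Fin n → ℝ) => (p.1, p.2 i) :=
      measurable_fst.prodMk (hX i)
    have h' := (measurable_treeMap_uncurry (d := d)).comp h
    exact h'
  have hms : MeasurableSet {p : TreeLabelling d × (Fin n → ℝ) |
      HasPattern p.2 (fun j => treeMap p.1 (p.2 j)) σ} :=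
    measurableSet_hasPattern (X := fun p : TreeLabelling d × (Fin n → ℝ) => p.2)
      (Y := fun p j => treeMap p.1 (p.2 j)) hX hY σ
  exact (measurable_measure_prodMk_left (ν := uniformPoints (Fin n)) hms).ennreal_toReal

theorem measurable_treeEntropy {d : ℕ} [NeZero d] (n : ℕ) :
    Measurable (treeEntropy n : TreeLabelling d → ℝ) := by
  have h : (treeEntropy n : TreeLabelling d → ℝ) = fun S => ∑ σ : Equiv.Perm (Fin n),
      Real.negMulLog (patternDensity (treePermuton S) σ) := rfl
  rw [h]
  exact Finset.measurable_fun_sum _ fun σ _ => Real.continuous_negMulLog.measurable.comp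
    (measurable_patternDensity_treePermuton σ)

theorem measurable_subtree {d : ℕ} (i : Fin d) :
    Measurable fun S : TreeLabelling d => subtree S i :=
  measurable_pi_lambda _ fun w => measurable_pi_apply (i :: w)

theorem measurable_binomialMean {Ω : Type*} [MeasurableSpace Ω] {p : ℝ} {h : Ω → ℕ → ℝ}
    (hh : ∀ l, Measurable fun ω => h ω l) (n : ℕ) :
    Measurable fun ω => binomialMean p (h ω) n := by
  induction n generalizing h with
  | zero => exact hh 0
  | succ n ih =>
    simp only [binomialMean]
    exact ((ih hh).const_mul _).add ((ih (h := fun ω l => h ω (l + 1)) fun l => hh _).const_mul _)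

theorem measurable_entropyGain {d : ℕ} [NeZero d] (n : ℕ) :
    Measurable fun S : TreeLabelling d => entropyGain n S :=
  (measurable_treeEntropy n).sub (Finset.measurable_fun_sum _ fun i _ =>
    measurable_binomialMean (fun l => (measurable_treeEntropy l).comp (measurable_subtree i)) n)

theorem infinitePi_map_comp_injective {X ι ι' : Type*} [MeasurableSpace X] (ν : Measure X)
    [IsProbabilityMeasure ν] {g : ι' → ι} (hg : Function.Injective g) :
    (Measure.infinitePi fun _ : ι => ν).map (fun x j => x (g j)) =
      Measure.infinitePi fun _ : ι' => ν := by
  refine Measure.eq_infinitePi _ fun s t ht => ?_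
  have hm : Measurable fun (x : ι → X) j => x (g j) :=
    measurable_pi_lambda _ fun j => measurable_pi_apply (g j)
  rw [Measure.map_apply hm
    (MeasurableSet.pi s.countable_toSet fun i _ => ht i)]
  have hext : ∀ j, Function.extend g t (fun _ => Set.univ) (g j) = t j := fun j =>
    hg.extend_apply t _ j
  have hpre : (fun (x : ι → X) j => x (g j)) ⁻¹' (s : Set ι').pi t =
      ((s.map ⟨g, hg⟩ : Finset ι) : Set ι).pi (Function.extend g t fun _ => Set.univ) := by
    ext x
    simp [Set.mem_pi, hext]
  rw [hpre, Measure.infinitePi_pi, Finset.prod_map]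
  · simp [hext]
  · intro i hi
    obtain ⟨j, _, rfl⟩ := Finset.mem_map.1 hi
    simpa [hext] using ht j

/-- The labellings of the subtrees of the children of the root are independent copies of the
labelling of the whole tree. -/
theorem labellingLaw_map_subtree {d : ℕ} (F : PMF (Equiv.Perm (Fin d))) :
    (labellingLaw F).map (fun S i => subtree S i) = Measure.pi fun _ : Fin d => labellingLaw F := by
  have h1 := infinitePi_map_comp_injective F.toMeasure
    (g := fun p : Fin d × List (Fin d) => p.1 :: p.2) (by rintro ⟨a, v⟩ ⟨b, w⟩ h; simpa using h)
  have h2 := Measure.infinitePi_map_curry (fun (_ : Fin d) (_ : List (Fin d)) => F.toMeasure)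
  have hm : Measurable fun (S : TreeLabelling d) (p : Fin d × List (Fin d)) => S (p.1 :: p.2) :=
    measurable_pi_lambda _ fun p => measurable_pi_apply (p.1 :: p.2)
  rw [← h1, Measure.map_map (MeasurableEquiv.measurable _) hm] at h2
  rw [← Measure.infinitePi_eq_pi]
  exact h2

theorem measurable_subtrees {d : ℕ} : Measurable fun (S : TreeLabelling d) i => subtree S i :=
  measurable_pi_lambda _ measurable_subtree

theorem measurePreserving_subtree {d : ℕ} (F : PMF (Equiv.Perm (Fin d))) (i : Fin d) :
    MeasurePreserving (fun S => subtree S i) (labellingLaw F) (labellingLaw F) :=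
  (measurePreserving_eval (fun _ : Fin d => labellingLaw F) i).comp
    ⟨measurable_subtrees, labellingLaw_map_subtree F⟩

theorem memLp_levelSum {d : ℕ} (F : PMF (Equiv.Perm (Fin d))) {g : TreeLabelling d → ℝ}
    (hg : MemLp g 2 (labellingLaw F)) (k : ℕ) : MemLp (levelSum g k) 2 (labellingLaw F) := by
  induction k with
  | zero => exact hg
  | succ k ih =>
    exact memLp_finsetSum _ fun i _ => ih.comp_measurePreserving (measurePreserving_subtree F i)

theorem integral_levelSum {d : ℕ} (F : PMF (Equiv.Perm (Fin d))) {g : TreeLabelling d → ℝ}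
    (hg : MemLp g 2 (labellingLaw F)) (k : ℕ) :
    ∫ S, levelSum g k S ∂labellingLaw F = d ^ k * ∫ S, g S ∂labellingLaw F := by
  induction k with
  | zero => simp [levelSum]
  | succ k ih =>
    have hL := memLp_levelSum F hg k
    have hi : ∀ i : Fin d, ∫ S, levelSum g k (subtree S i) ∂labellingLaw F =
        ∫ S, levelSum g k S ∂labellingLaw F := fun i => by
      have hmp := measurePreserving_subtree F i
      have h := integral_map (μ := labellingLaw F) hmp.aemeasurable (f := levelSum g k)
        (by rw [hmp.map_eq]; exact hL.aestronglyMeasurable)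
      rw [← h, hmp.map_eq]
    simp only [levelSum]
    rw [integral_finsetSum]
    · simp only [hi, ih, Finset.sum_const, Finset.card_univ, Fintype.card_fin, nsmul_eq_mul]
      ring
    · exact fun i _ => (hL.comp_measurePreserving (measurePreserving_subtree F i)).integrable
        one_le_two

theorem variance_levelSum {d : ℕ} (F : PMF (Equiv.Perm (Fin d))) {g : TreeLabelling d → ℝ}
    (hg : MemLp g 2 (labellingLaw F)) (k : ℕ) :
    ProbabilityTheory.variance (levelSum g k) (labellingLaw F) =
      d ^ k * ProbabilityTheory.variance g (labellingLaw F) := by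
  induction k with
  | zero => rw [pow_zero, one_mul]; rfl
  | succ k ih =>
    have hL := memLp_levelSum F hg k
    have hsum := ProbabilityTheory.variance_sum_pi (μ := fun _ : Fin d => labellingLaw F)
      (X := fun _ => levelSum g k) fun _ => hL
    rw [← labellingLaw_map_subtree F, ProbabilityTheory.variance_map ?_
      measurable_subtrees.aemeasurable] at hsum
    · have hfun : (∑ i : Fin d, fun ω : Fin d → TreeLabelling d => levelSum g k (ω i)) ∘
          (fun S i => subtree S i) = levelSum g (k + 1) := by
        funext S
        simp [levelSum]
      rw [hfun] at hsum
      rw [hsum]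
      simp only [ih, Finset.sum_const, Finset.card_univ, Fintype.card_fin, nsmul_eq_mul]
      ring
    · rw [labellingLaw_map_subtree F]
      refine Finset.aemeasurable_sum _ fun i _ => ?_
      exact (hL.comp_measurePreserving (measurePreserving_eval (fun _ : Fin d => labellingLaw F) i)
        ).aestronglyMeasurable.aemeasurable

/-- The strong law of large numbers along the levels of the tree. The level sizes grow
exponentially, so the variances of the level averages are summable. -/
theorem ae_tendsto_levelSum {d : ℕ} (hd : 2 ≤ d) (F : PMF (Equiv.Perm (Fin d)))
    {g : TreeLabelling d → ℝ} (hg : MemLp g 2 (labellingLaw F)) :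
    ∀ᵐ S ∂labellingLaw F, Tendsto (fun k => (d : ℝ)⁻¹ ^ k * levelSum g k S) atTop
      (𝓝 (∫ S, g S ∂labellingLaw F)) := by
  have hd0 : (0 : ℝ) < d := by positivity
  have hdinv : (d : ℝ)⁻¹ < 1 := inv_lt_one_of_one_lt₀ (by exact_mod_cast hd)
  set m := ∫ S, g S ∂labellingLaw F with hm
  have hmul : ∀ k, (d : ℝ)⁻¹ ^ k * (d : ℝ) ^ k = 1 := fun k => by
    rw [← mul_pow, inv_mul_cancel₀ hd0.ne', one_pow]
  have hD : ∀ k, MemLp (fun S => (d : ℝ)⁻¹ ^ k * levelSum g k S) 2 (labellingLaw F) := fun k =>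
    (memLp_levelSum F hg k).const_mul _
  have hDm : ∀ k, MemLp (fun S => (d : ℝ)⁻¹ ^ k * levelSum g k S - m) 2 (labellingLaw F) := fun k =>
    (hD k).sub (memLp_const m)
  have hint : ∀ k, ∫ S, ((d : ℝ)⁻¹ ^ k * levelSum g k S - m) ^ 2 ∂labellingLaw F =
      (d : ℝ)⁻¹ ^ k * ProbabilityTheory.variance g (labellingLaw F) := fun k => by
    have hmean : ∫ S, (d : ℝ)⁻¹ ^ k * levelSum g k S ∂labellingLaw F = m := by
      rw [integral_const_mul, integral_levelSum F hg, ← mul_assoc, hmul, one_mul]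
    have hv := ProbabilityTheory.variance_eq_integral (hD k).aestronglyMeasurable.aemeasurable
    rw [hmean, ProbabilityTheory.variance_const_mul, variance_levelSum F hg] at hv
    rw [← hv]
    linear_combination (d : ℝ)⁻¹ ^ k * ProbabilityTheory.variance g (labellingLaw F) * hmul k
  have hlint : ∫⁻ S, ∑' k, ENNReal.ofReal (((d : ℝ)⁻¹ ^ k * levelSum g k S - m) ^ 2)
      ∂labellingLaw F ≠ ⊤ := by
    rw [lintegral_tsum fun k => (hDm k).integrable_sq.aestronglyMeasurable.aemeasurable.ennreal_ofReal]
    have h : ∀ k, ∫⁻ S, ENNReal.ofReal (((d : ℝ)⁻¹ ^ k * levelSum g k S - m) ^ 2) ∂labellingLaw F =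
        ENNReal.ofReal ((d : ℝ)⁻¹ ^ k * ProbabilityTheory.variance g (labellingLaw F)) := fun k => by
      rw [← ofReal_integral_eq_lintegral_ofReal (hDm k).integrable_sq
        (Eventually.of_forall fun _ => sq_nonneg _), hint]
    simp only [h]
    have hsum : Summable fun k : ℕ =>
        (d : ℝ)⁻¹ ^ k * ProbabilityTheory.variance g (labellingLaw F) :=
      (summable_geometric_of_lt_one (by positivity) hdinv).mul_right _
    exact hsum.tsum_ofReal_ne_top
  have hae := ae_lt_top' (AEMeasurable.tsum fun k =>
    (hDm k).integrable_sq.aestronglyMeasurable.aemeasurable.ennreal_ofReal) hlint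
  filter_upwards [hae] with S hS
  have h0 := ENNReal.tendsto_atTop_zero_of_tsum_ne_top hS.ne
  have h1 := (ENNReal.tendsto_toReal ENNReal.zero_ne_top).comp h0
  simp only [Function.comp_def, ENNReal.toReal_ofReal (sq_nonneg _), ENNReal.toReal_zero] at h1
  have h2 := h1.sqrt
  simp only [Real.sqrt_sq_eq_abs, Real.sqrt_zero] at h2
  have h3 := (tendsto_zero_iff_abs_tendsto_zero _).2 h2
  simpa using h3.add_const m

/-- The mean information gain over the random labelling. -/
noncomputable def meanGain {d : ℕ} [NeZero d] (F : PMF (Equiv.Perm (Fin d))) (l : ℕ) : ℝ :=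
  ∫ S, entropyGain l S ∂labellingLaw F

theorem memLp_entropyGain {d : ℕ} [NeZero d] (hd : 2 ≤ d) (F : PMF (Equiv.Perm (Fin d))) (l : ℕ) :
    MemLp (entropyGain l) 2 (labellingLaw F) :=
  memLp_of_bounded (a := 0) (b := d * Real.log (l + 1))
    (Eventually.of_forall fun S => ⟨entropyGain_nonneg hd l S, entropyGain_le hd l S⟩)
    (measurable_entropyGain l).aestronglyMeasurable 2

theorem meanGain_nonneg {d : ℕ} [NeZero d] (hd : 2 ≤ d) (F : PMF (Equiv.Perm (Fin d))) (l : ℕ) :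
    0 ≤ meanGain F l := integral_nonneg fun S => entropyGain_nonneg hd l S

theorem meanGain_le {d : ℕ} [NeZero d] (hd : 2 ≤ d) (F : PMF (Equiv.Perm (Fin d))) (l : ℕ) :
    meanGain F l ≤ d * Real.log (l + 1) := by
  have := integral_mono ((memLp_entropyGain hd F l).integrable one_le_two)
    (integrable_const (μ := labellingLaw F) (d * Real.log (l + 1))) (entropyGain_le hd l)
  simpa [meanGain] using this

theorem meanGain_of_le_one {d : ℕ} [NeZero d] (hd : 2 ≤ d) (F : PMF (Equiv.Perm (Fin d))) {l : ℕ}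
    (hl : l ≤ 1) : meanGain F l = 0 := by
  simp [meanGain, entropyGain_of_le_one hd hl]

theorem ae_tendsto_meanGain {d : ℕ} [NeZero d] (hd : 2 ≤ d) (F : PMF (Equiv.Perm (Fin d))) :
    ∀ᵐ S ∂labellingLaw F, ∀ l, Tendsto (fun k => (d : ℝ)⁻¹ ^ k * levelSum (entropyGain l) k S) atTop
      (𝓝 (meanGain F l)) :=
  ae_all_iff.2 fun l => ae_tendsto_levelSum hd F (memLp_entropyGain hd F l)

/-! ### Poisson limits of binomial means -/

theorem binomialMean_eq_tsum (p : ℝ) (h : ℕ → ℝ) (n : ℕ) :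
    binomialMean p h n = ∑' l, n.choose l * p ^ l * (1 - p) ^ (n - l) * h l := by
  rw [binomialMean_eq_sum, tsum_eq_sum]
  intro l hl
  rw [Finset.mem_range, not_lt] at hl
  rw [Nat.choose_eq_zero_of_lt (by omega)]
  simp

theorem binomialMean_le_sq {p C : ℝ} (h0 : 0 ≤ p) (h1 : p ≤ 1) (hC : 0 ≤ C) {h : ℕ → ℝ}
    (hh : ∀ l, h l ≤ C * ((l : ℝ) * (l - 1))) (n : ℕ) :
    binomialMean p h n ≤ C * (n * p) ^ 2 := by
  refine (binomialMean_mono h0 h1 hh n).trans ?_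
  rw [binomialMean_const_mul, binomialMean_mul_pred]
  have : (0 : ℝ) ≤ n := by positivity
  gcongr
  nlinarith [mul_nonneg this (sq_nonneg p)]

theorem binomialMean_le_sqrt {p C : ℝ} (h0 : 0 ≤ p) (h1 : p ≤ 1) (hC : 0 ≤ C) {h : ℕ → ℝ}
    (hh : ∀ l, h l ≤ C * √l) {n : ℕ} (hn : 0 < n * p) :
    binomialMean p h n ≤ C * √(n * p) := by
  set s := √(n * p) with hs
  have hs0 : 0 < s := Real.sqrt_pos.2 hn
  have hss : s * s = n * p := Real.mul_self_sqrt hn.le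
  -- the square root is below its tangent line at the mean `n * p = s * s`
  have hb : ∀ l, h l ≤ C * ((2 * s)⁻¹ * l + s / 2) := fun l => by
    refine (hh l).trans (mul_le_mul_of_nonneg_left ?_ hC)
    have hl : √(l : ℝ) * √l = l := Real.mul_self_sqrt (by positivity)
    rw [← sub_nonneg]
    have : (2 * s)⁻¹ * l + s / 2 - √l = (2 * s)⁻¹ * (√l - s) ^ 2 := by
      field_simp
      linear_combination -hl
    rw [this]
    positivity
  refine (binomialMean_mono h0 h1 hb n).trans (le_of_eq ?_)
  rw [binomialMean_const_mul, binomialMean_add, binomialMean_const_mul, binomialMean_natCast,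
    binomialMean_const, ← hss]
  field_simp
  ring

theorem tendsto_one_sub_pow {α : Type*} {f : Filter α} {n : α → ℕ} {p : α → ℝ} {t : ℝ}
    (hp : Tendsto p f (𝓝 0)) (hnp : Tendsto (fun x => n x * p x) f (𝓝 t))
    (hn : Tendsto n f atTop) (l : ℕ) :
    Tendsto (fun x => (1 - p x) ^ (n x - l)) f (𝓝 (Real.exp (-t))) := by
  have hlt : ∀ᶠ x in f, p x < 1 := hp.eventually_lt_const (by norm_num)
  have hnl : Tendsto (fun x => ((n x - l : ℕ) : ℝ) * p x) f (𝓝 t) := by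
    have h := hnp.sub (hp.const_mul (l : ℝ))
    rw [mul_zero, sub_zero] at h
    refine h.congr' ?_
    filter_upwards [hn.eventually_ge_atTop l] with x hx
    rw [Nat.cast_sub hx]
    ring
  have hlow : Tendsto (fun x => Real.exp (-(((n x - l : ℕ) : ℝ) * p x / (1 - p x)))) f
      (𝓝 (Real.exp (-t))) := by
    have h := (hnl.div (hp.const_sub 1) (by norm_num)).neg.rexp
    simpa using h
  refine tendsto_of_tendsto_of_tendsto_of_le_of_le' hlow hnl.neg.rexp ?_ ?_
  · filter_upwards [hlt] with x hx
    have h1 : 0 < 1 - p x := by linarith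
    have h2 : Real.exp (-(p x / (1 - p x))) ≤ 1 - p x := by
      rw [Real.exp_neg, inv_le_comm₀ (Real.exp_pos _) h1]
      have := Real.add_one_le_exp (p x / (1 - p x))
      have h3 : (1 - p x)⁻¹ = p x / (1 - p x) + 1 := by field_simp; ring
      rwa [h3]
    calc _ = Real.exp (-(p x / (1 - p x))) ^ (n x - l) := by
          rw [← Real.exp_nat_mul]; congr 1; ring
      _ ≤ _ := pow_le_pow_left₀ (Real.exp_pos _).le h2 _
  · filter_upwards [hlt] with x hx
    have h1 : 0 ≤ 1 - p x := by linarith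
    calc _ ≤ Real.exp (-p x) ^ (n x - l) :=
          pow_le_pow_left₀ h1 (by linarith [Real.add_one_le_exp (-p x)]) _
      _ = _ := by rw [← Real.exp_nat_mul]; congr 1; ring

theorem tendsto_choose_mul_pow {α : Type*} {f : Filter α} {n : α → ℕ} {p : α → ℝ} {t : ℝ}
    (hp : Tendsto p f (𝓝 0)) (hnp : Tendsto (fun x => n x * p x) f (𝓝 t))
    (hn : Tendsto n f atTop) (l : ℕ) :
    Tendsto (fun x => ((n x).choose l : ℝ) * p x ^ l) f (𝓝 (t ^ l / l.factorial)) := by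
  have h1 : ∀ i ∈ Finset.range l, Tendsto (fun x => ((n x - i : ℕ) : ℝ) * p x) f (𝓝 t) := by
    intro i _
    have h := hnp.sub (hp.const_mul (i : ℝ))
    rw [mul_zero, sub_zero] at h
    refine h.congr' ?_
    filter_upwards [hn.eventually_ge_atTop i] with x hx
    rw [Nat.cast_sub hx]
    ring
  have h2 := (tendsto_finsetProd _ h1).div_const (l.factorial : ℝ)
  rw [Finset.prod_const, Finset.card_range] at h2
  refine h2.congr fun x => ?_
  have h3 : (l.factorial : ℝ) * ((n x).choose l : ℝ) = ∏ i ∈ Finset.range l, ((n x - i : ℕ) : ℝ) := by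
    rw [← Nat.cast_mul, ← Nat.descFactorial_eq_factorial_mul_choose,
      Nat.descFactorial_eq_prod_range, Nat.cast_prod]
  rw [Finset.prod_mul_distrib, Finset.prod_const, Finset.card_range, ← h3]
  field_simp

theorem summable_pow_div_factorial_mul_succ (x : ℝ) :
    Summable fun l : ℕ => x ^ l / l.factorial * (l + 1) := by
  have h1 := Real.summable_pow_div_factorial x
  have h2 : Summable fun l : ℕ => x ^ l / l.factorial * l := by
    rw [← summable_nat_add_iff 1]
    refine (h1.mul_left x).congr fun l => ?_
    rw [Nat.factorial_succ]
    push_cast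
    field_simp
    ring
  exact (h2.add h1).congr fun l => by ring

/-- The Poisson limit theorem for means of functions of moderate growth, where the function may
vary as well. -/
theorem tendsto_binomialMean {α : Type*} {f : Filter α} {n : α → ℕ} {p : α → ℝ} {t C : ℝ}
    {b : α → ℕ → ℝ} {r : ℕ → ℝ} (h0 : ∀ x, 0 ≤ p x) (h1 : ∀ x, p x ≤ 1)
    (hnp : Tendsto (fun x => n x * p x) f (𝓝 t)) (hn : Tendsto n f atTop)
    (hb : ∀ l, Tendsto (fun x => b x l) f (𝓝 (r l))) (hbC : ∀ x l, |b x l| ≤ C * (l + 1)) :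
    Tendsto (fun x => binomialMean (p x) (b x) (n x)) f
      (𝓝 (∑' l : ℕ, t ^ l / l.factorial * Real.exp (-t) * r l)) := by
  have hp : Tendsto p f (𝓝 0) := by
    have hn' : Tendsto (fun x => ((n x : ℝ))⁻¹) f (𝓝 0) :=
      tendsto_inv_atTop_zero.comp (tendsto_natCast_atTop_atTop.comp hn)
    have h := hnp.mul hn'
    rw [mul_zero] at h
    refine h.congr' ?_
    filter_upwards [hn.eventually_gt_atTop 0] with x hx
    field_simp
  simp only [binomialMean_eq_tsum]
  refine tendsto_tsum_of_dominated_convergence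
    (bound := fun l : ℕ => C * ((t + 1) ^ l / l.factorial * (l + 1))) ?_ ?_ ?_
  · exact (summable_pow_div_factorial_mul_succ _).mul_left C
  · exact fun l => ((tendsto_choose_mul_pow hp hnp hn l).mul
      (tendsto_one_sub_pow hp hnp hn l)).mul (hb l)
  · filter_upwards [hnp.eventually_le_const (show t < t + 1 by linarith)] with x hx l
    have hnp0 : 0 ≤ n x * p x := mul_nonneg (by positivity) (h0 x)
    have hq0 : 0 ≤ 1 - p x := by linarith [h1 x]
    have hq1 : 1 - p x ≤ 1 := by linarith [h0 x]
    have e1 : ((n x).choose l : ℝ) * p x ^ l ≤ (t + 1) ^ l / l.factorial := by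
      calc ((n x).choose l : ℝ) * p x ^ l ≤ (n x : ℝ) ^ l / l.factorial * p x ^ l := by
            have := h0 x
            gcongr
            exact Nat.choose_le_pow_div l (n x)
        _ = (n x * p x) ^ l / l.factorial := by rw [mul_pow]; ring
        _ ≤ _ := by gcongr
    have e2 : (1 - p x) ^ (n x - l) ≤ 1 := pow_le_one₀ hq0 hq1
    have e0 : 0 ≤ ((n x).choose l : ℝ) * p x ^ l := mul_nonneg (by positivity) (pow_nonneg (h0 x) _)
    rw [norm_mul, Real.norm_eq_abs, Real.norm_eq_abs, abs_of_nonneg (mul_nonneg e0 (by positivity))]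
    calc _ ≤ ((t + 1) ^ l / l.factorial * 1) * (C * (l + 1)) := by
          have e3 : 0 ≤ (t + 1) ^ l / (l.factorial : ℝ) := e0.trans e1
          gcongr
          exact hbC x l
      _ = _ := by ring

/-! ### The log-periodic limit -/

/-- The mean of `r` under the Poisson law with mean `t`, divided by `t`; here `r 0` and `r 1` are
taken to vanish. This is the contribution to the entropy per point of a level of the tree with `t`
points per node. -/
noncomputable def poissonProfile (r : ℕ → ℝ) (t : ℝ) : ℝ :=
  ∑' l : ℕ, r (l + 2) / (l + 2).factorial * (t ^ (l + 1) * Real.exp (-t))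

theorem tsum_poisson_div {r : ℕ → ℝ} {t C : ℝ} (h0 : r 0 = 0) (h1 : r 1 = 0)
    (hr : ∀ l, |r l| ≤ C * (l + 1)) (ht : 0 < t) :
    (∑' l : ℕ, t ^ l / l.factorial * Real.exp (-t) * r l) / t = poissonProfile r t := by
  have hs : Summable fun l : ℕ => t ^ l / l.factorial * Real.exp (-t) * r l := by
    refine Summable.of_norm_bounded
      ((summable_pow_div_factorial_mul_succ t).mul_left (C * Real.exp (-t))) fun l => ?_
    rw [norm_mul, Real.norm_eq_abs, Real.norm_eq_abs, abs_of_nonneg (by positivity)]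
    calc _ ≤ t ^ l / l.factorial * Real.exp (-t) * (C * (l + 1)) := by
          gcongr
          exact hr l
      _ = _ := by ring
  rw [← hs.sum_add_tsum_nat_add 2, poissonProfile, Finset.sum_range_succ,
    Finset.sum_range_one, h0, h1]
  simp only [mul_zero, zero_add]
  rw [← tsum_div_const]
  refine tsum_congr fun l => ?_
  field_simp
  ring

/-- The growth conditions on information gains: nonnegative, vanishing for at most one point, and
at most of the order of a square root. -/
structure IsGain (C : ℝ) (h : ℕ → ℝ) : Prop where
  nonneg : ∀ l, 0 ≤ h l
  zero : h 0 = 0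
  one : h 1 = 0
  le_sqrt : ∀ l, h l ≤ C * √l

theorem IsGain.const_nonneg {C : ℝ} {h : ℕ → ℝ} (hh : IsGain C h) : 0 ≤ C := by
  simpa using (hh.nonneg 1).trans (hh.le_sqrt 1)

theorem IsGain.le_mul_pred {C : ℝ} {h : ℕ → ℝ} (hh : IsGain C h) (l : ℕ) :
    h l ≤ C * ((l : ℝ) * (l - 1)) := by
  rcases l with _ | _ | l
  · simp [hh.zero]
  · simp [hh.one]
  · refine (hh.le_sqrt _).trans (mul_le_mul_of_nonneg_left ?_ hh.const_nonneg)
    rw [Real.sqrt_le_left (by push_cast; nlinarith)]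
    push_cast
    have : (0 : ℝ) ≤ l := by positivity
    nlinarith [mul_nonneg this this, mul_nonneg (mul_nonneg this this) this]

theorem IsGain.abs_le {C : ℝ} {h : ℕ → ℝ} (hh : IsGain C h) (l : ℕ) : |h l| ≤ C * (l + 1) := by
  rw [abs_of_nonneg (hh.nonneg l)]
  refine (hh.le_sqrt _).trans (mul_le_mul_of_nonneg_left ?_ hh.const_nonneg)
  rw [Real.sqrt_le_left (by positivity)]
  nlinarith [(by positivity : (0 : ℝ) ≤ l)]

/-- The contribution of a level with `n * p` points per node, small both for few and for many points
per node; this dominates the sum over the levels. -/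
theorem IsGain.binomialMean_div_le {C p : ℝ} {h : ℕ → ℝ} (hh : IsGain C h) (h0 : 0 ≤ p)
    (h1 : p ≤ 1) {n : ℕ} (hn : 0 < n * p) :
    binomialMean p h n / (n * p) ≤ C * min (n * p) (√(n * p))⁻¹ := by
  rw [div_le_iff₀ hn, mul_assoc]
  rcases min_choice (n * p) (√(n * p))⁻¹ with h | h <;> rw [h]
  · exact (binomialMean_le_sq h0 h1 hh.const_nonneg hh.le_mul_pred n).trans (by rw [sq])
  · refine (binomialMean_le_sqrt h0 h1 hh.const_nonneg hh.le_sqrt hn).trans (le_of_eq ?_)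
    congr 1
    rw [eq_inv_mul_iff_mul_eq₀ (Real.sqrt_ne_zero'.2 hn), Real.mul_self_sqrt hn.le]

theorem tendsto_binomialMean_div {α : Type*} {f : Filter α} {n : α → ℕ} {p : α → ℝ} {t C : ℝ}
    {b : α → ℕ → ℝ} {r : ℕ → ℝ} (ht : 0 < t) (h0 : ∀ x, 0 ≤ p x) (h1 : ∀ x, p x ≤ 1)
    (hnp : Tendsto (fun x => n x * p x) f (𝓝 t)) (hn : Tendsto n f atTop)
    (hb : ∀ l, Tendsto (fun x => b x l) f (𝓝 (r l))) (hbC : ∀ x, IsGain C (b x))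
    (hr : IsGain C r) :
    Tendsto (fun x => binomialMean (p x) (b x) (n x) / (n x * p x)) f
      (𝓝 (poissonProfile r t)) := by
  rw [← tsum_poisson_div hr.zero hr.one hr.abs_le ht]
  exact (tendsto_binomialMean h0 h1 hnp hn hb fun x => (hbC x).abs_le).div hnp ht.ne'

theorem poissonProfile_nonneg {C : ℝ} {r : ℕ → ℝ} (hr : IsGain C r) {t : ℝ} (ht : 0 < t) :
    0 ≤ poissonProfile r t :=
  tsum_nonneg fun l => by have := hr.nonneg (l + 2); positivity

theorem poissonProfile_le {C : ℝ} {r : ℕ → ℝ} (hr : IsGain C r) {t : ℝ} (ht : 0 < t) :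
    poissonProfile r t ≤ C * min t (√t)⁻¹ := by
  -- pass to the Poisson limit in the bound for binomial means
  have hlim := tendsto_binomialMean_div (f := atTop) (n := fun n : ℕ => n)
    (p := fun n : ℕ => min (t / n) 1) (b := fun _ => r) ht (fun n => by positivity)
    (fun n => min_le_right _ _) (tendsto_const_nhds.congr' ?_) tendsto_id
    (fun l => tendsto_const_nhds) (fun _ => hr) hr
  · refine le_of_tendsto hlim ?_
    filter_upwards [eventually_gt_atTop 0, eventually_ge_atTop ⌈t⌉₊] with n hn hnt
    have hn' : (0 : ℝ) < n := by exact_mod_cast hn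
    have h1 : t / n ≤ 1 := by
      rw [div_le_one hn']
      exact Nat.ceil_le.1 hnt
    have h2 : (n : ℝ) * min (t / n) 1 = t := by rw [min_eq_left h1]; field_simp
    have := hr.binomialMean_div_le (p := min (t / n) 1) (n := n) (by positivity)
      (min_le_right _ _) (by rw [h2]; exact ht)
    rwa [h2] at this ⊢
  · filter_upwards [eventually_gt_atTop 0, eventually_ge_atTop ⌈t⌉₊] with n hn hnt
    have hn' : (0 : ℝ) < n := by exact_mod_cast hn
    have h1 : t / n ≤ 1 := by
      rw [div_le_one hn']
      exact Nat.ceil_le.1 hnt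
    rw [min_eq_left h1]
    field_simp

theorem summable_int_pow_natAbs {q : ℝ} (h0 : 0 ≤ q) (h1 : q < 1) :
    Summable fun j : ℤ => q ^ j.natAbs := by
  refine Summable.of_nat_of_neg ?_ ?_ <;> simpa using summable_geometric_of_lt_one h0 h1

theorem min_mul_zpow_le {D u : ℝ} (hD : 1 < D) (hu : 0 < u) (j : ℤ) :
    min (u * D ^ (-j)) (√(u * D ^ (-j)))⁻¹ ≤ (u + (√u)⁻¹) * (√D)⁻¹ ^ j.natAbs := by
  have hD0 : 0 < D := by linarith
  have hs1 : 1 ≤ √D := Real.one_le_sqrt.2 hD.le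
  have hs0 : 0 < √D := by linarith
  have hsu : 0 < √u := Real.sqrt_pos.2 hu
  have hsD : D = √D * √D := (Real.mul_self_sqrt hD0.le).symm
  rcases Int.natAbs_eq j with h | h <;> set k := j.natAbs <;> rw [h]
  · refine (min_le_left _ _).trans ?_
    rw [zpow_neg, zpow_natCast]
    calc u * (D ^ k)⁻¹ = u * ((√D)⁻¹ ^ k * (√D)⁻¹ ^ k) := by
          rw [← mul_pow, ← mul_inv, ← hsD, inv_pow]
      _ ≤ u * ((√D)⁻¹ ^ k * 1) := by
          gcongr
          exact pow_le_one₀ (by positivity) (inv_le_one_of_one_le₀ hs1)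
      _ ≤ _ := by
          rw [mul_one]
          gcongr
          linarith [inv_pos.2 hsu]
  · refine (min_le_right _ _).trans ?_
    rw [neg_neg, zpow_natCast, Real.sqrt_mul hu.le, mul_inv]
    have : √(D ^ k) = √D ^ k := by
      rw [Real.sqrt_eq_iff_mul_self_eq (by positivity) (by positivity), ← mul_pow, ← hsD]
    rw [this, inv_pow]
    gcongr
    linarith

/-- The log-periodic limit theorem behind the entropy asymptotics: if level `k` of the tree
contributes `d ^ k` binomial means of functions `a k` converging to `r`, then along `n ~ θ d ^ m`
the contributions per point converge to the sum of the Poisson profiles over all scales. -/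
theorem tendsto_tsum_levels {α : Type*} {f : Filter α} {n m : α → ℕ} {θ C D : ℝ} {a : ℕ → ℕ → ℝ}
    {r : ℕ → ℝ} (hD : 1 < D) (hθ : 0 < θ) (hm : Tendsto m f atTop)
    (hnm : Tendsto (fun x => (n x : ℝ) / D ^ m x) f (𝓝 θ)) (ha : ∀ k, IsGain C (a k))
    (hr : IsGain C r) (har : ∀ l, Tendsto (fun k => a k l) atTop (𝓝 (r l))) :
    Tendsto (fun x => ∑' k : ℕ, binomialMean (D⁻¹ ^ k) (a k) (n x) / (n x * D⁻¹ ^ k)) f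
      (𝓝 (∑' j : ℤ, poissonProfile r (θ * D ^ (-j)))) := by
  have hD0 : 0 < D := by linarith
  have hDinv0 : 0 ≤ D⁻¹ := by positivity
  have hDinv1 : D⁻¹ ≤ 1 := inv_le_one_of_one_le₀ hD.le
  let G : ℕ → ℕ → ℝ := fun k N => binomialMean (D⁻¹ ^ k) (a k) N / (N * D⁻¹ ^ k)
  -- index the levels by their distance from level `m x`, where a node has about `θ` points
  let T : α → ℤ → ℝ := fun x j => if 0 ≤ j + m x then G (j + m x).toNat (n x) else 0
  have hshift : ∀ x, ∑' k : ℕ, G k (n x) = ∑' j : ℤ, T x j := by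
    intro x
    have hinj : Function.Injective fun k : ℕ => (k : ℤ) - m x := fun a b h => by
      simpa using h
    rw [← hinj.tsum_eq]
    · refine tsum_congr fun k => ?_
      simp [T]
    · intro j hj
      have : 0 ≤ j + m x := by
        by_contra h
        exact hj (by simp [T, h])
      exact ⟨(j + m x).toNat, by simp [Int.toNat_of_nonneg this]⟩
  have hn : Tendsto n f atTop := by
    rw [← tendsto_natCast_atTop_iff (R := ℝ)]
    have h := hnm.pos_mul_atTop hθ ((tendsto_pow_atTop_atTop_of_one_lt hD).comp hm)
    refine h.congr fun x => ?_
    simp only [Function.comp]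
    field_simp
  have hscale : ∀ x (j : ℤ), 0 ≤ j + m x →
      (n x : ℝ) * D⁻¹ ^ (j + m x).toNat = n x / D ^ m x * D ^ (-j) := by
    intro x j hj
    rw [inv_pow, ← zpow_natCast D (j + m x).toNat, Int.toNat_of_nonneg hj, zpow_add₀ hD0.ne',
      zpow_natCast, zpow_neg]
    field_simp
  change Tendsto (fun x => ∑' k : ℕ, G k (n x)) f _
  simp only [hshift]
  refine tendsto_tsum_of_dominated_convergence
    (bound := fun j : ℤ => C * ((2 * θ + (√(θ / 2))⁻¹) * (√D)⁻¹ ^ j.natAbs)) ?_ ?_ ?_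
  · refine ((summable_int_pow_natAbs (by positivity) ?_).mul_left _).mul_left _
    exact inv_lt_one_of_one_lt₀ (by rw [Real.lt_sqrt] <;> linarith)
  · intro j
    have hk : Tendsto (fun x => (j + m x).toNat) f atTop := by
      refine tendsto_atTop.2 fun b => ?_
      filter_upwards [hm.eventually_ge_atTop (b + j.natAbs)] with x hx
      omega
    have hj : ∀ᶠ x in f, 0 ≤ j + m x := by
      filter_upwards [hm.eventually_ge_atTop j.natAbs] with x hx
      omega
    have hlim := tendsto_binomialMean_div (f := f) (n := n)
      (p := fun x => D⁻¹ ^ (j + m x).toNat) (b := fun x => a (j + m x).toNat)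
      (t := θ * D ^ (-j)) (by positivity) (fun x => by positivity)
      (fun x => pow_le_one₀ hDinv0 hDinv1) ((hnm.mul_const _).congr' ?_) hn
      (fun l => (har l).comp hk) (fun x => ha _) hr
    · refine hlim.congr' ?_
      filter_upwards [hj] with x hx
      simp [T, G, hx]
    · filter_upwards [hj] with x hx
      exact (hscale x j hx).symm
  · filter_upwards [hnm.eventually_le_const (show θ < 2 * θ by linarith),
      hnm.eventually_const_le (show θ / 2 < θ by linarith)] with x h1 h2 j
    have hpos : 0 < (n x : ℝ) / D ^ m x := by linarith
    have hC := hr.const_nonneg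
    by_cases hj : 0 ≤ j + m x
    · have hT : T x j = G (j + m x).toNat (n x) := if_pos hj
      have hnp : 0 < (n x : ℝ) * D⁻¹ ^ (j + m x).toNat := by
        rw [hscale x j hj]
        positivity
      have hp1 : D⁻¹ ^ (j + m x).toNat ≤ 1 := pow_le_one₀ hDinv0 hDinv1
      have h0 : 0 ≤ G (j + m x).toNat (n x) :=
        div_nonneg (binomialMean_nonneg (by positivity) hp1 (ha _).nonneg _) hnp.le
      rw [hT, Real.norm_eq_abs, abs_of_nonneg h0]
      refine ((ha _).binomialMean_div_le (by positivity) hp1 hnp).trans ?_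
      rw [hscale x j hj]
      refine mul_le_mul_of_nonneg_left ((min_mul_zpow_le hD hpos j).trans ?_) hC
      gcongr
    · have hT : T x j = 0 := if_neg hj
      rw [hT, norm_zero]
      positivity

/-! ### Decay of the Gamma function on vertical lines -/

theorem mul_pred_div_two_mul_sq_le_one_add_pow {y : ℝ} (hy : 0 ≤ y) (n : ℕ) :
    (n : ℝ) * (n - 1) / 2 * y ^ 2 ≤ (1 + y) ^ n := by
  induction n with
  | zero => simp
  | succ n ih =>
    have h1 := one_add_mul_le_pow (show -2 ≤ y by linarith) n
    have h2 := mul_le_mul_of_nonneg_right h1 hy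
    have h3 : (1 + y) ^ (n + 1) = (1 + y) ^ n + (1 + y) ^ n * y := by ring
    rw [h3]
    push_cast
    linarith

/-- The squared modulus of the Gamma function at `l + 1 + i s`, relative to `(l !) ^ 2`. -/
noncomputable def gammaRatio (s : ℝ) (l : ℕ) : ℝ :=
  ‖Complex.Gamma ((l : ℂ) + 1 + s * Complex.I)‖ ^ 2 / (l.factorial : ℝ) ^ 2

theorem gammaRatio_nonneg (s : ℝ) (l : ℕ) : 0 ≤ gammaRatio s l := by
  unfold gammaRatio; positivity

theorem gammaRatio_succ (s : ℝ) (l : ℕ) :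
    gammaRatio s (l + 1) = gammaRatio s l * (1 + s ^ 2 / ((l : ℝ) + 1) ^ 2) := by
  have hz : ((l : ℂ) + 1 + s * Complex.I) ≠ 0 := fun h => by
    have := congrArg Complex.re h
    simp at this
    norm_cast at this
  have hrec := Complex.Gamma_add_one _ hz
  have hcast : (((l + 1 : ℕ) : ℂ) + 1 + s * Complex.I) = (l : ℂ) + 1 + s * Complex.I + 1 := by
    push_cast; ring
  have hnorm : ‖(l : ℂ) + 1 + s * Complex.I‖ ^ 2 = ((l : ℝ) + 1) ^ 2 + s ^ 2 := by
    rw [← Complex.normSq_eq_norm_sq, Complex.normSq_apply]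
    simp
    ring
  unfold gammaRatio
  rw [hcast, hrec, norm_mul, mul_pow, hnorm, Nat.factorial_succ]
  push_cast
  field_simp

/-- The Gamma integral on the logarithmic scale, under the substitution `t = exp (L x)`. -/
theorem integral_gamma_kernel {L : ℝ} (hL : 0 < L) {s : ℂ} (hs : 0 < s.re) :
    Integrable (fun x : ℝ => Complex.exp (s * (L * x)) * (Real.exp (-Real.exp (L * x)) : ℝ)) ∧
    ∫ x : ℝ, Complex.exp (s * (L * x)) * (Real.exp (-Real.exp (L * x)) : ℝ) =
      Complex.Gamma s / L := by
  have himage : (fun x : ℝ => Real.exp (L * x)) '' Set.univ = Set.Ioi 0 := by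
    ext t
    simp only [Set.image_univ, Set.mem_range, Set.mem_Ioi]
    constructor
    · rintro ⟨x, rfl⟩; exact Real.exp_pos _
    · intro ht
      exact ⟨Real.log t / L, by rw [mul_div_cancel₀ _ hL.ne', Real.exp_log ht]⟩
  have hderiv : ∀ x ∈ (Set.univ : Set ℝ), HasDerivWithinAt (fun x : ℝ => Real.exp (L * x))
      (Real.exp (L * x) * L) Set.univ x := fun x _ => by
    have := ((hasDerivAt_id x).const_mul L).exp
    simp only [id, mul_one] at this
    exact this.hasDerivWithinAt
  have hinj : Set.InjOn (fun x : ℝ => Real.exp (L * x)) Set.univ := fun a _ b _ h => by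
    have := Real.exp_injective h
    exact mul_left_cancel₀ hL.ne' this
  have hfun : ∀ x : ℝ, |Real.exp (L * x) * L| • ((Real.exp (-Real.exp (L * x)) : ℂ) *
      (Real.exp (L * x) : ℂ) ^ (s - 1)) =
      L * (Complex.exp (s * (L * x)) * (Real.exp (-Real.exp (L * x)) : ℝ)) := fun x => by
    rw [abs_of_pos (by positivity), Complex.real_smul, Complex.cpow_def_of_ne_zero (by
      exact_mod_cast (Real.exp_pos _).ne'), ← Complex.ofReal_log (Real.exp_pos _).le, Real.log_exp]
    have : Complex.exp (s * (L * x)) = Complex.exp ((L * x : ℝ) * (s - 1)) * Real.exp (L * x) := by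
      rw [Complex.ofReal_exp, ← Complex.exp_add]
      congr 1
      push_cast
      ring
    rw [this]
    push_cast
    ring
  have hLc : (L : ℂ) ≠ 0 := by exact_mod_cast hL.ne'
  constructor
  · have h := (integrableOn_image_iff_integrableOn_abs_deriv_smul MeasurableSet.univ hderiv hinj
      (fun t : ℝ => (Real.exp (-t) : ℂ) * (t : ℂ) ^ (s - 1))).1 (by
        rw [himage]; exact Complex.GammaIntegral_convergent hs)
    rw [integrableOn_univ] at h
    simp only [hfun] at h
    exact (h.const_mul (L : ℂ)⁻¹).congr (Eventually.of_forall fun x => by field_simp)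
  · have h := integral_image_eq_integral_abs_deriv_smul MeasurableSet.univ hderiv hinj
      (fun t : ℝ => (Real.exp (-t) : ℂ) * (t : ℂ) ^ (s - 1))
    rw [himage, setIntegral_univ] at h
    simp only [hfun] at h
    rw [integral_const_mul] at h
    rw [Complex.Gamma_eq_integral hs, Complex.GammaIntegral, h]
    field_simp

theorem norm_gamma_kernel (L : ℝ) (s : ℂ) (x : ℝ) :
    ‖Complex.exp (s * (L * x)) * (Real.exp (-Real.exp (L * x)) : ℝ)‖ =
      Real.exp (s.re * (L * x)) * Real.exp (-Real.exp (L * x)) := by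
  rw [norm_mul, Complex.norm_exp, Complex.norm_real, Real.norm_eq_abs, abs_of_pos (Real.exp_pos _)]
  congr 2
  simp [Complex.mul_re]

theorem integral_norm_gamma_kernel {L : ℝ} (hL : 0 < L) {s : ℂ} (hs : 0 < s.re) :
    ∫ x : ℝ, ‖Complex.exp (s * (L * x)) * (Real.exp (-Real.exp (L * x)) : ℝ)‖ =
      Real.Gamma s.re / L := by
  have h := (integral_gamma_kernel hL (s := (s.re : ℂ)) (by simpa using hs)).2
  have h2 : (fun x : ℝ => Complex.exp ((s.re : ℂ) * (L * x)) *
      (Real.exp (-Real.exp (L * x)) : ℝ)) = fun x : ℝ =>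
      ((Real.exp (s.re * (L * x)) * Real.exp (-Real.exp (L * x)) : ℝ) : ℂ) := by
    funext x; push_cast; rfl
  rw [h2, integral_complex_ofReal, Complex.Gamma_ofReal] at h
  simp only [norm_gamma_kernel]
  exact_mod_cast h

theorem Complex.norm_Gamma_le_Gamma_re {s : ℂ} (hs : 0 < s.re) :
    ‖Complex.Gamma s‖ ≤ Real.Gamma s.re := by
  have h := norm_integral_le_integral_norm (μ := volume) (fun x : ℝ =>
    Complex.exp (s * ((1 : ℝ) * x)) * (Real.exp (-Real.exp (1 * x)) : ℝ))
  rw [(integral_gamma_kernel one_pos hs).2, integral_norm_gamma_kernel one_pos hs] at h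
  simpa using h

theorem gammaRatio_le_one (s : ℝ) (l : ℕ) : gammaRatio s l ≤ 1 := by
  have h := Complex.norm_Gamma_le_Gamma_re (s := (l : ℂ) + 1 + s * Complex.I) (by simp; positivity)
  have hre : ((l : ℂ) + 1 + s * Complex.I).re = l + 1 := by simp
  rw [hre, Real.Gamma_nat_eq_factorial] at h
  rw [gammaRatio, div_le_one (by positivity)]
  gcongr

/-- Comparing the values at `l` and at about `2 l` through the functional equation gains a factor
of the order of `(l / s ^ 2) ^ 2`. -/
theorem gammaRatio_mul_le {s : ℝ} (l : ℕ) :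
    gammaRatio s l * (s ^ 2) ^ 2 ≤ 32 * ((l : ℝ) + 1) ^ 2 := by
  set y := s ^ 2 / (2 * ((l : ℝ) + 1)) ^ 2 with hy
  have hy0 : 0 ≤ y := by positivity
  have hstep : ∀ n ≤ l + 2, gammaRatio s l * (1 + y) ^ n ≤ gammaRatio s (l + n) := by
    intro n
    induction n with
    | zero => simp
    | succ n ih =>
      intro hn
      rw [pow_succ, ← mul_assoc, ← add_assoc, gammaRatio_succ]
      have h1 := ih (by omega)
      have h2 : y ≤ s ^ 2 / (((l + n : ℕ) : ℝ) + 1) ^ 2 := by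
        rw [hy]
        have : (n : ℝ) ≤ l + 1 := by exact_mod_cast (by omega : n ≤ l + 1)
        gcongr
        push_cast
        linarith
      have := gammaRatio_nonneg s (l + n)
      gcongr
  have h1 := (hstep (l + 2) le_rfl).trans (gammaRatio_le_one s _)
  have h2 := mul_pred_div_two_mul_sq_le_one_add_pow hy0 (l + 2)
  have h3 : (s ^ 2) ^ 2 / (32 * ((l : ℝ) + 1) ^ 2) ≤ (1 + y) ^ (l + 2) := by
    refine le_trans ?_ h2
    have hl : (0 : ℝ) < (l : ℝ) + 1 := by positivity
    have h4 : (s ^ 2) ^ 2 / (32 * ((l : ℝ) + 1) ^ 2) =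
        ((l : ℝ) + 1) * (l + 1) / 2 * y ^ 2 := by
      rw [hy]; field_simp; ring
    rw [h4]
    push_cast
    gcongr <;> linarith
  have h5 : gammaRatio s l * ((s ^ 2) ^ 2 / (32 * ((l : ℝ) + 1) ^ 2)) ≤ 1 :=
    (mul_le_mul_of_nonneg_left h3 (gammaRatio_nonneg s l)).trans h1
  rw [← mul_div_assoc, div_le_one (by positivity)] at h5
  exact h5

/-- Interpolation between the bounds `l !` and `l ! * u`. The exponent `5 / 8` exceeds `1 / 2`, so that
the bound is summable over the frequencies, but is below `3 / 4`, so that the growth in `l` is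
compensated by coefficients decaying like `l ^ (-7 / 4)`. -/
theorem norm_Gamma_vertical_le {s : ℝ} (hs : s ≠ 0) (l : ℕ) :
    ‖Complex.Gamma ((l : ℂ) + 1 + s * Complex.I)‖ ≤
      l.factorial * (6 * (((l : ℝ) + 1) / s ^ 2)) ^ (5 / 8 : ℝ) := by
  have hs2 : 0 < s ^ 2 := by positivity
  set u := 6 * (((l : ℝ) + 1) / s ^ 2) with hu
  have hu0 : 0 < u := by positivity
  have hle1 : ‖Complex.Gamma ((l : ℂ) + 1 + s * Complex.I)‖ ≤ l.factorial * 1 := by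
    have h := gammaRatio_le_one s l
    rw [gammaRatio, div_le_one (by positivity)] at h
    rw [mul_one]
    exact (pow_le_pow_iff_left₀ (norm_nonneg _) (by positivity) two_ne_zero).1 h
  have hleu : ‖Complex.Gamma ((l : ℂ) + 1 + s * Complex.I)‖ ≤ l.factorial * u := by
    have h := gammaRatio_mul_le (s := s) l
    rw [gammaRatio, div_mul_eq_mul_div, div_le_iff₀ (by positivity)] at h
    refine (pow_le_pow_iff_left₀ (norm_nonneg _) (by positivity) two_ne_zero).1 ?_
    have h2 : (l.factorial * u) ^ 2 * (s ^ 2) ^ 2 =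
        36 * ((l : ℝ) + 1) ^ 2 * (l.factorial : ℝ) ^ 2 := by
      rw [hu]; field_simp; ring
    refine le_of_mul_le_mul_right ?_ (by positivity : 0 < (s ^ 2) ^ 2)
    rw [h2]
    refine h.trans ?_
    gcongr
    norm_num
  rcases le_total u 1 with h1 | h1
  · refine hleu.trans ?_
    gcongr
    calc u = u ^ (1 : ℝ) := (Real.rpow_one u).symm
      _ ≤ _ := Real.rpow_le_rpow_of_exponent_ge hu0 h1 (by norm_num)
  · refine hle1.trans ?_
    gcongr
    exact Real.one_le_rpow h1 (by norm_num)

/-! ### The Fourier series of the limit -/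

theorem IsGain.coeff_le {C : ℝ} {r : ℕ → ℝ} (hr : IsGain C r) (l : ℕ) :
    r (l + 2) / (l + 2).factorial ≤ C / l.factorial := by
  rw [div_le_div_iff₀ (by positivity) (by positivity), Nat.factorial_succ, Nat.factorial_succ]
  have h := hr.le_mul_pred (l + 2)
  push_cast at h ⊢
  have : (0 : ℝ) ≤ l.factorial := by positivity
  calc _ ≤ C * (((l : ℝ) + 2) * ((l : ℝ) + 2 - 1)) * l.factorial := by gcongr
    _ = _ := by ring

theorem IsGain.coeff_nonneg {C : ℝ} {r : ℕ → ℝ} (hr : IsGain C r) (l : ℕ) :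
    0 ≤ r (l + 2) / (l + 2).factorial := div_nonneg (hr.nonneg _) (by positivity)

theorem IsGain.profile_term_le {C M : ℝ} {r : ℕ → ℝ} (hr : IsGain C r) (l : ℕ) {t : ℝ}
    (ht : |t| ≤ M) : ‖r (l + 2) / (l + 2).factorial * (t ^ (l + 1) * Real.exp (-t))‖ ≤
      C * (M * Real.exp M) * (M ^ l / l.factorial) := by
  have hM : 0 ≤ M := (abs_nonneg t).trans ht
  have hC := hr.const_nonneg
  rw [norm_mul, norm_mul, norm_pow, Real.norm_eq_abs, Real.norm_eq_abs, Real.norm_eq_abs,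
    abs_of_nonneg (hr.coeff_nonneg l), abs_of_pos (Real.exp_pos _)]
  have h1 := hr.coeff_le l
  have h2 : -t ≤ M := (neg_le_abs t).trans ht
  calc _ ≤ C / l.factorial * (M ^ (l + 1) * Real.exp M) :=
        mul_le_mul h1 (by gcongr) (by positivity) (by positivity)
    _ = _ := by ring

theorem continuous_poissonProfile {C : ℝ} {r : ℕ → ℝ} (hr : IsGain C r) :
    Continuous (poissonProfile r) := by
  rw [continuous_iff_continuousAt]
  intro t
  have h : ContinuousOn (poissonProfile r) (Metric.closedBall 0 (|t| + 1)) := by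
    refine continuousOn_tsum (u := fun l : ℕ => C * ((|t| + 1) * Real.exp (|t| + 1)) *
      ((|t| + 1) ^ l / l.factorial)) (fun l => ?_) ?_ fun l x hx => ?_
    · fun_prop
    · exact (Real.summable_pow_div_factorial _).mul_left _
    · exact hr.profile_term_le l (by simpa using hx)
  refine h.continuousAt (Metric.closedBall_mem_nhds_of_mem ?_)
  simp

/-- The profile along the logarithmic scale. -/
noncomputable def logProfile (r : ℕ → ℝ) (L : ℝ) (x : ℝ) : ℂ :=
  (poissonProfile r (Real.exp (L * x)) : ℝ)

theorem continuous_logProfile {C : ℝ} {r : ℕ → ℝ} (hr : IsGain C r) (L : ℝ) :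
    Continuous (logProfile r L) := by
  have := continuous_poissonProfile hr
  unfold logProfile
  fun_prop

theorem norm_logProfile_le {C : ℝ} {r : ℕ → ℝ} (hr : IsGain C r) {L : ℝ} (hL : 0 < L) (x : ℝ) :
    ‖logProfile r L x‖ ≤ C * Real.exp (-(L / 2 * |x|)) := by
  have hpos := Real.exp_pos (L * x)
  rw [logProfile, Complex.norm_real, Real.norm_eq_abs, abs_of_nonneg (poissonProfile_nonneg hr hpos)]
  refine (poissonProfile_le hr hpos).trans (mul_le_mul_of_nonneg_left ?_ hr.const_nonneg)
  rcases le_total 0 x with hx | hx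
  · refine (min_le_right _ _).trans (le_of_eq ?_)
    rw [abs_of_nonneg hx, ← Real.exp_half, ← Real.exp_neg]
    congr 1; ring
  · refine (min_le_left _ _).trans (Real.exp_le_exp.2 ?_)
    rw [abs_of_nonpos hx]
    nlinarith

theorem isBigO_logProfile {C : ℝ} {r : ℕ → ℝ} (hr : IsGain C r) {L : ℝ} (hL : 0 < L) :
    logProfile r L =O[cocompact ℝ] fun x : ℝ => |x| ^ (-(2 : ℝ)) := by
  refine Asymptotics.IsBigO.of_bound (C * (8 / L ^ 2)) ?_
  filter_upwards [(isCompact_singleton (x := (0 : ℝ))).compl_mem_cocompact] with x hx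
  have hx0 : 0 < |x| := abs_pos.2 hx
  refine (norm_logProfile_le hr hL x).trans ?_
  have hC := hr.const_nonneg
  rw [mul_assoc, Real.norm_eq_abs, abs_of_nonneg (Real.rpow_nonneg hx0.le _),
    Real.rpow_neg hx0.le, show (2 : ℝ) = ((2 : ℕ) : ℝ) by norm_num, Real.rpow_natCast]
  gcongr
  have h := Real.quadratic_le_exp_of_nonneg (show 0 ≤ L / 2 * |x| by positivity)
  rw [Real.exp_neg, inv_le_comm₀ (Real.exp_pos _) (by positivity)]
  have h2 : (8 / L ^ ((2 : ℕ) : ℝ) * (|x| ^ 2)⁻¹)⁻¹ = (L / 2 * |x|) ^ 2 / 2 := by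
    rw [Real.rpow_natCast]
    field_simp
    ring
  have h3 : 0 ≤ L / 2 * |x| := by positivity
  norm_num at h2 ⊢
  rw [h2]
  linarith

/-- The `l`-th contribution to the `n`-th Fourier coefficient. -/
noncomputable def gammaTerm (r : ℕ → ℝ) (L : ℝ) (n : ℤ) (l : ℕ) : ℂ :=
  ((r (l + 2) / (l + 2).factorial / L : ℝ) : ℂ) *
    Complex.Gamma ((l : ℂ) + 1 - 2 * Real.pi * Complex.I * n / L)

theorem gammaTerm_arg (L : ℝ) (n : ℤ) (l : ℕ) :
    (l : ℂ) + 1 - 2 * Real.pi * Complex.I * n / L =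
      (l : ℂ) + 1 + ((-(2 * Real.pi * n / L) : ℝ) : ℂ) * Complex.I := by
  push_cast; ring

theorem gammaTerm_arg_re (L : ℝ) (n : ℤ) (l : ℕ) :
    ((l : ℂ) + 1 - 2 * Real.pi * Complex.I * n / L).re = (l : ℝ) + 1 := by
  rw [gammaTerm_arg]; simp

/-- The coefficients weighted with factorials decay like `l ^ (-7 / 4)`. -/
theorem coeff_mul_factorial_le {C : ℝ} {r : ℕ → ℝ} (hC : 0 ≤ C)
    (hr : ∀ l, r l ≤ C * (l : ℝ) ^ (1 / 4 : ℝ)) (l : ℕ) :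
    r (l + 2) / (l + 2).factorial * l.factorial ≤ 2 * C * ((l : ℝ) + 1) ^ (-(7 / 4) : ℝ) := by
  have hl : (0 : ℝ) < (l : ℝ) + 1 := by positivity
  have h1 : r (l + 2) / (l + 2).factorial * l.factorial =
      r (l + 2) / (((l : ℝ) + 2) * ((l : ℝ) + 1)) := by
    rw [Nat.factorial_succ, Nat.factorial_succ]
    push_cast
    field_simp
    ring
  have h2 : r (l + 2) ≤ C * (2 * ((l : ℝ) + 1) ^ (1 / 4 : ℝ)) := by
    refine (hr (l + 2)).trans (mul_le_mul_of_nonneg_left ?_ hC)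
    calc ((l + 2 : ℕ) : ℝ) ^ (1 / 4 : ℝ) ≤ (2 * ((l : ℝ) + 1)) ^ (1 / 4 : ℝ) := by
          gcongr; push_cast; linarith
      _ = 2 ^ (1 / 4 : ℝ) * ((l : ℝ) + 1) ^ (1 / 4 : ℝ) := Real.mul_rpow (by norm_num) hl.le
      _ ≤ _ := by
        gcongr
        calc (2 : ℝ) ^ (1 / 4 : ℝ) ≤ 2 ^ (1 : ℝ) :=
              Real.rpow_le_rpow_of_exponent_le (by norm_num) (by norm_num)
          _ = 2 := Real.rpow_one 2
  rw [h1, div_le_iff₀ (by positivity)]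
  have h3 : ((l : ℝ) + 1) ^ (-(7 / 4) : ℝ) * (((l : ℝ) + 1) * ((l : ℝ) + 1)) =
      ((l : ℝ) + 1) ^ (1 / 4 : ℝ) := by
    rw [← pow_two, ← Real.rpow_natCast, ← Real.rpow_add hl]
    norm_num
  have h4 : 0 ≤ ((l : ℝ) + 1) ^ (-(7 / 4) : ℝ) := by positivity
  calc _ ≤ C * (2 * ((l : ℝ) + 1) ^ (1 / 4 : ℝ)) := h2
    _ = 2 * C * (((l : ℝ) + 1) ^ (-(7 / 4) : ℝ) * (((l : ℝ) + 1) * ((l : ℝ) + 1))) := by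
        rw [h3]; ring
    _ ≤ 2 * C * (((l : ℝ) + 1) ^ (-(7 / 4) : ℝ) * (((l : ℝ) + 2) * ((l : ℝ) + 1))) := by
        gcongr; linarith
    _ = _ := by ring

theorem summable_succ_rpow {p : ℝ} (hp : p < -1) : Summable fun l : ℕ => ((l : ℝ) + 1) ^ p := by
  have h := (summable_nat_add_iff 1).2 (Real.summable_nat_rpow.2 hp)
  exact h.congr fun l => by push_cast; rfl

theorem summable_coeff_mul_factorial {C : ℝ} {r : ℕ → ℝ} (hC : 0 ≤ C) (hr0 : ∀ l, 0 ≤ r l)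
    (hr : ∀ l, r l ≤ C * (l : ℝ) ^ (1 / 4 : ℝ)) :
    Summable fun l : ℕ => r (l + 2) / (l + 2).factorial * l.factorial := by
  refine Summable.of_nonneg_of_le (fun l => by have := hr0 (l + 2); positivity)
    (coeff_mul_factorial_le hC hr) ((summable_succ_rpow (by norm_num)).mul_left _)

theorem norm_gammaTerm_le {r : ℕ → ℝ} (hr0 : ∀ l, 0 ≤ r l) {L : ℝ} (hL : 0 < L) (n : ℤ) (l : ℕ) :
    ‖gammaTerm r L n l‖ ≤ r (l + 2) / (l + 2).factorial * l.factorial / L := by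
  have h := Complex.norm_Gamma_le_Gamma_re
    (s := (l : ℂ) + 1 - 2 * Real.pi * Complex.I * n / L) (by rw [gammaTerm_arg_re]; positivity)
  rw [gammaTerm_arg_re, Real.Gamma_nat_eq_factorial] at h
  have := hr0 (l + 2)
  rw [gammaTerm, norm_mul, Complex.norm_real, Real.norm_eq_abs, abs_of_nonneg (by positivity)]
  calc _ ≤ r (l + 2) / (l + 2).factorial / L * l.factorial := by gcongr
    _ = _ := by ring

theorem summable_gammaTerm {C : ℝ} {r : ℕ → ℝ} (hC : 0 ≤ C) (hr0 : ∀ l, 0 ≤ r l)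
    (hr : ∀ l, r l ≤ C * (l : ℝ) ^ (1 / 4 : ℝ)) {L : ℝ} (hL : 0 < L) (n : ℤ) :
    Summable (gammaTerm r L n) :=
  Summable.of_norm_bounded ((summable_coeff_mul_factorial hC hr0 hr).div_const L)
    (norm_gammaTerm_le hr0 hL n)

/-- The Fourier coefficients are absolutely summable, by the decay of the Gamma function. -/
theorem summable_tsum_gammaTerm {C : ℝ} {r : ℕ → ℝ} (hC : 0 ≤ C) (hr0 : ∀ l, 0 ≤ r l)
    (hr : ∀ l, r l ≤ C * (l : ℝ) ^ (1 / 4 : ℝ)) {L : ℝ} (hL : 0 < L) :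
    Summable fun n : ℤ => ∑' l, gammaTerm r L n l := by
  set K : ℝ := 2 * C / L * (6 * (L / (2 * Real.pi)) ^ 2) ^ (5 / 8 : ℝ) with hK
  have hterm : ∀ n : ℤ, n ≠ 0 → ∀ l, ‖gammaTerm r L n l‖ ≤
      K * |(n : ℝ)| ^ (-(5 / 4) : ℝ) * ((l : ℝ) + 1) ^ (-(9 / 8) : ℝ) := by
    intro n hn l
    have hnR : (n : ℝ) ≠ 0 := by exact_mod_cast hn
    have hl : (0 : ℝ) < (l : ℝ) + 1 := by positivity
    have hn0 : 0 < |(n : ℝ)| := abs_pos.2 hnR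
    have hs : -(2 * Real.pi * n / L) ≠ 0 := by
      have := Real.pi_ne_zero
      have := hL.ne'
      simp [hnR]
      tauto
    have hG := norm_Gamma_vertical_le hs l
    rw [← gammaTerm_arg] at hG
    have harg : 6 * (((l : ℝ) + 1) / (-(2 * Real.pi * n / L)) ^ 2) =
        6 * (L / (2 * Real.pi)) ^ 2 * (|(n : ℝ)| ^ (-(2 : ℝ)) * ((l : ℝ) + 1)) := by
      rw [Real.rpow_neg hn0.le, show (2 : ℝ) = ((2 : ℕ) : ℝ) by norm_num, Real.rpow_natCast, sq_abs]
      have := Real.pi_ne_zero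
      push_cast
      field_simp
    rw [harg, Real.mul_rpow (by positivity) (by positivity), Real.mul_rpow (by positivity) hl.le,
      ← Real.rpow_mul hn0.le] at hG
    have hcoef := coeff_mul_factorial_le hC hr l
    have hexp : (-(2 : ℝ)) * (5 / 8) = -(5 / 4) := by norm_num
    rw [hexp] at hG
    have hpow : ((l : ℝ) + 1) ^ (-(7 / 4) : ℝ) * ((l : ℝ) + 1) ^ (5 / 8 : ℝ) =
        ((l : ℝ) + 1) ^ (-(9 / 8) : ℝ) := by
      rw [← Real.rpow_add hl]; norm_num
    have := hr0 (l + 2)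
    rw [gammaTerm, norm_mul, Complex.norm_real, Real.norm_eq_abs, abs_of_nonneg (by positivity)]
    set X := (6 * (L / (2 * Real.pi)) ^ 2) ^ (5 / 8 : ℝ) with hX
    have hX0 : 0 ≤ X := by positivity
    set N := |(n : ℝ)| ^ (-(5 / 4) : ℝ) with hN
    have hN0 : 0 ≤ N := by positivity
    calc _ ≤ r (l + 2) / (l + 2).factorial / L *
          (l.factorial * (X * (N * ((l : ℝ) + 1) ^ (5 / 8 : ℝ)))) := by gcongr
      _ = r (l + 2) / (l + 2).factorial * l.factorial *
          (X * (N * ((l : ℝ) + 1) ^ (5 / 8 : ℝ)) / L) := by ring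
      _ ≤ 2 * C * ((l : ℝ) + 1) ^ (-(7 / 4) : ℝ) *
          (X * (N * ((l : ℝ) + 1) ^ (5 / 8 : ℝ)) / L) := by gcongr
      _ = 2 * C / L * X * N * (((l : ℝ) + 1) ^ (-(7 / 4) : ℝ) * ((l : ℝ) + 1) ^ (5 / 8 : ℝ)) := by
          ring
      _ = _ := by rw [hpow]
  have hsl : Summable fun l : ℕ => ((l : ℝ) + 1) ^ (-(9 / 8) : ℝ) :=
    summable_succ_rpow (by norm_num)
  have hsn : Summable fun n : ℤ => K * |(n : ℝ)| ^ (-(5 / 4) : ℝ) *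
      ∑' l : ℕ, ((l : ℝ) + 1) ^ (-(9 / 8) : ℝ) :=
    ((Real.summable_abs_int_rpow (by norm_num)).mul_left K).mul_right _
  refine Summable.of_norm_bounded_eventually hsn ?_
  filter_upwards [(Set.finite_singleton (0 : ℤ)).compl_mem_cofinite] with n hn
  have h2 := tsum_of_norm_bounded (hsl.mul_left (K * |(n : ℝ)| ^ (-(5 / 4) : ℝ))).hasSum
    (hterm n hn)
  rwa [tsum_mul_left] at h2

open FourierTransform in
/-- The Fourier transform of the profile on the logarithmic scale is a Mellin transform, computed
termwise by Gamma integrals. -/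
theorem fourier_logProfile {C C' : ℝ} {r : ℕ → ℝ} (hg : IsGain C' r) (hC : 0 ≤ C)
    (hr : ∀ l, r l ≤ C * (l : ℝ) ^ (1 / 4 : ℝ)) {L : ℝ} (hL : 0 < L) (n : ℤ) :
    𝓕 (logProfile r L) (n : ℝ) = ∑' l, gammaTerm r L n l := by
  set s : ℕ → ℂ := fun l => (l : ℂ) + 1 - 2 * Real.pi * Complex.I * n / L with hs
  have hre : ∀ l, (s l).re = (l : ℝ) + 1 := gammaTerm_arg_re L n
  have hre0 : ∀ l, 0 < (s l).re := fun l => by rw [hre]; positivity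
  let F : ℕ → ℝ → ℂ := fun l x => ((r (l + 2) / (l + 2).factorial : ℝ) : ℂ) *
    (Complex.exp (s l * (L * x)) * (Real.exp (-Real.exp (L * x)) : ℝ))
  have hFint : ∀ l, Integrable (F l) := fun l => (integral_gamma_kernel hL (hre0 l)).1.const_mul _
  have hFnorm : ∀ l, ∫ x, ‖F l x‖ = r (l + 2) / (l + 2).factorial * l.factorial / L := fun l => by
    simp only [F, norm_mul (((r (l + 2) / (l + 2).factorial : ℝ)) : ℂ), Complex.norm_real,
      Real.norm_eq_abs, abs_of_nonneg (hg.coeff_nonneg l)]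
    rw [integral_const_mul, integral_norm_gamma_kernel hL (hre0 l), hre,
      Real.Gamma_nat_eq_factorial]
    ring
  have hsum := hasSum_integral_of_summable_integral_norm hFint (by
    simp only [hFnorm]
    exact (summable_coeff_mul_factorial hC hg.nonneg hr).div_const L)
  have hval : ∀ l, ∫ x, F l x = gammaTerm r L n l := fun l => by
    simp only [F]
    rw [integral_const_mul, (integral_gamma_kernel hL (hre0 l)).2, gammaTerm]
    push_cast
    ring
  simp only [hval] at hsum
  rw [hsum.tsum_eq, Real.fourier_real_eq_integral_exp_smul]
  congr 1
  funext x
  have hLc : (L : ℂ) ≠ 0 := by exact_mod_cast hL.ne'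
  have hterm : ∀ l, F l x = Complex.exp (((-2 * Real.pi * x * n : ℝ) : ℂ) * Complex.I) *
      ((r (l + 2) / (l + 2).factorial * (Real.exp (L * x) ^ (l + 1) *
        Real.exp (-Real.exp (L * x))) : ℝ) : ℂ) := fun l => by
    have h1 : Complex.exp (s l * (L * x)) =
        Complex.exp (((-2 * Real.pi * x * n : ℝ) : ℂ) * Complex.I) *
          ((Real.exp (L * x) ^ (l + 1) : ℝ) : ℂ) := by
      rw [← Real.exp_nat_mul, Complex.ofReal_exp, ← Complex.exp_add]
      congr 1
      rw [hs]
      push_cast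
      field_simp
      ring
    simp only [F]
    rw [h1]
    push_cast
    ring
  simp only [hterm]
  rw [tsum_mul_left, ← Complex.ofReal_tsum]
  rfl

/-- The sum of the profiles over all scales is the sum of an absolutely convergent Fourier series,
by Poisson summation. -/
theorem hasSum_gammaTerm_exp {C C' : ℝ} {r : ℕ → ℝ} (hg : IsGain C' r) (hC : 0 ≤ C)
    (hr : ∀ l, r l ≤ C * (l : ℝ) ^ (1 / 4 : ℝ)) {L : ℝ} (hL : 0 < L) (x : ℝ) :
    HasSum (fun n : ℤ => (∑' l, gammaTerm r L n l) * Complex.exp (2 * Real.pi * Complex.I * n * x))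
      ((∑' j : ℤ, poissonProfile r (Real.exp (L * x) * Real.exp L ^ (-j)) : ℝ) : ℂ) := by
  have hFs := summable_tsum_gammaTerm hC hg.nonneg hr hL
  have hfou : ∀ n : ℤ, fourier n (x : UnitAddCircle) =
      Complex.exp (2 * Real.pi * Complex.I * n * x) := fun n => by
    rw [fourier_coe_apply]; simp
  have hpoisson := Real.tsum_eq_tsum_fourier_of_rpow_decay_of_summable
    (continuous_logProfile hg L) (by norm_num : (1 : ℝ) < 2) (isBigO_logProfile hg hL)
    (hFs.congr fun n => (fourier_logProfile hg hC hr hL n).symm) x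
  simp only [fourier_logProfile hg hC hr hL, hfou] at hpoisson
  have hsum : Summable fun n : ℤ => (∑' l, gammaTerm r L n l) *
      Complex.exp (2 * Real.pi * Complex.I * n * x) := by
    refine Summable.of_norm ((hFs.norm).congr fun n => ?_)
    have : (2 * Real.pi * Complex.I * n * x : ℂ) = ((2 * Real.pi * n * x : ℝ) : ℂ) * Complex.I := by
      push_cast; ring
    rw [norm_mul, this, Complex.norm_exp_ofReal_mul_I, mul_one]
  convert hsum.hasSum using 1
  rw [← hpoisson, Complex.ofReal_tsum, ← (Equiv.neg ℤ).tsum_eq]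
  refine tsum_congr fun j => ?_
  rw [logProfile]
  congr 2
  rw [← Real.rpow_intCast, ← Real.exp_mul, ← Real.exp_add]
  congr 1
  simp
  ring

/-! ### Almost sure convergence of the entropy per point -/

theorem mul_log_succ_le_sqrt (d : ℕ) (l : ℕ) : d * Real.log (l + 1) ≤ 2 * d * √l := by
  have h0 : (0 : ℝ) < (l : ℝ) + 1 := by positivity
  have h1 : Real.log (l + 1) = 2 * Real.log √(l + 1) := by
    rw [Real.log_sqrt h0.le]; ring
  have h2 := Real.log_le_sub_one_of_pos (Real.sqrt_pos.2 h0)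
  have h3 : √((l : ℝ) + 1) ≤ √l + 1 := by
    rw [Real.sqrt_le_left (by positivity)]
    nlinarith [Real.sq_sqrt (show (0 : ℝ) ≤ l by positivity), Real.sqrt_nonneg (l : ℝ)]
  have hd : (0 : ℝ) ≤ d := by positivity
  nlinarith

theorem isGain_entropyGain {d : ℕ} [NeZero d] (hd : 2 ≤ d) (S : TreeLabelling d) (k : ℕ) :
    IsGain (2 * d) fun l => (d : ℝ)⁻¹ ^ k * levelSum (entropyGain l) k S := by
  have hd0 : (0 : ℝ) < d := by exact_mod_cast NeZero.pos d
  have hz : ∀ l ≤ 1, levelSum (entropyGain l) k S = 0 := fun l hl => by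
    have : (entropyGain l : TreeLabelling d → ℝ) = fun _ => 0 :=
      funext fun S => entropyGain_of_le_one hd hl S
    rw [this, levelSum_const, mul_zero]
  refine ⟨fun l => ?_, by simp [hz 0], by simp [hz 1], fun l => ?_⟩
  · have := levelSum_mono (g := fun _ => 0) (entropyGain_nonneg hd l) k S
    rw [levelSum_const, mul_zero] at this
    positivity
  · have h := levelSum_mono (h := fun _ => 2 * d * √l)
      (fun S => (entropyGain_le hd l S).trans (mul_log_succ_le_sqrt d l)) k S
    rw [levelSum_const] at h
    calc _ ≤ (d : ℝ)⁻¹ ^ k * (d ^ k * (2 * d * √l)) := by gcongr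
      _ = _ := by
        rw [← mul_assoc, ← mul_pow, inv_mul_cancel₀ hd0.ne', one_pow, one_mul]

theorem isGain_meanGain {d : ℕ} [NeZero d] (hd : 2 ≤ d) (F : PMF (Equiv.Perm (Fin d))) :
    IsGain (2 * d) (meanGain F) :=
  ⟨meanGain_nonneg hd F, meanGain_of_le_one hd F (by norm_num), meanGain_of_le_one hd F le_rfl,
    fun l => (meanGain_le hd F l).trans (mul_log_succ_le_sqrt d l)⟩

/-- The logarithmic bound in the form of a small power. The exponent `1 / 4` is small enough for the
absolute summability of the Fourier coefficients. -/
theorem meanGain_le_rpow {d : ℕ} [NeZero d] (hd : 2 ≤ d) (F : PMF (Equiv.Perm (Fin d))) (l : ℕ) :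
    meanGain F l ≤ 8 * d * (l : ℝ) ^ (1 / 4 : ℝ) := by
  rcases Nat.eq_zero_or_pos l with rfl | hl
  · rw [meanGain_of_le_one hd F (by norm_num)]; positivity
  refine (meanGain_le hd F l).trans ?_
  have hl1 : (1 : ℝ) ≤ l := by exact_mod_cast hl
  have h1 := Real.log_le_rpow_div (show (0 : ℝ) ≤ (l : ℝ) + 1 by positivity)
    (show (0 : ℝ) < 1 / 4 by norm_num)
  have h2 : ((l : ℝ) + 1) ^ (1 / 4 : ℝ) ≤ 2 * (l : ℝ) ^ (1 / 4 : ℝ) := by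
    calc ((l : ℝ) + 1) ^ (1 / 4 : ℝ) ≤ (2 * (l : ℝ)) ^ (1 / 4 : ℝ) := by gcongr; linarith
      _ = 2 ^ (1 / 4 : ℝ) * (l : ℝ) ^ (1 / 4 : ℝ) := Real.mul_rpow (by norm_num) (by positivity)
      _ ≤ _ := by
        gcongr
        calc (2 : ℝ) ^ (1 / 4 : ℝ) ≤ 2 ^ (1 : ℝ) :=
              Real.rpow_le_rpow_of_exponent_le (by norm_num) (by norm_num)
          _ = 2 := Real.rpow_one 2
  have hd0 : (0 : ℝ) ≤ d := by positivity
  calc d * Real.log (l + 1) ≤ d * (8 * (l : ℝ) ^ (1 / 4 : ℝ)) := by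
        gcongr
        linarith
    _ = _ := by ring

theorem treeEntropy_div_eq_tsum {d : ℕ} [NeZero d] (hd : 2 ≤ d) (n : ℕ) (S : TreeLabelling d) :
    treeEntropy n S / n = ∑' k : ℕ, binomialMean ((d : ℝ)⁻¹ ^ k)
      (fun l => (d : ℝ)⁻¹ ^ k * levelSum (entropyGain l) k S) n / (n * (d : ℝ)⁻¹ ^ k) := by
  have hd0 : (d : ℝ) ≠ 0 := by simpa using NeZero.ne d
  rw [← (hasSum_treeEntropy hd n S).tsum_eq, ← tsum_div_const]
  refine tsum_congr fun k => ?_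
  rw [binomialMean_const_mul, mul_comm (n : ℝ), mul_div_mul_left _ _ (by positivity)]

theorem tendsto_natFloor_div {d : ℕ} (hd : 2 ≤ d) (x : ℝ) :
    Tendsto (fun q : ℕ × ℝ => (⌊(d : ℝ) ^ (q.2 + (q.1 : ℝ))⌋₊ : ℝ) / (d : ℝ) ^ q.1)
      (atTop ×ˢ 𝓝 x) (𝓝 ((d : ℝ) ^ x)) := by
  have hd0 : (0 : ℝ) < d := by positivity
  have hdinv : (d : ℝ)⁻¹ < 1 := inv_lt_one_of_one_lt₀ (by exact_mod_cast hd)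
  have h1 : Tendsto (fun q : ℕ × ℝ => (d : ℝ) ^ q.2) (atTop ×ˢ 𝓝 x) (𝓝 ((d : ℝ) ^ x)) :=
    (Real.continuous_const_rpow hd0.ne').continuousAt.tendsto.comp tendsto_snd
  have h2 : Tendsto (fun q : ℕ × ℝ => (d : ℝ) ^ q.2 - (d : ℝ)⁻¹ ^ q.1) (atTop ×ˢ 𝓝 x)
      (𝓝 ((d : ℝ) ^ x)) := by
    simpa using h1.sub ((tendsto_pow_atTop_nhds_zero_of_lt_one (by positivity) hdinv).comp
      tendsto_fst)
  have hmul : ∀ q : ℕ × ℝ, (d : ℝ) ^ (q.2 + (q.1 : ℝ)) = (d : ℝ) ^ q.2 * (d : ℝ) ^ q.1 := fun q => by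
    rw [Real.rpow_add hd0, Real.rpow_natCast]
  refine tendsto_of_tendsto_of_tendsto_of_le_of_le h2 h1 (fun q => ?_) fun q => ?_
  · rw [le_div_iff₀ (by positivity), sub_mul, ← mul_pow, inv_mul_cancel₀ hd0.ne', one_pow, ← hmul]
    exact (Nat.sub_one_lt_floor _).le
  · rw [div_le_iff₀ (by positivity), ← hmul]
    exact Nat.floor_le (by positivity)

/-- The log-periodic limit: the sum of the Poisson profile of the mean gains over all scales. -/
noncomputable def limitProfile {d : ℕ} [NeZero d] (F : PMF (Equiv.Perm (Fin d))) (x : ℝ) : ℝ :=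
  ∑' j : ℤ, poissonProfile (meanGain F) ((d : ℝ) ^ x * (d : ℝ) ^ (-j))

theorem hasSum_limitProfile {d : ℕ} [NeZero d] (hd : 2 ≤ d) (F : PMF (Equiv.Perm (Fin d))) (x : ℝ) :
    HasSum (fun n : ℤ => (∑' l, gammaTerm (meanGain F) (Real.log d) n l) *
      Complex.exp (2 * Real.pi * Complex.I * n * x)) (limitProfile F x : ℂ) := by
  have hd0 : (0 : ℝ) < d := by positivity
  have h := hasSum_gammaTerm_exp (isGain_meanGain hd F) (by positivity) (meanGain_le_rpow hd F)
    (Real.log_pos (by exact_mod_cast hd : (1 : ℝ) < d)) x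
  rwa [Real.exp_log hd0, ← Real.rpow_def_of_pos hd0] at h

theorem summable_coeff_meanGain {d : ℕ} [NeZero d] (hd : 2 ≤ d) (F : PMF (Equiv.Perm (Fin d))) :
    Summable fun n : ℤ => ∑' l, gammaTerm (meanGain F) (Real.log d) n l :=
  summable_tsum_gammaTerm (by positivity) (meanGain_nonneg hd F) (meanGain_le_rpow hd F)
    (Real.log_pos (by exact_mod_cast hd))

theorem norm_mul_exp_two_pi (c : ℂ) (n : ℤ) (x : ℝ) :
    ‖c * Complex.exp (2 * Real.pi * Complex.I * n * x)‖ = ‖c‖ := by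
  have : (2 * Real.pi * Complex.I * n * x : ℂ) = ((2 * Real.pi * n * x : ℝ) : ℂ) * Complex.I := by
    push_cast; ring
  rw [norm_mul, this, Complex.norm_exp_ofReal_mul_I, mul_one]

theorem continuous_limitProfile {d : ℕ} [NeZero d] (hd : 2 ≤ d) (F : PMF (Equiv.Perm (Fin d))) :
    Continuous (limitProfile F) := by
  have h : Continuous fun x : ℝ => ∑' n : ℤ, (∑' l, gammaTerm (meanGain F) (Real.log d) n l) *
      Complex.exp (2 * Real.pi * Complex.I * n * x) :=
    continuous_tsum (fun n => by fun_prop) (summable_coeff_meanGain hd F).norm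
      fun n x => (norm_mul_exp_two_pi _ n x).le
  simp only [(hasSum_limitProfile hd F _).tsum_eq] at h
  simpa [Function.comp_def] using Complex.continuous_re.comp h

theorem isLogPeriodicLimit_limitProfile {d : ℕ} [NeZero d] (hd : 2 ≤ d)
    (F : PMF (Equiv.Perm (Fin d))) {S : TreeLabelling d}
    (hS : ∀ l, Tendsto (fun k => (d : ℝ)⁻¹ ^ k * levelSum (entropyGain l) k S) atTop
      (𝓝 (meanGain F l))) :
    IsLogPeriodicLimit (d : ℝ) (fun n : ℕ => samplingEntropy (treePermuton S) n / (n : ℝ))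
      (limitProfile F) := by
  rw [IsLogPeriodicLimit, tendstoLocallyUniformly_iff_filter]
  intro x
  rw [tendstoUniformlyOnFilter_iff_tendsto]
  have h1 : Tendsto (fun q : ℕ × ℝ => limitProfile F q.2) (atTop ×ˢ 𝓝 x)
      (𝓝 (limitProfile F x)) := (continuous_limitProfile hd F).continuousAt.tendsto.comp tendsto_snd
  have h2 := tendsto_tsum_levels (f := (atTop : Filter ℕ) ×ˢ 𝓝 x)
    (n := fun q => ⌊(d : ℝ) ^ (q.2 + (q.1 : ℝ))⌋₊) (m := Prod.fst) (D := d)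
    (by exact_mod_cast hd) (Real.rpow_pos_of_pos (by positivity) x) tendsto_fst
    (tendsto_natFloor_div hd x) (isGain_entropyGain hd S) (isGain_meanGain hd F) hS
  simp only [← treeEntropy_div_eq_tsum hd] at h2
  exact (h1.prodMk_nhds h2).mono_right (nhds_le_uniformity _)

/-! ### The mean of the limit -/

theorem integral_exp_two_pi (n : ℤ) :
    ∫ x in (0 : ℝ)..1, Complex.exp (2 * Real.pi * Complex.I * n * x) = if n = 0 then 1 else 0 := by
  split_ifs with h
  · simp [h]
  · have hc : (2 * Real.pi * Complex.I * n : ℂ) ≠ 0 := by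
      have := Real.pi_ne_zero
      simp [h]
    rw [integral_exp_mul_complex hc]
    have : (2 * Real.pi * Complex.I * n : ℂ) = n * (2 * Real.pi * Complex.I) := by ring
    rw [Complex.ofReal_one, mul_one, this, Complex.exp_int_mul_two_pi_mul_I]
    simp

theorem integral_limitProfile {d : ℕ} [NeZero d] (hd : 2 ≤ d) (F : PMF (Equiv.Perm (Fin d))) :
    ((∫ x in (0 : ℝ)..1, limitProfile F x : ℝ) : ℂ) =
      ∑' l, gammaTerm (meanGain F) (Real.log d) 0 l := by
  set c : ℤ → ℂ := fun n => ∑' l, gammaTerm (meanGain F) (Real.log d) n l with hc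
  let f : ℤ → C(ℝ, ℂ) := fun n =>
    ⟨fun x => c n * Complex.exp (2 * Real.pi * Complex.I * n * x), by fun_prop⟩
  have hsum := intervalIntegral.hasSum_intervalIntegral_of_summable_norm (a := 0) (b := 1) (f := f)
    (Summable.of_nonneg_of_le (fun _ => norm_nonneg _) (fun n => by
      rw [ContinuousMap.norm_le _ (norm_nonneg (c n))]
      exact fun x => (norm_mul_exp_two_pi (c n) n x).le) (summable_coeff_meanGain hd F).norm)
  have h1 : ∀ n : ℤ, ∫ x in (0 : ℝ)..1, f n x = if n = 0 then c 0 else 0 := fun n => by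
    have : ∀ x : ℝ, f n x = c n * Complex.exp (2 * Real.pi * Complex.I * n * x) := fun _ => rfl
    simp only [this]
    rw [intervalIntegral.integral_const_mul, integral_exp_two_pi]
    split_ifs with h <;> simp [h]
  have h2 : ∀ x : ℝ, ∑' n, f n x = (limitProfile F x : ℂ) := fun x =>
    (hasSum_limitProfile hd F x).tsum_eq
  simp only [h1, h2] at hsum
  rw [intervalIntegral.integral_ofReal] at hsum
  exact hsum.unique (hasSum_ite_eq 0 (c 0))

/-- The mean is a series of nonnegative terms, in which each mean gain has a positive weight. -/
theorem integral_limitProfile_eq_zero_iff {d : ℕ} [NeZero d] (hd : 2 ≤ d)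
    (F : PMF (Equiv.Perm (Fin d))) :
    ∫ x in (0 : ℝ)..1, limitProfile F x = 0 ↔ ∀ l, meanGain F l = 0 := by
  have hL : 0 < Real.log d := Real.log_pos (by exact_mod_cast hd)
  have hg := isGain_meanGain hd F
  have hterm : ∀ l, gammaTerm (meanGain F) (Real.log d) 0 l =
      ((meanGain F (l + 2) / (l + 2).factorial * l.factorial / Real.log d : ℝ) : ℂ) := fun l => by
    rw [gammaTerm]
    simp only [Int.cast_zero, mul_zero, zero_div, sub_zero]
    rw [Complex.Gamma_nat_eq_factorial]
    push_cast
    ring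
  have hs := (summable_coeff_mul_factorial (C := 8 * d) (by positivity) (meanGain_nonneg hd F)
    (meanGain_le_rpow hd F)).div_const (Real.log d)
  have h := integral_limitProfile hd F
  simp only [hterm] at h
  rw [← Complex.ofReal_tsum, Complex.ofReal_inj] at h
  have hnn : ∀ l : ℕ, 0 ≤ meanGain F (l + 2) / (l + 2).factorial * l.factorial / Real.log d :=
    fun l => by have := hg.nonneg (l + 2); positivity
  rw [h, ← hs.hasSum_iff, hasSum_zero_iff_of_nonneg hnn]
  constructor
  · intro h0 l
    rcases l with _ | _ | l
    · exact hg.zero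
    · exact hg.one
    · have h1 := congrFun h0 l
      simp only [Pi.zero_apply] at h1
      have hf1 : ((l + 2).factorial : ℝ) ≠ 0 := by positivity
      have hf2 : (l.factorial : ℝ) ≠ 0 := by positivity
      simpa [hL.ne', hf1, hf2] using h1
  · intro h0
    funext l
    simp [h0]

/-! ### Labellings of zero entropy -/

theorem Equiv.Perm.eq_one_of_strictMono {n : ℕ} {σ : Equiv.Perm (Fin n)} (h : StrictMono σ) :
    σ = 1 :=
  Fin.equiv_eq_of_strictMono (x := fun i : Fin n => ((i : ℕ) : ℝ)) (τ' := Equiv.refl _)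
    (fun i j hij => by simpa using h hij) fun i j hij => by simpa using hij

theorem Equiv.Perm.eq_revPerm_of_strictAnti {n : ℕ} {σ : Equiv.Perm (Fin n)} (h : StrictAnti σ) :
    σ = Fin.revPerm := by
  have h1 : Fin.revPerm * σ = 1 :=
    eq_one_of_strictMono fun i j hij => by simpa using h hij
  ext i
  have h2 := congrArg (fun π : Equiv.Perm (Fin n) => Fin.rev (π i)) h1
  simpa using congrArg Fin.val h2

theorem patternDensity_pos_of_cellDensity {d : ℕ} [NeZero d] {S : TreeLabelling d} {n : ℕ}
    {σ : Equiv.Perm (Fin n)} (κ : Fin n → Fin d) (h : 0 < cellDensity S (cellCount κ) σ) :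
    0 < patternDensity (treePermuton S) σ := by
  have hd0 : (0 : ℝ) < d := by exact_mod_cast NeZero.pos d
  rw [patternDensity_eq_sum]
  exact Finset.sum_pos' (fun κ _ => mul_nonneg (by positivity) (cellDensity_nonneg S _ σ))
    ⟨κ, Finset.mem_univ κ, mul_pos (by positivity) h⟩

theorem ae_pi_unitLebesgue {ι : Type*} [Fintype ι] {p : ℝ → Prop} (h : ∀ᵐ x ∂unitLebesgue, p x) :
    ∀ᵐ x ∂uniformPoints ι, ∀ j, p (x j) :=
  ae_all_iff.2 fun j => (measurePreserving_eval (fun _ : ι => unitLebesgue) j).quasiMeasurePreserving.ae h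

/-- Points in distinct cells follow the label of the root: a pattern contained in this label has
positive density. -/
theorem patternDensity_pos_of_strictMono {d : ℕ} [NeZero d] (hd : 2 ≤ d) {S : TreeLabelling d}
    {n : ℕ} {σ : Equiv.Perm (Fin n)} {κ : Fin n → Fin d} (hκ : StrictMono κ)
    (hσ : ∀ p q, S [] (κ p) < S [] (κ q) ↔ σ p < σ q) :
    0 < patternDensity (treePermuton S) σ := by
  refine patternDensity_pos_of_cellDensity κ ?_
  rw [← measureReal_cellPattern]
  have hae : ∀ᵐ x ∂uniformPoints (Fin n), x ∈ {x : Fin n → ℝ |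
      HasPattern (fun j => cellMap (κ j) (x j)) (fun j => treeMap S (cellMap (κ j) (x j))) σ} := by
    filter_upwards [ae_pi_unitLebesgue (ι := Fin n) ae_unitLebesgue_mem_Ico,
      ae_all_iff.2 fun j : Fin n => (measurePreserving_eval (fun _ : Fin n => unitLebesgue)
        j).quasiMeasurePreserving.ae (ae_treeMap_mem_Ico hd (subtree S (κ j)))] with x hx hy
    have hlt : ∀ p q, S [] (κ p) < S [] (κ q) →
        treeMap S (cellMap (κ p) (x p)) < treeMap S (cellMap (κ q) (x q)) := fun p q h => by
      rw [treeMap_cellMap S _ (hx p), treeMap_cellMap S _ (hx q)]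
      exact cellMap_lt_of_lt h (hy p).2 (hy q).1
    refine ⟨Equiv.refl _, fun p q hpq => cellMap_lt_of_lt (hκ hpq) (hx p).2 (hx q).1,
      fun p q => ?_⟩
    rw [← hσ]
    refine ⟨fun h => ?_, hlt p q⟩
    by_contra hc
    rcases (not_lt.1 hc).lt_or_eq with h' | h'
    · exact lt_asymm h (hlt q p h')
    · rw [hκ.injective ((S []).injective h')] at h
      exact lt_irrefl _ h
  rw [measureReal_def, (mem_ae_iff_prob_eq_one (measurableSet_cellPattern S κ σ)).1 hae, ENNReal.toReal_one]
  exact one_pos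

/-- With positive probability all points fall in one cell, so patterns of a subtree are patterns of
the tree. -/
theorem patternDensity_pos_of_subtree {d : ℕ} [NeZero d] {S : TreeLabelling d}
    {n : ℕ} {σ : Equiv.Perm (Fin n)} {i : Fin d}
    (h : 0 < patternDensity (treePermuton (subtree S i)) σ) :
    0 < patternDensity (treePermuton S) σ := by
  refine patternDensity_pos_of_cellDensity (fun _ => i) (h.trans_eq ?_)
  rw [← measureReal_cellPattern, patternDensity_treePermuton]
  refine measureReal_congr (eventuallyEq_set.2 ?_)
  filter_upwards [ae_pi_unitLebesgue (ι := Fin n) ae_unitLebesgue_mem_Ico] with x hx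
  have hs : SamePattern x (fun j => treeMap (subtree S i) (x j)) (fun j => cellMap i (x j))
      (fun j => treeMap S (cellMap i (x j))) :=
    ⟨Equiv.refl _, fun p q => ⟨(cellMap_lt_cellMap (NeZero.pos d) i).symm, by
      simp only [Equiv.refl_apply]
      rw [treeMap_cellMap S i (hx p), treeMap_cellMap S i (hx q),
        cellMap_lt_cellMap (NeZero.pos d)]⟩⟩
  exact ⟨HasPattern.congr hs, HasPattern.congr hs.symm⟩

theorem root_eq_revPerm_of_patternDensity {d : ℕ} [NeZero d] (hd : 2 ≤ d) {S : TreeLabelling d}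
    (h : patternDensity (treePermuton S) (1 : Equiv.Perm (Fin 2)) = 0) : S [] = Fin.revPerm := by
  refine Equiv.Perm.eq_revPerm_of_strictAnti fun i j hij => ?_
  by_contra hc
  have hlt : S [] i < S [] j :=
    (not_lt.1 hc).lt_of_ne fun he => hij.ne ((S []).injective he)
  refine (patternDensity_pos_of_strictMono hd (κ := ![i, j]) ?_ ?_).ne' h
  · rw [Fin.strictMono_iff_lt_succ]; simpa using hij
  · simp [Fin.forall_fin_two, hlt, hlt.le]

theorem root_eq_one_of_patternDensity {d : ℕ} [NeZero d] (hd : 2 ≤ d) {S : TreeLabelling d}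
    (h : patternDensity (treePermuton S) (Fin.revPerm : Equiv.Perm (Fin 2)) = 0) : S [] = 1 := by
  refine Equiv.Perm.eq_one_of_strictMono fun i j hij => ?_
  by_contra hc
  have hlt : S [] j < S [] i :=
    (not_lt.1 hc).lt_of_ne fun he => hij.ne' ((S []).injective he)
  refine (patternDensity_pos_of_strictMono hd (κ := ![i, j]) ?_ ?_).ne' h
  · rw [Fin.strictMono_iff_lt_succ]; simpa using hij
  · simp [Fin.forall_fin_two, hlt, hlt.le]

/-- If two points have a deterministic pattern, then the labels of the root and of any child are both
the identity or both the reversal: each contains the pattern of every pair of letters. -/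
theorem labels_eq_of_treeEntropy_two {d : ℕ} [NeZero d] (hd : 2 ≤ d) {S : TreeLabelling d}
    (h : treeEntropy 2 S = 0) (i : Fin d) :
    (S [] = 1 ∧ S [i] = 1) ∨ (S [] = Fin.revPerm ∧ S [i] = Fin.revPerm) := by
  have hσ : ∃ σ : Equiv.Perm (Fin 2), patternDensity (treePermuton S) σ = 0 := by
    by_contra! hne
    have h1 : ∀ σ : Equiv.Perm (Fin 2), patternDensity (treePermuton S) σ = 1 := fun σ => by
      have h0 := (Finset.sum_eq_zero_iff_of_nonneg fun σ _ =>
        Real.negMulLog_nonneg (patternDensity_nonneg (treePermuton S) σ) measureReal_le_one).1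
          (show ∑ σ : Equiv.Perm (Fin 2), _ = 0 from h) σ
          (Finset.mem_univ σ)
      rw [Real.negMulLog, neg_mul, neg_eq_zero] at h0
      exact Real.eq_one_of_pos_of_log_eq_zero
        ((patternDensity_nonneg _ σ).lt_of_ne' (hne σ)) ((mul_eq_zero.1 h0).resolve_left (hne σ))
    have h2 := sum_patternDensity hd S 2
    simp [h1, Fintype.card_perm] at h2
  obtain ⟨σ, hσ⟩ := hσ
  have hsub : patternDensity (treePermuton (subtree S i)) σ = 0 :=
    le_antisymm (not_lt.1 fun hp => (patternDensity_pos_of_subtree hp).ne' hσ)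
      (patternDensity_nonneg _ σ)
  have hcases : ∀ σ : Equiv.Perm (Fin 2), σ = 1 ∨ σ = Fin.revPerm := by decide
  rcases hcases σ with rfl | rfl
  · exact Or.inr ⟨root_eq_revPerm_of_patternDensity hd hσ,
      root_eq_revPerm_of_patternDensity hd hsub⟩
  · exact Or.inl ⟨root_eq_one_of_patternDensity hd hσ, root_eq_one_of_patternDensity hd hsub⟩

/-- For two points the entropy recursion reads `H₂ = gain + d⁻² * (sum of the H₂ of the subtrees)`, and
the subtrees have the law of the tree, so a vanishing mean gain forces `E H₂ = 0`. -/
theorem ae_treeEntropy_two_eq_zero {d : ℕ} [NeZero d] (hd : 2 ≤ d) {F : PMF (Equiv.Perm (Fin d))}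
    (h : meanGain F 2 = 0) : ∀ᵐ S ∂labellingLaw F, treeEntropy 2 S = 0 := by
  have hd1 : (1 : ℝ) < d := by exact_mod_cast hd
  have hint : Integrable (treeEntropy 2) (labellingLaw F) :=
    (memLp_of_bounded (a := 0) (b := 2)
      (Eventually.of_forall fun S => ⟨treeEntropy_nonneg 2 S, by
        have := treeEntropy_le hd 2 S
        norm_num at this ⊢
        exact this⟩)
      (measurable_treeEntropy 2).aestronglyMeasurable 2).integrable one_le_two
  have hgain : ∀ S : TreeLabelling d, entropyGain 2 S =
      treeEntropy 2 S - ∑ i, ((d : ℝ) ^ 2)⁻¹ * treeEntropy 2 (subtree S i) := fun S => by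
    have h0 := fun (l : ℕ) (hl : l ≤ 1) S => treeEntropy_of_le_one (d := d) hd hl S
    simp [entropyGain, binomialMean, h0, sq, mul_assoc]
  have hsub : ∀ i : Fin d, ∫ S, treeEntropy 2 (subtree S i) ∂labellingLaw F =
      ∫ S, treeEntropy 2 S ∂labellingLaw F := fun i => by
    rw [← (measurePreserving_subtree F i).map_eq, integral_map
      (measurable_subtree i).aemeasurable (measurable_treeEntropy 2).aestronglyMeasurable]
    rw [(measurePreserving_subtree F i).map_eq]
  have hisub : ∀ i : Fin d, Integrable (fun S => treeEntropy 2 (subtree S i)) (labellingLaw F) :=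
    fun i => (measurePreserving_subtree F i).integrable_comp_of_integrable hint
  have hE : (1 - (d : ℝ)⁻¹) * ∫ S, treeEntropy 2 S ∂labellingLaw F = 0 := by
    rw [← h, meanGain]
    simp only [hgain]
    rw [integral_sub hint (integrable_finsetSum _ fun i _ => (hisub i).const_mul _),
      integral_finsetSum _ fun i _ => (hisub i).const_mul _]
    simp only [integral_const_mul, hsub, Finset.sum_const, Finset.card_univ, Fintype.card_fin,
      nsmul_eq_mul]
    field_simp
  have hz := (mul_eq_zero.1 hE).resolve_left (sub_pos.2 (inv_lt_one_of_one_lt₀ hd1)).ne'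
  exact (integral_eq_zero_iff_of_nonneg (fun S => treeEntropy_nonneg 2 S) hint).1 hz

theorem labellingLaw_apply_pair {d : ℕ} (F : PMF (Equiv.Perm (Fin d))) {s t : List (Fin d)}
    (hst : s ≠ t) (a b : Equiv.Perm (Fin d)) :
    labellingLaw F {S | S s = a ∧ S t = b} = F a * F b := by
  have h := Measure.infinitePi_pi (μ := fun _ : List (Fin d) => F.toMeasure) (s := {s, t})
    (t := fun w => if w = s then {a} else {b}) fun _ _ => MeasurableSpace.measurableSet_top
  rw [Finset.prod_pair hst] at h
  simp only [if_true, if_neg hst.symm] at h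
  rw [PMF.toMeasure_apply_singleton _ _ MeasurableSpace.measurableSet_top,
    PMF.toMeasure_apply_singleton _ _ MeasurableSpace.measurableSet_top] at h
  rw [← h, labellingLaw]
  congr 1
  ext S
  simp [hst.symm]

/-- The labels of the root and of a child are independent with law `F`, so they can only almost surely
coincide if `F` is concentrated at one permutation. -/
theorem eq_pure_of_meanGain_two {d : ℕ} [NeZero d] (hd : 2 ≤ d) {F : PMF (Equiv.Perm (Fin d))}
    (h : meanGain F 2 = 0) : F = PMF.pure 1 ∨ F = PMF.pure Fin.revPerm := by
  have hae := ae_treeEntropy_two_eq_zero hd h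
  have hpair : ∀ a b, F a ≠ 0 → F b ≠ 0 →
      (a = 1 ∧ b = 1) ∨ (a = Fin.revPerm ∧ b = Fin.revPerm) := by
    intro a b ha hb
    by_contra hc
    have h0 : labellingLaw F {S | S [] = a ∧ S [(0 : Fin d)] = b} = 0 := by
      refine measure_mono_null (fun S hS => ?_) (ae_iff.1 hae)
      simp only [Set.mem_ofPred_eq] at hS ⊢
      intro hz
      have := labels_eq_of_treeEntropy_two hd hz 0
      rw [hS.1, hS.2] at this
      exact hc this
    rw [labellingLaw_apply_pair F (by simp)] at h0
    exact mul_ne_zero ha hb h0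
  obtain ⟨a, ha⟩ := F.support_nonempty
  rw [PMF.mem_support_iff] at ha
  have hF : F = PMF.pure a := by
    have h1 : F a = 1 := (F.apply_eq_one_iff a).2 (Set.eq_singleton_iff_unique_mem.2 ⟨ha, fun b hb => by
      rcases hpair a b ha hb with h | h <;> rw [h.1, h.2]⟩)
    ext b
    by_cases hb : b = a
    · rw [hb, h1, PMF.pure_apply_self]
    · rw [PMF.pure_apply_of_ne _ _ hb]
      by_contra hb0
      rcases hpair a b ha hb0 with h | h <;> exact hb (h.2.trans h.1.symm)
  rcases hpair a a ha ha with h | h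
  · exact Or.inl (hF.trans (by rw [h.1]))
  · exact Or.inr (hF.trans (by rw [h.1]))

theorem treeEntropy_eq_zero_of_ae {d : ℕ} [NeZero d] (hd : 2 ≤ d) {S : TreeLabelling d} {n : ℕ}
    (π : Equiv.Perm (Fin n)) (h : ∀ᵐ x ∂uniformPoints (Fin n), ∀ σ : Equiv.Perm (Fin n),
      HasPattern x (fun j => treeMap S (x j)) σ → σ = π) : treeEntropy n S = 0 := by
  have h0 : ∀ σ : Equiv.Perm (Fin n), σ ≠ π → patternDensity (treePermuton S) σ = 0 := by
    intro σ hσ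
    rw [patternDensity_treePermuton, measureReal_def, measure_mono_null _ (ae_iff.1 h),
      ENNReal.toReal_zero]
    intro x hx
    simp only [Set.mem_ofPred_eq] at hx ⊢
    exact fun hc => hσ (hc σ hx)
  have h1 : patternDensity (treePermuton S) π = 1 := by
    rw [← sum_patternDensity hd S n]
    exact (Finset.sum_eq_single π (fun σ _ hσ => h0 σ hσ) (by simp)).symm
  refine Finset.sum_eq_zero fun σ _ => ?_
  by_cases hσ : σ = π
  · rw [hσ, h1, Real.negMulLog_one]
  · rw [h0 σ hσ, Real.negMulLog_zero]

theorem treeMap_const_one {d : ℕ} [NeZero d] (hd : 2 ≤ d) {x : ℝ} (hx : x ∈ Set.Ico (0 : ℝ) 1) :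
    treeMap (fun _ : List (Fin d) => 1) x = x :=
  Real.ofDigits_digits hd hx

/-- Corresponding digits of `x` and of its image add up to `d - 1`. -/
theorem treeMap_const_revPerm {d : ℕ} [NeZero d] (hd : 2 ≤ d) {x : ℝ}
    (hx : x ∈ Set.Ico (0 : ℝ) 1) : treeMap (fun _ : List (Fin d) => Fin.revPerm) x = 1 - x := by
  rw [eq_sub_iff_add_eq]
  nth_rw 2 [← Real.ofDigits_digits hd hx]
  rw [← Real.ofDigits_const_last_eq_one' hd, treeMap, Real.ofDigits, Real.ofDigits, Real.ofDigits,
    ← Real.summable_ofDigitsTerm.tsum_add Real.summable_ofDigitsTerm]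
  refine tsum_congr fun k => ?_
  have hk := (Real.digits x d k).2
  simp only [Real.ofDigitsTerm, treeAction, Fin.revPerm_apply, Fin.val_rev, ← add_mul]
  congr 1
  norm_cast
  omega

theorem treeEntropy_const_one {d : ℕ} [NeZero d] (hd : 2 ≤ d) (n : ℕ) :
    treeEntropy n (fun _ : List (Fin d) => 1) = 0 := by
  refine treeEntropy_eq_zero_of_ae hd 1 ?_
  filter_upwards [ae_pi_unitLebesgue (ι := Fin n) ae_unitLebesgue_mem_Ico] with x hx σ hσ
  obtain ⟨τ, h1, h2⟩ := hσ
  refine Equiv.Perm.eq_one_of_strictMono fun i j hij => (h2 i j).1 ?_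
  beta_reduce
  rw [treeMap_const_one hd (hx _), treeMap_const_one hd (hx _)]
  exact h1 hij

theorem treeEntropy_const_revPerm {d : ℕ} [NeZero d] (hd : 2 ≤ d) (n : ℕ) :
    treeEntropy n (fun _ : List (Fin d) => Fin.revPerm) = 0 := by
  refine treeEntropy_eq_zero_of_ae hd Fin.revPerm ?_
  filter_upwards [ae_pi_unitLebesgue (ι := Fin n) ae_unitLebesgue_mem_Ico] with x hx σ hσ
  obtain ⟨τ, h1, h2⟩ := hσ
  refine Equiv.Perm.eq_revPerm_of_strictAnti fun i j hij => (h2 j i).1 ?_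
  beta_reduce
  rw [treeMap_const_revPerm hd (hx _), treeMap_const_revPerm hd (hx _)]
  exact sub_lt_sub_left (h1 hij) 1

theorem meanGain_pure {d : ℕ} [NeZero d] {α : Equiv.Perm (Fin d)}
    (h : ∀ n, treeEntropy n (fun _ : List (Fin d) => α) = 0) (l : ℕ) :
    meanGain (PMF.pure α) l = 0 := by
  have hlaw : labellingLaw (PMF.pure α) = Measure.dirac fun _ => α := by
    rw [labellingLaw, PMF.toMeasure_pure, Measure.infinitePi_dirac]
  have hsub : ∀ i, subtree (fun _ : List (Fin d) => α) i = fun _ => α := fun _ => rfl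
  rw [meanGain, hlaw, integral_dirac' _ _ (measurable_entropyGain l).stronglyMeasurable,
    entropyGain]
  simp [hsub, h, binomialMean_const]

theorem forall_meanGain_eq_zero_iff {d : ℕ} [NeZero d] (hd : 2 ≤ d)
    (F : PMF (Equiv.Perm (Fin d))) :
    (∀ l, meanGain F l = 0) ↔ F = PMF.pure 1 ∨ F = PMF.pure Fin.revPerm := by
  refine ⟨fun h => eq_pure_of_meanGain_two hd (h 2), ?_⟩
  rintro (rfl | rfl)
  · exact meanGain_pure (treeEntropy_const_one hd)
  · exact meanGain_pure (treeEntropy_const_revPerm hd)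

/-! ### Fourier coefficients in terms of the sampled gains -/

/-- The mean gain per unit of probability that `l` points do not all fall in the cell of the first
one; this is the sequence in the Fourier coefficients. For `l ≤ 1` the numerator and the denominator
vanish, and so does the quotient. -/
noncomputable def gainRate {d : ℕ} [NeZero d] (F : PMF (Equiv.Perm (Fin d))) (l : ℕ) : ℝ :=
  meanGain F l / (1 - ((d : ℝ) ^ (l - 1))⁻¹)

theorem one_half_le_one_sub_inv_pow {d : ℕ} (hd : 2 ≤ d) {k : ℕ} (hk : k ≠ 0) :
    1 / 2 ≤ 1 - ((d : ℝ) ^ k)⁻¹ := by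
  have hdR : (2 : ℝ) ≤ d := by exact_mod_cast hd
  have h : (2 : ℝ) ≤ (d : ℝ) ^ k := hdR.trans (le_self_pow₀ (by linarith) hk)
  have := inv_anti₀ two_pos h
  linarith

theorem gainRate_nonneg {d : ℕ} [NeZero d] (hd : 2 ≤ d) (F : PMF (Equiv.Perm (Fin d))) (l : ℕ) :
    0 ≤ gainRate F l := by
  have hdR : (1 : ℝ) ≤ d := by exact_mod_cast one_le_two.trans hd
  exact div_nonneg (meanGain_nonneg hd F l) (sub_nonneg.2 (inv_le_one_of_one_le₀ (one_le_pow₀ hdR)))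

theorem isBigO_gainRate {d : ℕ} [NeZero d] (hd : 2 ≤ d) (F : PMF (Equiv.Perm (Fin d))) :
    gainRate F =O[atTop] fun l : ℕ => Real.log (l : ℝ) := by
  refine Asymptotics.IsBigO.of_bound (4 * d) ?_
  filter_upwards [eventually_ge_atTop 2] with l hl
  have hlR : (2 : ℝ) ≤ l := by exact_mod_cast hl
  have hlog : Real.log (l + 1) ≤ 2 * Real.log l := by
    rw [← Real.log_rpow (by positivity)]
    refine Real.log_le_log (by positivity) ?_
    norm_num
    nlinarith
  rw [Real.norm_of_nonneg (gainRate_nonneg hd F l),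
    Real.norm_of_nonneg (Real.log_nonneg (by linarith)), gainRate]
  have hc := one_half_le_one_sub_inv_pow hd (k := l - 1) (by omega)
  have h0 := meanGain_nonneg hd F l
  rw [div_le_iff₀ (by linarith)]
  have h1 : meanGain F l ≤ 2 * d * Real.log l :=
    (meanGain_le hd F l).trans (by nlinarith [(Nat.cast_nonneg d : (0 : ℝ) ≤ d)])
  have hl0 : 0 ≤ Real.log l := Real.log_nonneg (by linarith)
  calc meanGain F l ≤ 4 * d * Real.log l * (1 / 2) := by linarith
    _ ≤ _ := by gcongr

theorem fourierTerm_gainRate {d : ℕ} [NeZero d] (hd : 2 ≤ d) (F : PMF (Equiv.Perm (Fin d))) (r : ℤ)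
    (l : ℕ) : fourierTerm d (gainRate F) r (l + 1) =
      gammaTerm (meanGain F) (Real.log d) r l := by
  have hc := one_half_le_one_sub_inv_pow hd (k := l + 1) (by omega)
  have h0 : 1 - ((d : ℝ) ^ (l + 1))⁻¹ ≠ 0 := by linarith
  have h : gainRate F (l + 1 + 1) * ((1 - ((d : ℝ) ^ (l + 1))⁻¹) /
      ((l + 1 + 1).factorial * Real.log d)) =
      meanGain F (l + 2) / (l + 2).factorial / Real.log d := by
    rw [gainRate, show l + 1 + 1 - 1 = l + 1 by omega, div_mul_div_cancel₀ h0, div_div]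
  rw [fourierTerm, gammaTerm, h]
  push_cast
  rfl

theorem theorem5 (d : ℕ) [NeZero d] (hd : 2 ≤ d) (F : PMF (Equiv.Perm (Fin d))) :
    ∃ (ρ : ℕ → ℝ) (A : ℝ → ℝ),
      (∀ l, 0 ≤ ρ l) ∧
      (ρ =O[atTop] fun l : ℕ => Real.log (l : ℝ)) ∧
      (∀ᵐ S ∂(labellingLaw F), IsLogPeriodicLimit (d : ℝ)
        (fun n : ℕ => samplingEntropy (treePermuton S) n / (n : ℝ)) A) ∧
      (∀ r : ℤ, Summable fun l : ℕ => fourierTerm d ρ r (l + 1)) ∧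
      (∀ x : ℝ, HasSum
        (fun r : ℤ => (∑' l : ℕ, fourierTerm d ρ r (l + 1)) *
          Complex.exp (2 * (Real.pi : ℂ) * Complex.I * (r : ℂ) * (x : ℂ)))
        ((A x : ℝ) : ℂ)) ∧
      IntervalIntegrable A volume 0 1 ∧
      ((∫ x in (0 : ℝ)..1, A x) = 0 ↔ F = PMF.pure 1 ∨ F = PMF.pure Fin.revPerm) := by
  refine ⟨gainRate F, limitProfile F, gainRate_nonneg hd F, isBigO_gainRate hd F, ?_, fun r => ?_,
    fun x => ?_, (continuous_limitProfile hd F).intervalIntegrable 0 1,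
    (integral_limitProfile_eq_zero_iff hd F).trans (forall_meanGain_eq_zero_iff hd F)⟩
  · filter_upwards [ae_tendsto_meanGain hd F] with S hS
    exact isLogPeriodicLimit_limitProfile hd F hS
  · simp only [fourierTerm_gainRate hd]
    exact summable_gammaTerm (by positivity) (meanGain_nonneg hd F) (meanGain_le_rpow hd F)
      (Real.log_pos (by exact_mod_cast hd)) r
  · simp only [fourierTerm_gainRate hd]
    exact hasSum_limitProfile hd F x
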